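/- Let $G$ be a finite subgroup of $\mathrm{SO}(n)$ acting freely on $\mathbb R^n\setminus\{0\}$, and let $h$ and $r$ be the Euclidean metric and the radius function (distance to $0$) on $\mathbb R^n/G$. Let $(X,g)$ be an ALE manifold asymptotic to $\mathbb R^n/G$: $X$ is a noncompact smooth manifold of dimension $n$ with a smooth Riemannian metric $g$, and there is an asymptotic coordinate system, that is, a compact set $S\subset X$, a number $R>0$ and a diffeomorphism $\pi:X\setminus S\to\{z\in\mathbb R^n/G: r(z)>R\}$ such that $S\cup\pi^{-1}(\{R<r\le R'\})$ is compact for every $R'>R$ and $$\nabla^k(\pi_*g-h)=O(r^{-n-k})\quad\text{on }\{r>R\},\text{ for all }k\ge 0,$$ where $\nabla$ is the Levi-Civita connection of $h$, and $T=O(r^{-j})$ means $|T|\le Kr^{-j}$ for some $K>0$. Let $\rho:X\to[1,\infty)$ be a radius function for such a $\pi$: $\rho$ is smooth and $\nabla^k(\pi_*\rho-r)=O(r^{1-n-k})$ on $\{r>R\}$ for all $k\ge0$. For $\beta\in\mathbb R$ and an integer $k\ge0$, let $C^k_\beta(X)$ be the space of functions $f:X\to\mathbb R$ with $k$ continuous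 derivatives such that $\rho^{j-\beta}|\nabla^jf|_g$ is bounded on $X$ for $j=0,\dots,k$, where $\nabla$ is the Levi-Civita connection of $g$, and let $C^\infty_\beta(X)=\bigcap_kC^k_\beta(X)$. Let $\Delta f=-\mathrm{tr}_g\nabla^2f$ be the (nonnegative) Laplacian and $dV_g$ the Riemannian volume measure of $g$. (1) If $\beta,\gamma\in\mathbb R$ satisfy $\beta+\gamma<2-n$, and $u\in C^2_\beta(X)$, $v\in C^2_\gamma(X)$, then $u\,\Delta v$ and $v\,\Delta u$ are integrable and $$\int_Xu\,\Delta v\,dV_g=\int_Xv\,\Delta u\,dV_g.$$ (2) $\Delta(\rho^{2-n})$ lies in $C^\infty_{-2n}(X)$, it is integrable, and $$\int_X\Delta(\rho^{2-n})\,dV_g=\frac{(n-2)\,\Omega_{n-1}}{|G|},$$ where $\Omega_{n-1}$ is the volume of the unit sphere $\mathcal S^{n-1}$ in $\mathbb R^n$. -/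

import Mathlib

open Set MeasureTheory
open scoped Manifold ContDiff Bundle

noncomputable section

namespace ALE

/-! ### Tensor calculus for a metric on Euclidean space

A metric is a field `b` of bilinear forms; a covariant `k`-tensor field is a function
`T : ℝⁿ → (Fin k → ℝⁿ) → ℝ`, multilinear in its second argument. These are the local expressions
that are used below in the charts of a manifold. -/

section Coordinates

variable {n : ℕ}

/-- The Christoffel symbols of the Levi-Civita connection of `b`: the vector `Γ(u, v)` at `z`
determined by `b(Γ(u, v), w) = ½ (∂_u b(v, w) + ∂_v b(u, w) - ∂_w b(u, v))` for all `w`.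
Here `b z` is seen as a linear map from vectors to covectors, and inverted. -/
def christoffel
    (b : EuclideanSpace ℝ (Fin n) →
      EuclideanSpace ℝ (Fin n) →L[ℝ] EuclideanSpace ℝ (Fin n) →L[ℝ] ℝ)
    (z u v : EuclideanSpace ℝ (Fin n)) : EuclideanSpace ℝ (Fin n) :=
  (b z).inverse
    ((1 / 2 : ℝ) • (fderiv ℝ b z u v + fderiv ℝ b z v u - ((fderiv ℝ b z).flip u).flip v))

/-- The covariant derivative `∇T` of a covariant `k`-tensor field `T`, for the Levi-Civita
connection of `b`:
`(∇T)(v₀, v₁, …, v_k) = ∂_{v₀} (T(v₁, …, v_k)) - ∑ l, T(v₁, …, Γ(v₀, v_l), …, v_k)`. -/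
def covDeriv
    (b : EuclideanSpace ℝ (Fin n) →
      EuclideanSpace ℝ (Fin n) →L[ℝ] EuclideanSpace ℝ (Fin n) →L[ℝ] ℝ)
    {k : ℕ} (T : EuclideanSpace ℝ (Fin n) → (Fin k → EuclideanSpace ℝ (Fin n)) → ℝ) :
    EuclideanSpace ℝ (Fin n) → (Fin (k + 1) → EuclideanSpace ℝ (Fin n)) → ℝ :=
  fun z v =>
    fderiv ℝ (fun y => T y (Fin.tail v)) z (v 0)
      - ∑ l : Fin k, T z (Function.update (Fin.tail v) l (christoffel b z (v 0) (Fin.tail v l)))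

/-- The iterated covariant derivative `∇ʲ f` of a function `f`, a covariant `j`-tensor field. -/
def iterCovDeriv
    (b : EuclideanSpace ℝ (Fin n) →
      EuclideanSpace ℝ (Fin n) →L[ℝ] EuclideanSpace ℝ (Fin n) →L[ℝ] ℝ)
    (f : EuclideanSpace ℝ (Fin n) → ℝ) :
    (j : ℕ) → EuclideanSpace ℝ (Fin n) → (Fin j → EuclideanSpace ℝ (Fin n)) → ℝ
  | 0 => fun z _ => f z
  | j + 1 => covDeriv b (iterCovDeriv b f j)

/-- The Laplacian with the sign of geometers, `Δ f = - ∑ i j, b^{ij} (∇² f)_{ij}`. Here `eᵢ` is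
the standard basis, and `(b z).inverse` maps the dual basis covector `eⁱ` to `∑ j, b^{ij} e_j`. -/
def coordLaplacian
    (b : EuclideanSpace ℝ (Fin n) →
      EuclideanSpace ℝ (Fin n) →L[ℝ] EuclideanSpace ℝ (Fin n) →L[ℝ] ℝ)
    (f : EuclideanSpace ℝ (Fin n) → ℝ) (z : EuclideanSpace ℝ (Fin n)) : ℝ :=
  - ∑ i : Fin n, iterCovDeriv b f 2 z
      ![EuclideanSpace.single i 1, (b z).inverse (EuclideanSpace.proj i)]

/-- The density `√(det b_{ij})` of the Riemannian volume with respect to Lebesgue measure. -/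
def volumeDensity
    (b : EuclideanSpace ℝ (Fin n) →
      EuclideanSpace ℝ (Fin n) →L[ℝ] EuclideanSpace ℝ (Fin n) →L[ℝ] ℝ)
    (z : EuclideanSpace ℝ (Fin n)) : ℝ :=
  √(Matrix.det (Matrix.of fun i j : Fin n =>
    b z (EuclideanSpace.single i 1) (EuclideanSpace.single j 1)))

end Coordinates

/-! ### Riemannian manifolds -/

section Riemannian

variable {n : ℕ} {X : Type*} [TopologicalSpace X] [ChartedSpace (EuclideanSpace ℝ (Fin n)) X]
  [IsManifold (𝓡 n) ∞ X]

/-- A smooth Riemannian metric on an `n`-dimensional manifold. -/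
abbrev Metric (n : ℕ) (X : Type*) [TopologicalSpace X]
    [ChartedSpace (EuclideanSpace ℝ (Fin n)) X] [IsManifold (𝓡 n) ∞ X] :=
  Bundle.ContMDiffRiemannianMetric (𝓡 n) ∞ (EuclideanSpace ℝ (Fin n))
    (fun x : X => TangentSpace (𝓡 n) x)

/-- The pull-back `ψ^* g` of a metric under a map `ψ` from `ℝⁿ`:
`(ψ^* g)_z(v, w) = g_{ψ(z)}(dψ_z v, dψ_z w)`. -/
def pullbackMetric (g : Metric n X) (ψ : EuclideanSpace ℝ (Fin n) → X)
    (z : EuclideanSpace ℝ (Fin n)) :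
    EuclideanSpace ℝ (Fin n) →L[ℝ] EuclideanSpace ℝ (Fin n) →L[ℝ] ℝ :=
  let D : EuclideanSpace ℝ (Fin n) →L[ℝ] EuclideanSpace ℝ (Fin n) :=
    mfderiv (𝓡 n) (𝓡 n) ψ z
  let B : EuclideanSpace ℝ (Fin n) →L[ℝ] EuclideanSpace ℝ (Fin n) →L[ℝ] ℝ := g.inner (ψ z)
  B.bilinearComp D D

/-- The local expression of the metric `g` in the chart at the point `p`. -/
def chartMetric (g : Metric n X) (p : X) :
    EuclideanSpace ℝ (Fin n) →
      EuclideanSpace ℝ (Fin n) →L[ℝ] EuclideanSpace ℝ (Fin n) →L[ℝ] ℝ :=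
  pullbackMetric g (extChartAt (𝓡 n) p).symm

/-- The value `(∇ʲ f)(x)` of the iterated covariant derivative of `f` for the Levi-Civita
connection of `g`, a `j`-linear form on the tangent space at `x`, computed in the chart at `x`. -/
def nablaIter (g : Metric n X) (f : X → ℝ) (j : ℕ) (x : X)
    (v : Fin j → TangentSpace (𝓡 n) x) : ℝ :=
  iterCovDeriv (chartMetric g x) (f ∘ (extChartAt (𝓡 n) x).symm) j (extChartAt (𝓡 n) x x)
    (fun i => mfderiv (𝓡 n) (𝓡 n) (extChartAt (𝓡 n) x) x (v i))

/-- The Laplacian `Δ f = - tr_g ∇² f` of `g`, which is `d^* d f`, computed at `x` in the chart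
at `x`. -/
def laplacian (g : Metric n X) (f : X → ℝ) (x : X) : ℝ :=
  coordLaplacian (chartMetric g x) (f ∘ (extChartAt (𝓡 n) x).symm) (extChartAt (𝓡 n) x x)

/-- The Riemannian volume in the domain of the chart at `p`, extended by zero: it has density
`√(det g_{ij})` in that chart. -/
def chartVolume [MeasurableSpace X] (g : Metric n X) (p : X) : Measure X :=
  (((volume : Measure (EuclideanSpace ℝ (Fin n))).withDensity
      fun z => ENNReal.ofReal (volumeDensity (chartMetric g p) z)).restrict
    (extChartAt (𝓡 n) p).target).map (extChartAt (𝓡 n) p).symm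

/-- The Riemannian volume measure of `g`: the least measure that dominates all the volumes
`chartVolume g p`. As these agree on the overlaps of the charts, and as countably many charts
cover a second countable manifold, it restricts to `chartVolume g p` on the domain of the chart
at `p`. -/
def riemannianVolume [MeasurableSpace X] (g : Metric n X) : Measure X :=
  ⨆ p : X, chartVolume g p

/-- The space `C^k_β(X)` for the weight function `ρ`: the functions `f` with `k` continuous
derivatives for which `ρ^{j-β} |∇ʲ f|_g` is bounded on `X` for `j = 0, …, k`. The bound
is written as `|(∇ʲ f)(v₁, …, v_j)| ≤ C ρ^{β-j} |v₁|_g ⋯ |v_j|_g` for all tangent vectors. -/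
def weightedC (g : Metric n X) (ρ : X → ℝ) (k : ℕ) (β : ℝ) : Set (X → ℝ) :=
  {f | ContMDiff (𝓡 n) 𝓘(ℝ, ℝ) k f ∧
    ∀ j ≤ k, ∃ C : ℝ, ∀ (x : X) (v : Fin j → TangentSpace (𝓡 n) x),
      |nablaIter g f j x v| ≤ C * ρ x ^ (β - j) * ∏ i, √(g.inner x (v i) (v i))}

/-- The space `C^∞_β(X)`, the intersection of all the `C^k_β(X)`. -/
def weightedCInfty (g : Metric n X) (ρ : X → ℝ) (β : ℝ) : Set (X → ℝ) :=
  ⋂ k : ℕ, weightedC g ρ k β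

end Riemannian

/-! ### ALE manifolds -/

section ALE

variable {n : ℕ}

/-- `G` is a subgroup of `SO(n)` that acts freely on `ℝⁿ \ {0}`. -/
structure IsFreeRotationGroup
    (G : Subgroup (EuclideanSpace ℝ (Fin n) ≃ₗᵢ[ℝ] EuclideanSpace ℝ (Fin n))) : Prop where
  det_eq_one : ∀ a ∈ G, LinearMap.det
    (a.toLinearEquiv : EuclideanSpace ℝ (Fin n) →ₗ[ℝ] EuclideanSpace ℝ (Fin n)) = 1
  free : ∀ a ∈ G, ∀ z : EuclideanSpace ℝ (Fin n), z ≠ 0 → a z = z → a = 1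

/-- The relation of lying in the same orbit of `G`. -/
def orbitSetoid (G : Subgroup (EuclideanSpace ℝ (Fin n) ≃ₗᵢ[ℝ] EuclideanSpace ℝ (Fin n))) :
    Setoid (EuclideanSpace ℝ (Fin n)) where
  r z w := ∃ a ∈ G, a z = w
  iseqv :=
    { refl := fun _ => ⟨1, G.one_mem, rfl⟩
      symm := by
        rintro z _ ⟨a, ha, rfl⟩
        exact ⟨a⁻¹, G.inv_mem ha, a.symm_apply_apply z⟩
      trans := by
        rintro z _ _ ⟨a, ha, rfl⟩ ⟨c, hc, rfl⟩
        exact ⟨c * a, G.mul_mem hc ha, rfl⟩ }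

/-- The quotient `ℝⁿ/G`. -/
abbrev EuclideanQuotient
    (G : Subgroup (EuclideanSpace ℝ (Fin n) ≃ₗᵢ[ℝ] EuclideanSpace ℝ (Fin n))) :=
  Quotient (orbitSetoid G)

/-- The radius function `r` on `ℝⁿ/G`. -/
def radius (G : Subgroup (EuclideanSpace ℝ (Fin n) ≃ₗᵢ[ℝ] EuclideanSpace ℝ (Fin n))) :
    EuclideanQuotient G → ℝ :=
  Quotient.lift (fun z => ‖z‖) (by
    rintro z _ ⟨a, _, rfl⟩
    exact (a.norm_map z).symm)

variable {X : Type*} [TopologicalSpace X] [ChartedSpace (EuclideanSpace ℝ (Fin n)) X]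
  [IsManifold (𝓡 n) ∞ X]

/-- An asymptotic coordinate system `π : X \ S → {r > R} ⊆ ℝⁿ/G` that makes `(X, g)` an ALE
manifold asymptotic to `ℝⁿ/G`.

The smooth structure, the metric and the connection of `(ℝⁿ \ {0})/G` are those for which
the quotient map from `ℝⁿ \ {0}` is a local isometry. So they are expressed upstairs, through
`lift`, the composition of the quotient map `{‖z‖ > R} → {r > R}` with the inverse of `π`
(its values elsewhere play no role): the bijection `π` is a diffeomorphism if and only if `lift`
is a local diffeomorphism, and the pull-back of `π_* g` to `{‖z‖ > R}` is `lift^* g`. -/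
structure AsymptoticCoordinates (g : Metric n X)
    (G : Subgroup (EuclideanSpace ℝ (Fin n) ≃ₗᵢ[ℝ] EuclideanSpace ℝ (Fin n))) where
  /-- The compact set `S`. -/
  core : Set X
  isCompact_core : IsCompact core
  /-- The inner radius `R` of the end. -/
  R : ℝ
  R_pos : 0 < R
  /-- The map `π` (its values on `S` play no role). -/
  toQuotient : X → EuclideanQuotient G
  bijOn : BijOn toQuotient coreᶜ {q | R < radius G q}
  /-- The map `z ↦ π⁻¹(Gz)`. -/
  lift : EuclideanSpace ℝ (Fin n) → X
  lift_mem : ∀ z, R < ‖z‖ → lift z ∈ coreᶜ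
  toQuotient_lift : ∀ z, R < ‖z‖ → toQuotient (lift z) = Quotient.mk (orbitSetoid G) z
  isLocalDiffeomorphOn : IsLocalDiffeomorphOn (𝓡 n) (𝓡 n) ∞ lift {z | R < ‖z‖}
  /-- The only end of `X` is the one at `r = ∞`: nothing of `X` is missing at `r = R`. -/
  isCompact_inner : ∀ R' > R, IsCompact (core ∪ {x ∈ coreᶜ | radius G (toQuotient x) ≤ R'})
  /-- `∇ᵏ(π_* g - h) = O(r^{-n-k})` on `{r > R}` for all `k`, with `h` the Euclidean metric. In
  the coordinates of `ℝⁿ` the connection `∇` of `h` is given by the usual derivatives, and the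
  components of the tensor are `(lift^* g)_{ij} - δ_{ij}`. -/
  metric_decay : ∀ (k : ℕ) (i j : Fin n), ∃ K > 0, ∀ z : EuclideanSpace ℝ (Fin n), R < ‖z‖ →
    ‖iteratedFDeriv ℝ k (fun y =>
        pullbackMetric g lift y (EuclideanSpace.single i 1) (EuclideanSpace.single j 1)
          - if i = j then 1 else 0) z‖
      ≤ K * ‖z‖ ^ (-(n : ℝ) - k)

/-- `ρ : X → [1, ∞)` is a radius function, with respect to the asymptotic coordinates `c`:
it is smooth, and `∇ᵏ(π_* ρ - r) = O(r^{1-n-k})` on `{r > R}` for all `k`. -/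
structure AsymptoticCoordinates.IsRadiusFunction {g : Metric n X}
    {G : Subgroup (EuclideanSpace ℝ (Fin n) ≃ₗᵢ[ℝ] EuclideanSpace ℝ (Fin n))}
    (c : AsymptoticCoordinates g G) (ρ : X → ℝ) : Prop where
  contMDiff : ContMDiff (𝓡 n) 𝓘(ℝ, ℝ) ∞ ρ
  one_le : ∀ x, 1 ≤ ρ x
  decay : ∀ k : ℕ, ∃ K > 0, ∀ z : EuclideanSpace ℝ (Fin n), c.R < ‖z‖ →
    ‖iteratedFDeriv ℝ k (fun y => ρ (c.lift y) - ‖y‖) z‖ ≤ K * ‖z‖ ^ (1 - (n : ℝ) - k)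

end ALE

/-- The volume `Ω_{n-1}` of the unit sphere of `ℝⁿ`. -/
def sphereVolume (n : ℕ) : ℝ :=
  (volume : Measure (EuclideanSpace ℝ (Fin n))).toSphere.real univ

end ALE

end

noncomputable section

namespace ALE

open scoped Topology

set_option maxSynthPendingDepth 3
set_option linter.unusedSectionVars false
set_option synthInstance.maxHeartbeats 100000

/-! Everything follows from Green's second identity ∫ (φ Δf - f Δφ) dV = 0 for φ of compact support.
It is the divergence theorem in a chart (`IsMetricOn.setIntegral_green`), patched by a partition of
unity (`integral_greenIntegrand`), and it has no boundary term. It is applied with cutoff functions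
χ_k, equal to 1 for r ≤ k and to 0 for r ≥ 2k, which are rescalings of one bump. By scaling, the
derivatives of order j = 1, 2 of χ_k are O(r^{-j}) with constants independent of k
(`exists_cutoff_bound`), and they vanish for r < k. The end of X is covered |G| times by {‖z‖ > t}
in ℝⁿ, with bounded volume density (`paramVolume_lift`). So a continuous function that is O(r^δ)
with δ < -n is integrable; and if a sequence of functions has such a common bound and its k-th
member vanishes for r < k, the integrals tend to 0 by dominated convergence.

For (1), u Δv and v Δu are O(r^{β+γ-2}), and β + γ - 2 < -n. Green's identity for χ_k u and v turns
∫ χ_k (u Δv - v Δu) into the integral of the commutator v (Δ(χ_k u) - χ_k Δu). Only derivatives of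
χ_k occur in it, so it is O(r^{β+γ-2}) uniformly in k and lives in r ≥ k; its integral tends to 0
(`integral_mul_laplacian_eq`).

For (2), r^{2-n} is harmonic for the Euclidean metric, and exchanging h for g and r for ρ costs a
relative error O(r^{-n}) that survives differentiation. Hence Δ(ρ^{2-n}) has order -n - n = -2n
(`IsFlatEnd.isSymbol_metricLaplacian_rpow`). Its integral is the limit of ∫ χ_k Δ(ρ^{2-n}) = ∫
ρ^{2-n} Δχ_k. The latter lives in the end, and upstairs its integrand differs from the Euclidean
‖z‖^{2-n} Δ₀χ_k by O(‖z‖^{-2n}), so that the difference of the integrals tends to 0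
(`tendsto_integral_error`). Polar coordinates give exactly (n - 2) Ω_{n-1} for the Euclidean
integral, whatever k (`integral_norm_rpow_mul_flatLaplacian_cutoff`); the factor 1/|G| comes from
the covering.

Orders of decay are tracked by symbols: functions outside a ball whose k-th derivative is
O(‖z‖^{m-k}). They are stable under products, powers, inversion of the metric and covariant
derivatives. Objects on X are transferred to ℝⁿ through parametrizations, that is, smooth immersions
of open sets, under which covariant derivatives, Laplacian and volume are natural. Inverse charts
and the map `lift` of the asymptotic coordinates are both of this kind. -/

lemma contDiffOn_bilin {E F G H : Type*} [NormedAddCommGroup E] [NormedSpace ℝ E]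
    [NormedAddCommGroup F] [NormedSpace ℝ F] [NormedAddCommGroup G] [NormedSpace ℝ G]
    [NormedAddCommGroup H] [NormedSpace ℝ H] (B : F →L[ℝ] G →L[ℝ] H) {f : E → F} {g : E → G}
    {U : Set E} {m : WithTop ℕ∞} (hf : ContDiffOn ℝ m f U) (hg : ContDiffOn ℝ m g U) :
    ContDiffOn ℝ m (fun z => B (f z) (g z)) U :=
  (B.contDiff.comp_contDiffOn hf).clm_apply hg

/-! ### Christoffel symbols and covariant derivatives with values in spaces of tensors -/

section Tensors

variable {E : Type*} [NormedAddCommGroup E] [NormedSpace ℝ E]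

/-- `b` is a smooth Riemannian metric on the open set `U`. -/
structure IsMetricOn (b : E → E →L[ℝ] E →L[ℝ] ℝ) (U : Set E) : Prop where
  isOpen : IsOpen U
  contDiffOn : ContDiffOn ℝ ∞ b U
  symm : ∀ z ∈ U, ∀ v w, b z v w = b z w v
  pos : ∀ z ∈ U, ∀ v, v ≠ 0 → 0 < b z v v

/-- Definiteness gives injectivity, and equality of dimensions does the rest. This is what makes
`ContinuousLinearMap.inverse` of a metric a true inverse and not its default value `0`. -/
lemma exists_equiv_of_pos [FiniteDimensional ℝ E] {B : E →L[ℝ] E →L[ℝ] ℝ}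
    (h : ∀ v, v ≠ 0 → 0 < B v v) : ∃ e : E ≃L[ℝ] (E →L[ℝ] ℝ), (e : E →L[ℝ] (E →L[ℝ] ℝ)) = B := by
  have hinj : Function.Injective (B : E →ₗ[ℝ] (E →L[ℝ] ℝ)) := by
    rw [injective_iff_map_eq_zero]
    intro v hv
    by_contra hne
    have := h v hne
    have h2 : B v = 0 := hv
    simp [h2] at this
  have hfr : Module.finrank ℝ E = Module.finrank ℝ (E →L[ℝ] ℝ) := by
    rw [← (LinearMap.toContinuousLinearMap (𝕜 := ℝ) (E := E) (F' := ℝ)).finrank_eq]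
    exact (Subspace.dual_finrank_eq (K := ℝ) (V := E)).symm
  refine ⟨(LinearEquiv.ofInjectiveOfFinrankEq (B : E →ₗ[ℝ] (E →L[ℝ] ℝ)) hinj
    hfr).toContinuousLinearEquiv, ?_⟩
  ext v w
  rfl

lemma IsMetricOn.exists_equiv [FiniteDimensional ℝ E] {b : E → E →L[ℝ] E →L[ℝ] ℝ} {U : Set E}
    (hb : IsMetricOn b U) {z : E} (hz : z ∈ U) :
    ∃ e : E ≃L[ℝ] (E →L[ℝ] ℝ), (e : E →L[ℝ] (E →L[ℝ] ℝ)) = b z :=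
  exists_equiv_of_pos (hb.pos z hz)

lemma IsMetricOn.apply_inverse [FiniteDimensional ℝ E] {b : E → E →L[ℝ] E →L[ℝ] ℝ} {U : Set E}
    (hb : IsMetricOn b U) {z : E} (hz : z ∈ U) (α : E →L[ℝ] ℝ) :
    b z ((b z).inverse α) = α := by
  obtain ⟨e, he⟩ := hb.exists_equiv hz
  rw [← he, ContinuousLinearMap.inverse_equiv]
  simp

lemma IsMetricOn.inverse_apply [FiniteDimensional ℝ E] {b : E → E →L[ℝ] E →L[ℝ] ℝ} {U : Set E}
    (hb : IsMetricOn b U) {z : E} (hz : z ∈ U) (v : E) :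
    (b z).inverse (b z v) = v := by
  obtain ⟨e, he⟩ := hb.exists_equiv hz
  rw [← he, ContinuousLinearMap.inverse_equiv]
  simp

lemma IsMetricOn.injective [FiniteDimensional ℝ E] {b : E → E →L[ℝ] E →L[ℝ] ℝ} {U : Set E}
    (hb : IsMetricOn b U) {z : E} (hz : z ∈ U) : Function.Injective (b z) :=
  Function.LeftInverse.injective (g := (b z).inverse) (hb.inverse_apply hz)

lemma IsMetricOn.inverse_symm [FiniteDimensional ℝ E] {b : E → E →L[ℝ] E →L[ℝ] ℝ} {U : Set E}
    (hb : IsMetricOn b U) {z : E} (hz : z ∈ U) (α β : E →L[ℝ] ℝ) :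
    α ((b z).inverse β) = β ((b z).inverse α) := by
  conv_lhs => rw [← hb.apply_inverse hz α]
  conv_rhs => rw [← hb.apply_inverse hz β]
  exact hb.symm z hz _ _

lemma IsMetricOn.contDiffOn_inverse [FiniteDimensional ℝ E] {b : E → E →L[ℝ] E →L[ℝ] ℝ}
    {U : Set E} (hb : IsMetricOn b U) : ContDiffOn ℝ ∞ (fun z => (b z).inverse) U := by
  intro z hz
  have : CompleteSpace E := FiniteDimensional.complete ℝ E
  obtain ⟨e, he⟩ := hb.exists_equiv hz
  have h1 : ContDiffAt ℝ ∞ ContinuousLinearMap.inverse (b z) := he ▸ contDiffAt_map_inverse e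
  exact h1.comp_contDiffWithinAt z (hb.contDiffOn z hz)

variable (E) in
/-- `B ↦ ((u, v, w) ↦ ½ (B(u, v, w) + B(v, u, w) - B(w, u, v)))`. -/
def christoffelSymm : (E →L[ℝ] E →L[ℝ] E →L[ℝ] ℝ) →L[ℝ] (E →L[ℝ] E →L[ℝ] E →L[ℝ] ℝ) :=
  let F : (E →L[ℝ] E →L[ℝ] E →L[ℝ] ℝ) →L[ℝ] (E →L[ℝ] E →L[ℝ] E →L[ℝ] ℝ) :=
    (ContinuousLinearMap.flipₗᵢ ℝ E E (E →L[ℝ] ℝ) :)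
  let F' : (E →L[ℝ] E →L[ℝ] ℝ) →L[ℝ] (E →L[ℝ] E →L[ℝ] ℝ) := (ContinuousLinearMap.flipₗᵢ ℝ E E ℝ :)
  (1 / 2 : ℝ) • (ContinuousLinearMap.id ℝ _ + F - ContinuousLinearMap.compL ℝ E _ _ F' ∘L F)

lemma christoffelSymm_apply (B : E →L[ℝ] E →L[ℝ] E →L[ℝ] ℝ) (u v : E) :
    christoffelSymm E B u v = (1 / 2 : ℝ) • (B u v + B v u - (B.flip u).flip v) := rfl

variable (E) in
/-- The Christoffel symbols, as a bilinear function of the inverse metric and the first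
derivatives of the metric. -/
def christoffelBilin : ((E →L[ℝ] ℝ) →L[ℝ] E) →L[ℝ] (E →L[ℝ] E →L[ℝ] E →L[ℝ] ℝ) →L[ℝ]
    (E →L[ℝ] E →L[ℝ] E) :=
  ContinuousLinearMap.bilinearComp
    (ContinuousLinearMap.compL ℝ E (E →L[ℝ] E →L[ℝ] ℝ) (E →L[ℝ] E) ∘L
      ContinuousLinearMap.compL ℝ E (E →L[ℝ] ℝ) E)
    (ContinuousLinearMap.id ℝ _) (christoffelSymm E)

lemma christoffelBilin_apply (I : (E →L[ℝ] ℝ) →L[ℝ] E) (B : E →L[ℝ] E →L[ℝ] E →L[ℝ] ℝ) (u v : E) :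
    christoffelBilin E I B u v = I (christoffelSymm E B u v) := rfl

/-- The Christoffel symbols of `b` as a tensor-valued function. -/
def christoffelTensor (b : E → E →L[ℝ] E →L[ℝ] ℝ) (z : E) : E →L[ℝ] E →L[ℝ] E :=
  christoffelBilin E (b z).inverse (fderiv ℝ b z)

lemma IsMetricOn.contDiffOn_christoffelTensor [FiniteDimensional ℝ E] {b : E → E →L[ℝ] E →L[ℝ] ℝ}
    {U : Set E} (hb : IsMetricOn b U) : ContDiffOn ℝ ∞ (christoffelTensor b) U := by
  have h1 : ContDiffOn ℝ ∞ (fderiv ℝ b) U := hb.contDiffOn.fderiv_of_isOpen hb.isOpen (by simp)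
  exact contDiffOn_bilin (christoffelBilin E) hb.contDiffOn_inverse h1

variable (E) in
/-- The action of endomorphisms on covariant tensors, `(A, M) ↦ ∑ l, M(…, A v_l, …)`. -/
def derivationAction (k : ℕ) : (E →L[ℝ] E) →L[ℝ] (E [×k]→L[ℝ] ℝ) →L[ℝ] (E [×k]→L[ℝ] ℝ) :=
  ∑ l : Fin k, (ContinuousMultilinearMap.compContinuousLinearMapContinuousMultilinear ℝ
    (fun _ : Fin k => E) (fun _ : Fin k => E) ℝ).toContinuousLinearMap
      (fun _ => ContinuousLinearMap.id ℝ E) l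

lemma derivationAction_apply {k : ℕ} (A : E →L[ℝ] E) (M : E [×k]→L[ℝ] ℝ) (v : Fin k → E) :
    derivationAction E k A M v = ∑ l, M (Function.update v l (A (v l))) := by
  simp only [derivationAction, sum_apply]
  refine Finset.sum_congr rfl fun l _ => ?_
  simp only [ContinuousMultilinearMap.toContinuousLinearMap_apply]
  rw [ContinuousMultilinearMap.compContinuousLinearMapContinuousMultilinear_apply_apply,
    ContinuousMultilinearMap.compContinuousLinearMap_apply]
  congr 1
  ext1 i
  by_cases h : i = l
  · subst h; simp
  · simp [h]

variable (E) in
/-- The zeroth order part of the covariant derivative of covariant tensors. -/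
def connectionBilin (k : ℕ) : (E →L[ℝ] E →L[ℝ] E) →L[ℝ] (E [×k]→L[ℝ] ℝ) →L[ℝ]
    (E →L[ℝ] (E [×k]→L[ℝ] ℝ)) :=
  let F : (E →L[ℝ] (E [×k]→L[ℝ] ℝ) →L[ℝ] (E [×k]→L[ℝ] ℝ)) →L[ℝ]
      ((E [×k]→L[ℝ] ℝ) →L[ℝ] E →L[ℝ] (E [×k]→L[ℝ] ℝ)) :=
    (ContinuousLinearMap.flipₗᵢ ℝ E (E [×k]→L[ℝ] ℝ) (E [×k]→L[ℝ] ℝ) :)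
  F ∘L ContinuousLinearMap.compL ℝ E (E →L[ℝ] E) _ (derivationAction E k)

lemma connectionBilin_apply {k : ℕ} (Γ : E →L[ℝ] E →L[ℝ] E) (M : E [×k]→L[ℝ] ℝ) (u : E) :
    connectionBilin E k Γ M u = derivationAction E k (Γ u) M := rfl

variable (E) in
/-- Uncurrying of the first variable, as a continuous linear map. -/
def uncurryL (k : ℕ) : (E →L[ℝ] (E [×k]→L[ℝ] ℝ)) →L[ℝ] (E [×(k + 1)]→L[ℝ] ℝ) :=
  ((continuousMultilinearCurryLeftEquiv ℝ (fun _ : Fin (k + 1) => E) ℝ).symm :)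

lemma uncurryL_apply {k : ℕ} (A : E →L[ℝ] (E [×k]→L[ℝ] ℝ)) (v : Fin (k + 1) → E) :
    uncurryL E k A v = A (v 0) (Fin.tail v) := rfl

/-- The covariant derivative of a tensor field, for the connection with Christoffel symbols `Γ`. -/
def covDerivTensor (Γ : E → E →L[ℝ] E →L[ℝ] E) {k : ℕ} (M : E → E [×k]→L[ℝ] ℝ) (z : E) :
    E [×(k + 1)]→L[ℝ] ℝ :=
  uncurryL E k (fderiv ℝ M z - connectionBilin E k (Γ z) (M z))

lemma covDerivTensor_apply (Γ : E → E →L[ℝ] E →L[ℝ] E) {k : ℕ} (M : E → E [×k]→L[ℝ] ℝ) (z : E)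
    (v : Fin (k + 1) → E) :
    covDerivTensor Γ M z v = fderiv ℝ M z (v 0) (Fin.tail v)
      - ∑ l, M z (Function.update (Fin.tail v) l (Γ z (v 0) (Fin.tail v l))) := by
  rw [covDerivTensor, uncurryL_apply]
  simp [connectionBilin_apply, derivationAction_apply]

/-- The iterated covariant derivative of a function, as a tensor-valued function. -/
def iterCovDerivTensor (Γ : E → E →L[ℝ] E →L[ℝ] E) (f : E → ℝ) : (k : ℕ) → E → E [×k]→L[ℝ] ℝ
  | 0 => fun z => (continuousMultilinearCurryFin0 ℝ E ℝ).symm (f z)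
  | k + 1 => covDerivTensor Γ (iterCovDerivTensor Γ f k)

lemma contDiffOn_covDerivTensor {Γ : E → E →L[ℝ] E →L[ℝ] E} {k : ℕ} {M : E → E [×k]→L[ℝ] ℝ}
    {U : Set E} (hU : IsOpen U) (hΓ : ContDiffOn ℝ ∞ Γ U) {m n : ℕ∞} (hmn : m + 1 ≤ n)
    (hM : ContDiffOn ℝ n M U) : ContDiffOn ℝ m (covDerivTensor Γ M) U := by
  have h1 : ContDiffOn ℝ m (fderiv ℝ M) U := hM.fderiv_of_isOpen hU (by exact_mod_cast hmn)
  have h2 : ContDiffOn ℝ m M U := hM.of_le (by exact_mod_cast le_self_add.trans hmn)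
  have h3 : ContDiffOn ℝ m Γ U := hΓ.of_le (by exact_mod_cast le_top)
  exact (uncurryL E k).contDiff.comp_contDiffOn
    (h1.sub (contDiffOn_bilin (connectionBilin E k) h3 h2))

lemma contDiffOn_iterCovDerivTensor {Γ : E → E →L[ℝ] E →L[ℝ] E} {f : E → ℝ} {U : Set E}
    (hU : IsOpen U) (hΓ : ContDiffOn ℝ ∞ Γ U) (k : ℕ) {m n : ℕ∞} (hmn : m + k ≤ n)
    (hf : ContDiffOn ℝ n f U) : ContDiffOn ℝ m (iterCovDerivTensor Γ f k) U := by
  induction k generalizing m with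
  | zero =>
    have : ContDiffOn ℝ m f U := hf.of_le (by simpa using hmn)
    exact ((continuousMultilinearCurryFin0 ℝ E ℝ).symm.contDiff).comp_contDiffOn this
  | succ k ih =>
    refine contDiffOn_covDerivTensor hU hΓ le_rfl (ih (m := m + 1) ?_)
    rw [add_assoc, add_comm 1]
    exact_mod_cast hmn

end Tensors

/-! ### Naturality of the Levi-Civita connection under local isometries -/

section Covariance

variable {E : Type*} [NormedAddCommGroup E] [NormedSpace ℝ E] [FiniteDimensional ℝ E]

/-- The transformation law of Christoffel symbols. Differentiating the pull-back relation gives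
`key`; in the combination that defines the symbols, the second derivatives of `τ` cancel by
symmetry, except for two equal terms that form the inhomogeneous part. -/
lemma christoffelTensor_comp {b b' : E → E →L[ℝ] E →L[ℝ] ℝ} {τ : E → E} {U V : Set E}
    (hb : IsMetricOn b V) (hb' : IsMetricOn b' U) (hτ : ContDiffOn ℝ ∞ τ U) (hmaps : MapsTo τ U V)
    (hpull : ∀ z ∈ U, ∀ v w, b' z v w = b (τ z) (fderiv ℝ τ z v) (fderiv ℝ τ z w))
    {z : E} (hz : z ∈ U) (u v : E) :
    fderiv ℝ τ z (christoffelTensor b' z u v) =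
      christoffelTensor b (τ z) (fderiv ℝ τ z u) (fderiv ℝ τ z v)
        + fderiv ℝ (fderiv ℝ τ) z u v := by
  have hUn : U ∈ 𝓝 z := hb'.isOpen.mem_nhds hz
  have hVn : V ∈ 𝓝 (τ z) := hb.isOpen.mem_nhds (hmaps hz)
  have hτz : ContDiffAt ℝ ∞ τ z := hτ.contDiffAt hUn
  have hD : HasFDerivAt (fderiv ℝ τ) (fderiv ℝ (fderiv ℝ τ) z) z :=
    ((hτz.fderiv_right (m := 1) (by norm_cast)).differentiableAt (by simp)).hasFDerivAt
  have hτd : HasFDerivAt τ (fderiv ℝ τ z) z := (hτz.differentiableAt (by simp)).hasFDerivAt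
  have hbd : HasFDerivAt b (fderiv ℝ b (τ z)) (τ z) :=
    ((hb.contDiffOn.contDiffAt hVn).differentiableAt (by simp)).hasFDerivAt
  have hbd' : HasFDerivAt b' (fderiv ℝ b' z) z :=
    ((hb'.contDiffOn.contDiffAt hUn).differentiableAt (by simp)).hasFDerivAt
  have hsymm : ∀ x y, fderiv ℝ (fderiv ℝ τ) z x y = fderiv ℝ (fderiv ℝ τ) z y x :=
    (hτz.isSymmSndFDerivAt (by simp; norm_cast)).eq
  have hinj : Function.Injective (fderiv ℝ τ z) := by
    rw [injective_iff_map_eq_zero]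
    intro x hx
    by_contra hne
    have := hb'.pos z hz x hne
    rw [hpull z hz, hx] at this
    simp at this
  have hsurj : Function.Surjective (fderiv ℝ τ z) :=
    (LinearMap.injective_iff_surjective (f := (fderiv ℝ τ z : E →ₗ[ℝ] E))).1 hinj
  have key : ∀ x y w, fderiv ℝ b' z x y w =
      fderiv ℝ b (τ z) (fderiv ℝ τ z x) (fderiv ℝ τ z y) (fderiv ℝ τ z w)
      + b (τ z) (fderiv ℝ (fderiv ℝ τ) z x y) (fderiv ℝ τ z w)
      + b (τ z) (fderiv ℝ τ z y) (fderiv ℝ (fderiv ℝ τ) z x w) := by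
    intro x y w
    have h1 : HasFDerivAt (fun p => b' p y w) _ z :=
      (hbd'.clm_apply (hasFDerivAt_const y z)).clm_apply (hasFDerivAt_const w z)
    have h2 : HasFDerivAt (fun p => b (τ p) (fderiv ℝ τ p y) (fderiv ℝ τ p w)) _ z :=
      ((hbd.comp z hτd).clm_apply (hD.clm_apply (hasFDerivAt_const y z))).clm_apply
        (hD.clm_apply (hasFDerivAt_const w z))
    have h3 := h1.unique (h2.congr_of_eventuallyEq
      (Filter.eventually_of_mem hUn fun p hp => hpull p hp y w))
    have h4 := DFunLike.congr_fun h3 x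
    simp at h4
    rw [h4]; ring
  -- Vectors are equal once their pairings with the metric are, and it suffices to pair with vectors
  -- in the image of `fderiv ℝ τ z`, which is everything.
  apply hb.injective (hmaps hz)
  ext w'
  obtain ⟨w, rfl⟩ := hsurj w'
  rw [← hpull z hz]
  simp only [christoffelTensor, christoffelBilin_apply, christoffelSymm_apply, map_add,
    add_apply]
  rw [hb'.apply_inverse hz, hb.apply_inverse (hmaps hz)]
  simp only [smul_apply, sub_apply,
    add_apply, ContinuousLinearMap.flip_apply, key, smul_eq_mul]
  rw [hsymm v u, hsymm w u, hsymm w v,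
    hb.symm _ (hmaps hz) (fderiv ℝ τ z u) (fderiv ℝ (fderiv ℝ τ) z v w),
    hb.symm _ (hmaps hz) (fderiv ℝ τ z v) (fderiv ℝ (fderiv ℝ τ) z u w)]
  ring

/-- Differentiating the pulled-back tensor produces one term with a second derivative of `τ` for
each slot. These are exactly cancelled by the inhomogeneous terms of `christoffelTensor_comp`. -/
lemma iterCovDerivTensor_comp {b b' : E → E →L[ℝ] E →L[ℝ] ℝ} {τ : E → E} {U V : Set E}
    (hb : IsMetricOn b V) (hb' : IsMetricOn b' U) (hτ : ContDiffOn ℝ ∞ τ U) (hmaps : MapsTo τ U V)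
    (hpull : ∀ z ∈ U, ∀ v w, b' z v w = b (τ z) (fderiv ℝ τ z v) (fderiv ℝ τ z w))
    {f f' : E → ℝ} (hff' : ∀ z ∈ U, f' z = f (τ z)) {k : ℕ} (hf : ContDiffOn ℝ k f V)
    {z : E} (hz : z ∈ U) (v : Fin k → E) :
    iterCovDerivTensor (christoffelTensor b') f' k z v =
      iterCovDerivTensor (christoffelTensor b) f k (τ z) (fun i => fderiv ℝ τ z (v i)) := by
  induction k generalizing z with
  | zero => simp [iterCovDerivTensor, hff' z hz]
  | succ k ih =>
    have hUn : U ∈ 𝓝 z := hb'.isOpen.mem_nhds hz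
    have hVn : V ∈ 𝓝 (τ z) := hb.isOpen.mem_nhds (hmaps hz)
    have hτz : ContDiffAt ℝ ∞ τ z := hτ.contDiffAt hUn
    have hD : HasFDerivAt (fderiv ℝ τ) (fderiv ℝ (fderiv ℝ τ) z) z :=
      ((hτz.fderiv_right (m := 1) (by norm_cast)).differentiableAt (by simp)).hasFDerivAt
    have hτd : HasFDerivAt τ (fderiv ℝ τ z) z := (hτz.differentiableAt (by simp)).hasFDerivAt
    set M := iterCovDerivTensor (christoffelTensor b) f k with hM
    set M' := iterCovDerivTensor (christoffelTensor b') f' k with hM'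
    have hMc : ContDiffOn ℝ 1 M V :=
      contDiffOn_iterCovDerivTensor (m := 1) (n := (k + 1 : ℕ)) hb.isOpen
        hb.contDiffOn_christoffelTensor k (by rw [add_comm]; norm_cast) hf
    have hf'c : ContDiffOn ℝ (k + 1 : ℕ) f' U :=
      (hf.comp (hτ.of_le (by exact_mod_cast le_top)) hmaps).congr hff'
    have hMc' : ContDiffOn ℝ 1 M' U :=
      contDiffOn_iterCovDerivTensor (m := 1) (n := (k + 1 : ℕ)) hb'.isOpen
        hb'.contDiffOn_christoffelTensor k (by rw [add_comm]; norm_cast) hf'c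
    have hMd : HasFDerivAt M (fderiv ℝ M (τ z)) (τ z) :=
      ((hMc.contDiffAt hVn).differentiableAt (by simp)).hasFDerivAt
    have hMd' : HasFDerivAt M' (fderiv ℝ M' z) z :=
      ((hMc'.contDiffAt hUn).differentiableAt (by simp)).hasFDerivAt
    have ih' : ∀ p ∈ U, ∀ w, M' p w = M (τ p) (fun i => fderiv ℝ τ p (w i)) := fun p hp w =>
      ih (hf.of_le (by exact_mod_cast Nat.le_succ k)) hp w
    set w : Fin k → E := Fin.tail v with hw
    have hder : fderiv ℝ M' z (v 0) w =
        fderiv ℝ M (τ z) (fderiv ℝ τ z (v 0)) (fun i => fderiv ℝ τ z (w i))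
        + ∑ l, M (τ z) (Function.update (fun i => fderiv ℝ τ z (w i)) l
            (fderiv ℝ (fderiv ℝ τ) z (v 0) (w l))) := by
      have h1 : HasFDerivAt (fun p => M' p w) _ z := hMd'.continuousMultilinear_apply_const w
      have h2 : HasFDerivAt (fun p => (M ∘ τ) p (fun i => fderiv ℝ τ p (w i))) _ z :=
        HasFDerivAt.continuousMultilinearMap_apply (g := fun i p => fderiv ℝ τ p (w i))
          (hMd.comp z hτd)
          (fun i => hD.clm_apply (hasFDerivAt_const (w i) z))
      have h3 := h1.unique (h2.congr_of_eventuallyEq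
        (Filter.eventually_of_mem hUn fun p hp => ih' p hp w))
      have h4 := DFunLike.congr_fun h3 (v 0)
      simpa using h4
    change covDerivTensor _ M' z v = covDerivTensor _ M (τ z) _
    rw [covDerivTensor_apply, covDerivTensor_apply]
    have htail : Fin.tail (fun i => fderiv ℝ τ z (v i)) = fun i => fderiv ℝ τ z (w i) := rfl
    rw [htail, ← hw, hder, add_sub_assoc, ← Finset.sum_sub_distrib, sub_eq_add_neg,
      ← Finset.sum_neg_distrib]
    congr 1
    refine Finset.sum_congr rfl fun l _ => ?_
    rw [ih' z hz]
    have h5 : (fun i => fderiv ℝ τ z (Function.update w l (christoffelTensor b' z (v 0) (w l)) i))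
        = Function.update (fun i => fderiv ℝ τ z (w i)) l
            (fderiv ℝ τ z (christoffelTensor b' z (v 0) (w l))) := by
      ext1 i
      by_cases h : i = l
      · subst h; simp
      · simp [h]
    rw [h5, christoffelTensor_comp hb hb' hτ hmaps hpull hz, ContinuousMultilinearMap.map_update_add]
    ring

end Covariance

/-! ### Agreement of the tensor-valued calculus with the definitions in coordinates -/

section Euclidean

variable {n : ℕ}

lemma christoffel_eq (b : EuclideanSpace ℝ (Fin n) →
      EuclideanSpace ℝ (Fin n) →L[ℝ] EuclideanSpace ℝ (Fin n) →L[ℝ] ℝ)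
    (z u v : EuclideanSpace ℝ (Fin n)) : christoffel b z u v = christoffelTensor b z u v := rfl

/-- The definition differentiates the evaluation of a tensor at fixed vectors. Evaluation commutes
with the derivative because the tensor-valued field is differentiable, which is the role of the
regularity of `f`. -/
lemma iterCovDeriv_eq {b : EuclideanSpace ℝ (Fin n) →
      EuclideanSpace ℝ (Fin n) →L[ℝ] EuclideanSpace ℝ (Fin n) →L[ℝ] ℝ}
    {U : Set (EuclideanSpace ℝ (Fin n))} (hb : IsMetricOn b U) {f : EuclideanSpace ℝ (Fin n) → ℝ}
    {k : ℕ} (hf : ContDiffOn ℝ k f U) {z : EuclideanSpace ℝ (Fin n)} (hz : z ∈ U)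
    (v : Fin k → EuclideanSpace ℝ (Fin n)) :
    iterCovDeriv b f k z v = iterCovDerivTensor (christoffelTensor b) f k z v := by
  induction k generalizing z with
  | zero => simp [iterCovDeriv, iterCovDerivTensor]
  | succ k ih =>
    have hUn : U ∈ 𝓝 z := hb.isOpen.mem_nhds hz
    have ih' := fun {p} (hp : p ∈ U) => ih (hf.of_le (by exact_mod_cast Nat.le_succ k)) hp
    set M := iterCovDerivTensor (christoffelTensor b) f k with hM
    have hMc : ContDiffOn ℝ 1 M U :=
      contDiffOn_iterCovDerivTensor (m := 1) (n := (k + 1 : ℕ)) hb.isOpen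
        hb.contDiffOn_christoffelTensor k (by rw [add_comm]; norm_cast) hf
    have hMd : HasFDerivAt M (fderiv ℝ M z) z :=
      ((hMc.contDiffAt hUn).differentiableAt (by simp)).hasFDerivAt
    change covDeriv b _ z v = covDerivTensor _ M z v
    rw [covDerivTensor_apply, covDeriv]
    have h1 : (fun y => iterCovDeriv b f k y (Fin.tail v)) =ᶠ[𝓝 z] fun y => M y (Fin.tail v) :=
      Filter.eventually_of_mem hUn fun p hp => ih' hp _
    rw [h1.fderiv_eq, (hMd.continuousMultilinear_apply_const (Fin.tail v)).fderiv]
    simp only [ih' hz, christoffel_eq]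
    rfl

end Euclidean

/-! ### Covariant Hessian and Laplacian -/

section Hessian

variable {E : Type*} [NormedAddCommGroup E] [NormedSpace ℝ E]

/-- The covariant Hessian `∇² f`. -/
def hessian (b : E → E →L[ℝ] E →L[ℝ] ℝ) (f : E → ℝ) (z : E) : E →L[ℝ] E →L[ℝ] ℝ :=
  fderiv ℝ (fderiv ℝ f) z
    - ContinuousLinearMap.compL ℝ E E ℝ (fderiv ℝ f z) ∘L christoffelTensor b z

lemma hessian_apply (b : E → E →L[ℝ] E →L[ℝ] ℝ) (f : E → ℝ) (z u v : E) :
    hessian b f z u v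
      = fderiv ℝ (fderiv ℝ f) z u v - fderiv ℝ f z (christoffelTensor b z u v) := rfl

lemma hessian_mul (b : E → E →L[ℝ] E →L[ℝ] ℝ) {φ f : E → ℝ} {z : E}
    (hφ : ContDiffAt ℝ 2 φ z) (hf : ContDiffAt ℝ 2 f z) (u v : E) :
    hessian b (fun y => φ y * f y) z u v = φ z * hessian b f z u v + f z * hessian b φ z u v
      + (fderiv ℝ φ z u * fderiv ℝ f z v + fderiv ℝ f z u * fderiv ℝ φ z v) := by
  have hd : ∀ {h : E → ℝ}, ContDiffAt ℝ 2 h z → ∀ᶠ y in 𝓝 z, HasFDerivAt h (fderiv ℝ h y) y :=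
    fun h => (h.eventually (by simp)).mono fun y hy => (hy.differentiableAt (by simp)).hasFDerivAt
  have hD : ∀ {h : E → ℝ}, ContDiffAt ℝ 2 h z →
      HasFDerivAt (fderiv ℝ h) (fderiv ℝ (fderiv ℝ h) z) z := fun h =>
    ((h.fderiv_right (m := 1) (by norm_cast)).differentiableAt (by simp)).hasFDerivAt
  have h1 : fderiv ℝ (fun y => φ y * f y) =ᶠ[𝓝 z]
      fun y => φ y • fderiv ℝ f y + f y • fderiv ℝ φ y := by
    filter_upwards [hd hφ, hd hf] with y h1 h2 using (h1.mul h2).fderiv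
  have h2 : HasFDerivAt (fderiv ℝ (fun y => φ y * f y)) _ z :=
    (((hd hφ).self_of_nhds.smul (hD hf)).add
      ((hd hf).self_of_nhds.smul (hD hφ))).congr_of_eventuallyEq h1
  rw [hessian_apply, h2.fderiv, h1.self_of_nhds, hessian_apply, hessian_apply]
  simp
  ring

lemma hessian_congr (b : E → E →L[ℝ] E →L[ℝ] ℝ) {f f' : E → ℝ} {z : E} (h : f =ᶠ[𝓝 z] f') :
    hessian b f z = hessian b f' z := by
  rw [hessian, hessian, h.fderiv.fderiv_eq, h.fderiv_eq]

lemma hessian_add (b : E → E →L[ℝ] E →L[ℝ] ℝ) {φ f : E → ℝ} {z : E}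
    (hφ : ContDiffAt ℝ 2 φ z) (hf : ContDiffAt ℝ 2 f z) :
    hessian b (fun y => φ y + f y) z = hessian b φ z + hessian b f z := by
  have hd : ∀ {h : E → ℝ}, ContDiffAt ℝ 2 h z → ∀ᶠ y in 𝓝 z, HasFDerivAt h (fderiv ℝ h y) y :=
    fun h => (h.eventually (by simp)).mono fun y hy => (hy.differentiableAt (by simp)).hasFDerivAt
  have hD : ∀ {h : E → ℝ}, ContDiffAt ℝ 2 h z →
      HasFDerivAt (fderiv ℝ h) (fderiv ℝ (fderiv ℝ h) z) z := fun h =>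
    ((h.fderiv_right (m := 1) (by norm_cast)).differentiableAt (by simp)).hasFDerivAt
  have h1 : fderiv ℝ (fun y => φ y + f y) =ᶠ[𝓝 z] fun y => fderiv ℝ φ y + fderiv ℝ f y := by
    filter_upwards [hd hφ, hd hf] with y h1 h2 using (h1.add h2).fderiv
  have h2 : HasFDerivAt (fderiv ℝ (fun y => φ y + f y)) _ z :=
    ((hD hφ).add (hD hf)).congr_of_eventuallyEq h1
  ext u v
  rw [hessian_apply, h2.fderiv, h1.self_of_nhds]
  simp only [add_apply, hessian_apply]
  ring

variable [FiniteDimensional ℝ E]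

variable (E) in
/-- The trace of a continuous endomorphism of a finite dimensional space. -/
def traceL : (E →L[ℝ] E) →L[ℝ] ℝ :=
  LinearMap.toContinuousLinearMap ((LinearMap.trace ℝ E) ∘ₗ (ContinuousLinearMap.coeLM ℝ))

lemma traceL_apply (A : E →L[ℝ] E) : traceL E A = LinearMap.trace ℝ E (A : E →ₗ[ℝ] E) := rfl

lemma traceL_smulRight (α : E →L[ℝ] ℝ) (v : E) : traceL E (α.smulRight v) = α v := by
  rw [traceL_apply]
  exact LinearMap.trace_smulRight (α : E →ₗ[ℝ] ℝ) v

lemma traceL_eq_sum_basis {ι : Type*} [Fintype ι] (e : Module.Basis ι ℝ E) (A : E →L[ℝ] E) :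
    traceL E A = ∑ i, e.repr (A (e i)) i := by
  classical
  rw [traceL_apply, LinearMap.trace_eq_matrix_trace ℝ e, Matrix.trace]
  simp [LinearMap.toMatrix_apply]

/-- The trace of a bilinear form with respect to a metric does not change under transposition. -/
lemma traceL_inverse_comp_flip {I : (E →L[ℝ] ℝ) →L[ℝ] E}
    (hI : ∀ α β : E →L[ℝ] ℝ, α (I β) = β (I α)) (Q : E →L[ℝ] E →L[ℝ] ℝ) :
    traceL E (I ∘L Q.flip) = traceL E (I ∘L Q) := by
  let e := Module.finBasis ℝ E
  let c : Fin (Module.finrank ℝ E) → (E →L[ℝ] ℝ) := fun i =>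
    LinearMap.toContinuousLinearMap (e.coord i)
  have hc : ∀ i v, e.repr v i = c i v := fun i v => rfl
  have hexp : ∀ v : E, v = ∑ i, c i v • e i := fun v => (e.sum_repr v).symm
  rw [traceL_eq_sum_basis e, traceL_eq_sum_basis e]
  simp only [hc, ContinuousLinearMap.comp_apply]
  have h1 : ∀ i, c i (I (Q.flip (e i))) = ∑ j, c j (I (c i)) * Q (e j) (e i) := by
    intro i
    rw [hI]
    conv_lhs => rw [hexp (I (c i))]
    simp
  have h2 : ∀ i, c i (I (Q (e i))) = ∑ j, c j (I (c i)) * Q (e i) (e j) := by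
    intro i
    rw [hI]
    conv_lhs => rw [hexp (I (c i))]
    simp
  simp only [h1, h2]
  rw [Finset.sum_comm]
  refine Finset.sum_congr rfl fun i _ => Finset.sum_congr rfl fun j _ => ?_
  rw [hI]

/-- The Laplacian as minus the metric trace of the covariant Hessian. -/
def metricLaplacian (b : E → E →L[ℝ] E →L[ℝ] ℝ) (f : E → ℝ) (z : E) : ℝ :=
  - traceL E ((b z).inverse ∘L hessian b f z)

lemma hessian_comp {b b' : E → E →L[ℝ] E →L[ℝ] ℝ} {τ : E → E} {U V : Set E}
    (hb : IsMetricOn b V) (hb' : IsMetricOn b' U) (hτ : ContDiffOn ℝ ∞ τ U) (hmaps : MapsTo τ U V)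
    (hpull : ∀ z ∈ U, ∀ v w, b' z v w = b (τ z) (fderiv ℝ τ z v) (fderiv ℝ τ z w))
    {f f' : E → ℝ} (hff' : ∀ z ∈ U, f' z = f (τ z)) (hf : ContDiffOn ℝ 2 f V)
    {z : E} (hz : z ∈ U) (u v : E) :
    hessian b' f' z u v = hessian b f (τ z) (fderiv ℝ τ z u) (fderiv ℝ τ z v) := by
  have hUn : U ∈ 𝓝 z := hb'.isOpen.mem_nhds hz
  have hVn : V ∈ 𝓝 (τ z) := hb.isOpen.mem_nhds (hmaps hz)
  have hτd : ∀ p ∈ U, HasFDerivAt τ (fderiv ℝ τ p) p := fun p hp =>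
    ((hτ.contDiffAt (hb'.isOpen.mem_nhds hp)).differentiableAt (by simp)).hasFDerivAt
  have hD : HasFDerivAt (fderiv ℝ τ) (fderiv ℝ (fderiv ℝ τ) z) z :=
    (((hτ.contDiffAt hUn).fderiv_right (m := 1) (by norm_cast)).differentiableAt
      (by simp)).hasFDerivAt
  have hfd : ∀ q ∈ V, HasFDerivAt f (fderiv ℝ f q) q := fun q hq =>
    ((hf.contDiffAt (hb.isOpen.mem_nhds hq)).differentiableAt (by simp)).hasFDerivAt
  have hfD : HasFDerivAt (fderiv ℝ f) (fderiv ℝ (fderiv ℝ f) (τ z)) (τ z) :=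
    (((hf.contDiffAt hVn).fderiv_right (m := 1) (by norm_cast)).differentiableAt
      (by simp)).hasFDerivAt
  have h1 : ∀ p ∈ U, fderiv ℝ f' p = fderiv ℝ f (τ p) ∘L fderiv ℝ τ p := fun p hp =>
    (((hfd _ (hmaps hp)).comp p (hτd p hp)).congr_of_eventuallyEq
      (Filter.eventually_of_mem (hb'.isOpen.mem_nhds hp) fun q hq => hff' q hq)).fderiv
  have h2 : HasFDerivAt (fderiv ℝ f') _ z :=
    ((hfD.comp z (hτd z hz)).clm_comp hD).congr_of_eventuallyEq
      (Filter.eventually_of_mem hUn fun q hq => h1 q hq)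
  rw [hessian_apply, hessian_apply, h2.fderiv, h1 z hz]
  simp only [ContinuousLinearMap.comp_apply, Function.comp_apply,
    christoffelTensor_comp hb hb' hτ hmaps hpull hz, map_add]
  simp
  ring

/-- The endomorphisms "inverse metric after Hessian" on the two sides are conjugate by the
derivative of `τ`, hence have the same trace. -/
lemma metricLaplacian_comp {b b' : E → E →L[ℝ] E →L[ℝ] ℝ} {τ : E → E} {U V : Set E}
    (hb : IsMetricOn b V) (hb' : IsMetricOn b' U) (hτ : ContDiffOn ℝ ∞ τ U) (hmaps : MapsTo τ U V)
    (hpull : ∀ z ∈ U, ∀ v w, b' z v w = b (τ z) (fderiv ℝ τ z v) (fderiv ℝ τ z w))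
    {f f' : E → ℝ} (hff' : ∀ z ∈ U, f' z = f (τ z)) (hf : ContDiffOn ℝ 2 f V)
    {z : E} (hz : z ∈ U) :
    metricLaplacian b' f' z = metricLaplacian b f (τ z) := by
  have hinj : Function.Injective (fderiv ℝ τ z) := by
    rw [injective_iff_map_eq_zero]
    intro x hx
    by_contra hne
    have := hb'.pos z hz x hne
    rw [hpull z hz, hx] at this
    simp at this
  let D : E ≃ₗ[ℝ] E := LinearEquiv.ofInjectiveEndo (fderiv ℝ τ z : E →ₗ[ℝ] E) hinj
  have hD : ∀ v, D v = fderiv ℝ τ z v := fun v => rfl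
  rw [metricLaplacian, metricLaplacian, traceL_apply, traceL_apply,
    ← LinearMap.trace_conj' (((b' z).inverse ∘L hessian b' f' z : E →L[ℝ] E) : E →ₗ[ℝ] E) D]
  congr 2
  ext1 u
  obtain ⟨u, rfl⟩ := D.surjective u
  rw [LinearEquiv.conj_apply]
  simp only [LinearMap.comp_apply, LinearEquiv.coe_coe, ContinuousLinearMap.coe_coe,
    ContinuousLinearMap.comp_apply, hD]
  apply hb.injective (hmaps hz)
  rw [hb.apply_inverse (hmaps hz)]
  ext w
  obtain ⟨w, rfl⟩ := D.surjective w
  have hDs : D.symm (fderiv ℝ τ z u) = u := D.symm_apply_apply u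
  rw [hD, ← hpull z hz, hb'.apply_inverse hz, hDs]
  exact hessian_comp hb hb' hτ hmaps hpull hff' hf hz u w

lemma metricLaplacian_mul {b : E → E →L[ℝ] E →L[ℝ] ℝ} {U : Set E} (hb : IsMetricOn b U)
    {φ f : E → ℝ} {z : E} (hz : z ∈ U) (hφ : ContDiffAt ℝ 2 φ z) (hf : ContDiffAt ℝ 2 f z) :
    metricLaplacian b (fun y => φ y * f y) z = φ z * metricLaplacian b f z
      + f z * metricLaplacian b φ z - 2 * fderiv ℝ φ z ((b z).inverse (fderiv ℝ f z)) := by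
  have h : (b z).inverse ∘L hessian b (fun y => φ y * f y) z
      = φ z • ((b z).inverse ∘L hessian b f z) + f z • ((b z).inverse ∘L hessian b φ z)
        + ((fderiv ℝ φ z).smulRight ((b z).inverse (fderiv ℝ f z))
          + (fderiv ℝ f z).smulRight ((b z).inverse (fderiv ℝ φ z))) := by
    ext1 u
    have h1 : hessian b (fun y => φ y * f y) z u = φ z • hessian b f z u + f z • hessian b φ z u
        + (fderiv ℝ φ z u • fderiv ℝ f z + fderiv ℝ f z u • fderiv ℝ φ z) := by
      ext v
      rw [hessian_mul b hφ hf]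
      simp
    simp only [ContinuousLinearMap.comp_apply, h1, map_add, map_smul, add_apply, smul_apply,
      ContinuousLinearMap.smulRight_apply]
  rw [metricLaplacian, h]
  simp only [map_add, map_smul, traceL_smulRight, metricLaplacian, smul_eq_mul]
  rw [hb.inverse_symm hz (fderiv ℝ f z)]
  ring

lemma metricLaplacian_congr (b : E → E →L[ℝ] E →L[ℝ] ℝ) {f f' : E → ℝ} {z : E}
    (h : f =ᶠ[𝓝 z] f') : metricLaplacian b f z = metricLaplacian b f' z := by
  rw [metricLaplacian, metricLaplacian, hessian_congr b h]

lemma metricLaplacian_add (b : E → E →L[ℝ] E →L[ℝ] ℝ) {φ f : E → ℝ} {z : E}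
    (hφ : ContDiffAt ℝ 2 φ z) (hf : ContDiffAt ℝ 2 f z) :
    metricLaplacian b (fun y => φ y + f y) z = metricLaplacian b φ z + metricLaplacian b f z := by
  rw [metricLaplacian, hessian_add b hφ hf, ContinuousLinearMap.comp_add, map_add, neg_add]
  rfl

lemma contDiffOn_hessian {b : E → E →L[ℝ] E →L[ℝ] ℝ} {U : Set E} (hb : IsMetricOn b U)
    {f : E → ℝ} {m n : ℕ∞} (hmn : m + 2 ≤ n) (hf : ContDiffOn ℝ n f U) :
    ContDiffOn ℝ m (hessian b f) U := by
  have h1 : ContDiffOn ℝ (m + 1) (fderiv ℝ f) U := hf.fderiv_of_isOpen hb.isOpen (by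
    have : m + 1 + 1 ≤ n := by rwa [add_assoc, one_add_one_eq_two]
    exact_mod_cast this)
  have h2 : ContDiffOn ℝ m (fderiv ℝ (fderiv ℝ f)) U := h1.fderiv_of_isOpen hb.isOpen le_rfl
  have h3 : ContDiffOn ℝ m (christoffelTensor b) U :=
    hb.contDiffOn_christoffelTensor.of_le (by exact_mod_cast le_top)
  have h4 : ContDiffOn ℝ m (fderiv ℝ f) U := h1.of_le (by exact_mod_cast le_self_add)
  exact h2.sub (contDiffOn_bilin (ContinuousLinearMap.compL ℝ E (E →L[ℝ] E) (E →L[ℝ] ℝ))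
    ((ContinuousLinearMap.compL ℝ E E ℝ).contDiff.comp_contDiffOn h4) h3)

lemma contDiffOn_metricLaplacian {b : E → E →L[ℝ] E →L[ℝ] ℝ} {U : Set E} (hb : IsMetricOn b U)
    {f : E → ℝ} {m n : ℕ∞} (hmn : m + 2 ≤ n) (hf : ContDiffOn ℝ n f U) :
    ContDiffOn ℝ m (metricLaplacian b f) U := by
  have h1 : ContDiffOn ℝ m (fun z => (b z).inverse) U :=
    hb.contDiffOn_inverse.of_le (by exact_mod_cast le_top)
  exact ((traceL E).contDiff.comp_contDiffOn (contDiffOn_bilin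
    (ContinuousLinearMap.compL ℝ E (E →L[ℝ] ℝ) E) h1 (contDiffOn_hessian hb hmn hf))).neg

/-- Obtained by differentiating the constant function `b y ((b y).inverse α) = α`. -/
lemma IsMetricOn.fderiv_inverse {b : E → E →L[ℝ] E →L[ℝ] ℝ} {U : Set E} (hb : IsMetricOn b U) {z : E} (hz : z ∈ U)
    (u : E) (α : E →L[ℝ] ℝ) :
    fderiv ℝ (fun y => (b y).inverse) z u α
      = - (b z).inverse (fderiv ℝ b z u ((b z).inverse α)) := by
  have hUn := hb.isOpen.mem_nhds hz
  have hbd : HasFDerivAt b (fderiv ℝ b z) z :=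
    ((hb.contDiffOn.contDiffAt hUn).differentiableAt (by simp)).hasFDerivAt
  have hI : HasFDerivAt (fun y => (b y).inverse) (fderiv ℝ (fun y => (b y).inverse) z) z :=
    ((hb.contDiffOn_inverse.contDiffAt hUn).differentiableAt (by simp)).hasFDerivAt
  have h1 :=
    hbd.clm_apply (hI.clm_apply (hasFDerivAt_const (𝕜 := ℝ) α z))
  have hev : (fun y => b y ((b y).inverse α)) =ᶠ[𝓝 z] fun _ => α :=
    Filter.eventually_of_mem hUn fun y hy => hb.apply_inverse hy α
  have h2 : HasFDerivAt (fun y => b y ((b y).inverse α)) 0 z :=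
    (hasFDerivAt_const (𝕜 := ℝ) α z).congr_of_eventuallyEq hev
  have h3 := DFunLike.congr_fun (h1.unique h2) u
  simp at h3
  apply hb.injective hz
  rw [map_neg, hb.apply_inverse hz]
  exact eq_neg_of_add_eq_zero_left h3

end Hessian

/-! ### The Laplacian of the definitions as a metric trace -/

section Euclidean

variable {n : ℕ}

lemma traceL_eq_sum (A : EuclideanSpace ℝ (Fin n) →L[ℝ] EuclideanSpace ℝ (Fin n)) :
    traceL _ A = ∑ i, A (EuclideanSpace.single i 1) i := by
  rw [traceL_eq_sum_basis (EuclideanSpace.basisFun (Fin n) ℝ).toBasis]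
  simp

lemma iterCovDeriv_one (b : EuclideanSpace ℝ (Fin n) →
      EuclideanSpace ℝ (Fin n) →L[ℝ] EuclideanSpace ℝ (Fin n) →L[ℝ] ℝ)
    (f : EuclideanSpace ℝ (Fin n) → ℝ) (z : EuclideanSpace ℝ (Fin n))
    (v : Fin 1 → EuclideanSpace ℝ (Fin n)) : iterCovDeriv b f 1 z v = fderiv ℝ f z (v 0) := by
  simp [iterCovDeriv, covDeriv]

lemma iterCovDeriv_two (b : EuclideanSpace ℝ (Fin n) →
      EuclideanSpace ℝ (Fin n) →L[ℝ] EuclideanSpace ℝ (Fin n) →L[ℝ] ℝ)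
    {f : EuclideanSpace ℝ (Fin n) → ℝ} {z : EuclideanSpace ℝ (Fin n)} (hf : ContDiffAt ℝ 2 f z)
    (v : Fin 2 → EuclideanSpace ℝ (Fin n)) :
    iterCovDeriv b f 2 z v = hessian b f z (v 0) (v 1) := by
  have hD : HasFDerivAt (fderiv ℝ f) (fderiv ℝ (fderiv ℝ f) z) z :=
    ((hf.fderiv_right (m := 1) (by norm_cast)).differentiableAt (by simp)).hasFDerivAt
  change covDeriv b (iterCovDeriv b f 1) z v = _
  rw [covDeriv, hessian_apply]
  simp only [iterCovDeriv_one]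
  rw [(hD.clm_apply (hasFDerivAt_const (Fin.tail v 0) z)).fderiv]
  simp [Fin.tail, christoffel_eq]

/-- The definition puts the raised covector in the second slot of the Hessian; symmetry of the
inverse metric turns this into a diagonal entry of the endomorphism whose trace is taken. -/
lemma coordLaplacian_eq {b : EuclideanSpace ℝ (Fin n) →
      EuclideanSpace ℝ (Fin n) →L[ℝ] EuclideanSpace ℝ (Fin n) →L[ℝ] ℝ}
    {U : Set (EuclideanSpace ℝ (Fin n))} (hb : IsMetricOn b U) {f : EuclideanSpace ℝ (Fin n) → ℝ}
    {z : EuclideanSpace ℝ (Fin n)} (hz : z ∈ U) (hf : ContDiffAt ℝ 2 f z) :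
    coordLaplacian b f z = metricLaplacian b f z := by
  rw [coordLaplacian, metricLaplacian, traceL_eq_sum]
  congr 1
  refine Finset.sum_congr rfl fun i _ => ?_
  rw [iterCovDeriv_two b hf]
  have := hb.inverse_symm hz (EuclideanSpace.proj i)
    (hessian b f z (EuclideanSpace.single i 1))
  simpa using this.symm

end Euclidean

/-! ### Volume density and the divergence form of the Laplacian -/

section Density

variable {n : ℕ}

/-- The Gram matrix of a bilinear form in the standard basis. -/
def gram (B : EuclideanSpace ℝ (Fin n) →L[ℝ] EuclideanSpace ℝ (Fin n) →L[ℝ] ℝ) :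
    Matrix (Fin n) (Fin n) ℝ :=
  Matrix.of fun i j => B (EuclideanSpace.single i 1) (EuclideanSpace.single j 1)

lemma volumeDensity_eq (b : EuclideanSpace ℝ (Fin n) →
      EuclideanSpace ℝ (Fin n) →L[ℝ] EuclideanSpace ℝ (Fin n) →L[ℝ] ℝ)
    (z : EuclideanSpace ℝ (Fin n)) : volumeDensity b z = √(gram (b z)).det := rfl

lemma euclidean_expand (v : EuclideanSpace ℝ (Fin n)) :
    v = ∑ i, v i • EuclideanSpace.single i (1 : ℝ) := by
  ext j
  simp [Pi.single_apply]

lemma bilin_expand (B : EuclideanSpace ℝ (Fin n) →L[ℝ] EuclideanSpace ℝ (Fin n) →L[ℝ] ℝ)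
    (v w : EuclideanSpace ℝ (Fin n)) : B v w = ∑ i, ∑ j, v i * gram B i j * w j := by
  conv_lhs => rw [euclidean_expand v, euclidean_expand w]
  simp only [map_sum, map_smul, sum_apply, smul_apply, smul_eq_mul, gram, Matrix.of_apply,
    Finset.mul_sum]
  rw [Finset.sum_comm]
  exact Finset.sum_congr rfl fun i _ => Finset.sum_congr rfl fun j _ => by ring

lemma det_gram_pos {B : EuclideanSpace ℝ (Fin n) →L[ℝ] EuclideanSpace ℝ (Fin n) →L[ℝ] ℝ}
    (hs : ∀ v w, B v w = B w v) (hp : ∀ v, v ≠ 0 → 0 < B v v) : 0 < (gram B).det := by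
  refine (Matrix.PosDef.of_dotProduct_mulVec_pos ?_ fun x hx => ?_).det_pos
  · ext i j
    simp [gram, hs (EuclideanSpace.single i 1)]
  · have h := hp (WithLp.toLp 2 x) (by simpa using hx)
    rw [bilin_expand] at h
    simpa [dotProduct, Matrix.mulVec, Finset.mul_sum, mul_assoc] using h

/-- The Gram matrix of the pulled-back form is `Pᵀ M P`. After a square root the factor becomes
`|det D|`, as the change of variables formula requires. -/
lemma det_gram_comp (B : EuclideanSpace ℝ (Fin n) →L[ℝ] EuclideanSpace ℝ (Fin n) →L[ℝ] ℝ)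
    (D : EuclideanSpace ℝ (Fin n) →L[ℝ] EuclideanSpace ℝ (Fin n)) :
    (gram (B.bilinearComp D D)).det = D.det ^ 2 * (gram B).det := by
  let P : Matrix (Fin n) (Fin n) ℝ := Matrix.of fun k i => D (EuclideanSpace.single i 1) k
  have hP : P.det = D.det := by
    have h1 : P = LinearMap.toMatrix (EuclideanSpace.basisFun (Fin n) ℝ).toBasis
        (EuclideanSpace.basisFun (Fin n) ℝ).toBasis (D : _ →ₗ[ℝ] EuclideanSpace ℝ (Fin n)) := by
      ext k i
      simp [P, LinearMap.toMatrix_apply]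
    rw [h1, LinearMap.det_toMatrix]
  have h : gram (B.bilinearComp D D) = P.transpose * gram B * P := by
    ext i j
    rw [Matrix.mul_apply]
    simp only [Matrix.mul_apply, Matrix.transpose_apply, Finset.sum_mul]
    rw [Finset.sum_comm]
    exact bilin_expand B _ _
  rw [h, Matrix.det_mul, Matrix.det_mul, Matrix.det_transpose, hP]
  ring

lemma contDiff_det_gram {m : WithTop ℕ∞} :
    ContDiff ℝ m (fun B : EuclideanSpace ℝ (Fin n) →L[ℝ] EuclideanSpace ℝ (Fin n) →L[ℝ] ℝ =>
      (gram B).det) := by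
  simp only [Matrix.det_apply, gram, Matrix.of_apply]
  refine ContDiff.sum fun σ _ => ContDiff.const_smul _ (contDiff_prod fun i _ => ?_)
  exact (contDiff_id.clm_apply contDiff_const).clm_apply contDiff_const

/-- Jacobi's formula. -/
lemma fderiv_det_gram (B H : EuclideanSpace ℝ (Fin n) →L[ℝ] EuclideanSpace ℝ (Fin n) →L[ℝ] ℝ)
    (A : EuclideanSpace ℝ (Fin n) →L[ℝ] EuclideanSpace ℝ (Fin n)) (hA : ∀ v, B (A v) = H v) :
    fderiv ℝ (fun B => (gram B).det) B H = traceL _ A * (gram B).det := by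
  let P : Matrix (Fin n) (Fin n) ℝ := Matrix.of fun i k => A (EuclideanSpace.single i 1) k
  have hd : HasFDerivAt (fun B : EuclideanSpace ℝ (Fin n) →L[ℝ] EuclideanSpace ℝ (Fin n) →L[ℝ] ℝ =>
      (gram B).det) _ B :=
    ((contDiff_det_gram (m := 1)).differentiable (by simp) B).hasFDerivAt
  have h1 : HasDerivAt (fun t : ℝ => B + t • H) H 0 := by
    simpa using ((hasDerivAt_id (0 : ℝ)).smul_const H).const_add B
  have hd0 : HasFDerivAt (fun B : EuclideanSpace ℝ (Fin n) →L[ℝ] EuclideanSpace ℝ (Fin n) →L[ℝ] ℝ =>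
      (gram B).det) (fderiv ℝ (fun B => (gram B).det) B) (B + (0 : ℝ) • H) := by simpa using hd
  have h2 := hd0.comp_hasDerivAt (0 : ℝ) h1
  -- Since `H` is `B` after `A`, the Gram matrix factors along the line `B + t • H`, and the
  -- derivative at `t = 0` is read off from det(1 + tP) = 1 + t tr P + O(t²).
  have h3 : ∀ t : ℝ, gram (B + t • H) = (1 + t • P) * gram B := by
    intro t
    ext i j
    have h4 : P * gram B = gram H := by
      ext i j
      rw [Matrix.mul_apply]
      simp only [gram, Matrix.of_apply, ← hA]
      conv_rhs => rw [euclidean_expand (A (EuclideanSpace.single i 1))]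
      simp [P]
    rw [add_mul, one_mul, smul_mul_assoc, h4]
    simp [gram]
  have h5 : HasDerivAt (fun t : ℝ => (gram (B + t • H)).det) (P.trace * (gram B).det) 0 := by
    have h6 : HasDerivAt (fun t : ℝ => 1 + P.trace * t + Polynomial.eval t
        (Matrix.det (1 + (Polynomial.X : Polynomial ℝ) • P.map Polynomial.C)).divX.divX * t ^ 2)
        (P.trace) 0 := by
      have := (((hasDerivAt_id (0 : ℝ)).const_mul P.trace).const_add 1).add
        ((Polynomial.hasDerivAt (Matrix.det
          (1 + (Polynomial.X : Polynomial ℝ) • P.map Polynomial.C)).divX.divX 0).mul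
          (hasDerivAt_pow 2 (0 : ℝ)))
      convert! this using 1
      simp
    refine (h6.mul_const _).congr_of_eventuallyEq (Filter.Eventually.of_forall fun t => ?_)
    simp only []
    rw [h3, Matrix.det_mul, Matrix.det_one_add_smul]
  rw [h2.unique h5, traceL_eq_sum]
  rfl

variable {b : EuclideanSpace ℝ (Fin n) →
      EuclideanSpace ℝ (Fin n) →L[ℝ] EuclideanSpace ℝ (Fin n) →L[ℝ] ℝ}
    {U : Set (EuclideanSpace ℝ (Fin n))}

lemma IsMetricOn.det_gram_pos (hb : IsMetricOn b U) {z : EuclideanSpace ℝ (Fin n)} (hz : z ∈ U) :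
    0 < (gram (b z)).det :=
  ALE.det_gram_pos (hb.symm z hz) (hb.pos z hz)

lemma IsMetricOn.volumeDensity_pos (hb : IsMetricOn b U) {z : EuclideanSpace ℝ (Fin n)}
    (hz : z ∈ U) : 0 < volumeDensity b z :=
  Real.sqrt_pos.2 (hb.det_gram_pos hz)

lemma IsMetricOn.contDiffOn_volumeDensity (hb : IsMetricOn b U) :
    ContDiffOn ℝ ∞ (volumeDensity b) U :=
  ContDiffOn.sqrt (contDiff_det_gram.comp_contDiffOn hb.contDiffOn)
    fun _ hz => (hb.det_gram_pos hz).ne'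

lemma IsMetricOn.fderiv_volumeDensity (hb : IsMetricOn b U) {z : EuclideanSpace ℝ (Fin n)}
    (hz : z ∈ U) (u : EuclideanSpace ℝ (Fin n)) :
    fderiv ℝ (volumeDensity b) z u
      = volumeDensity b z * (1 / 2 * traceL _ ((b z).inverse ∘L fderiv ℝ b z u)) := by
  have hbd : HasFDerivAt b (fderiv ℝ b z) z :=
    ((hb.contDiffOn.contDiffAt (hb.isOpen.mem_nhds hz)).differentiableAt (by simp)).hasFDerivAt
  have hd : HasFDerivAt (fun B : EuclideanSpace ℝ (Fin n) →L[ℝ] EuclideanSpace ℝ (Fin n) →L[ℝ] ℝ =>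
      (gram B).det) _ (b z) :=
    ((contDiff_det_gram (m := 1)).differentiable (by simp) (b z)).hasFDerivAt
  have h : HasFDerivAt (volumeDensity b) _ z := (hd.comp z hbd).sqrt (hb.det_gram_pos hz).ne'
  rw [h.fderiv]
  have h2 := fderiv_det_gram (b z) (fderiv ℝ b z u) ((b z).inverse ∘L fderiv ℝ b z u)
    fun v => by simp [hb.apply_inverse hz]
  have h3 : volumeDensity b z * volumeDensity b z = (gram (b z)).det :=
    Real.mul_self_sqrt (hb.det_gram_pos hz).le
  have h4 := hb.volumeDensity_pos hz
  simp only [smul_apply, ContinuousLinearMap.comp_apply, h2, smul_eq_mul]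
  change 1 / (2 * volumeDensity b z) * _ = _
  rw [← h3]
  field_simp

/-- The gradient of `f` times the volume density. -/
def gradDensity (b : EuclideanSpace ℝ (Fin n) →
      EuclideanSpace ℝ (Fin n) →L[ℝ] EuclideanSpace ℝ (Fin n) →L[ℝ] ℝ)
    (f : EuclideanSpace ℝ (Fin n) → ℝ) (z : EuclideanSpace ℝ (Fin n)) :
    EuclideanSpace ℝ (Fin n) :=
  volumeDensity b z • (b z).inverse (fderiv ℝ f z)

lemma IsMetricOn.contDiffOn_gradDensity (hb : IsMetricOn b U) {f : EuclideanSpace ℝ (Fin n) → ℝ}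
    (hf : ContDiffOn ℝ 2 f U) : ContDiffOn ℝ 1 (gradDensity b f) U := by
  have h1 : ContDiffOn ℝ 1 (volumeDensity b) U :=
    hb.contDiffOn_volumeDensity.of_le (by exact_mod_cast le_top)
  have h2 : ContDiffOn ℝ 1 (fun z => (b z).inverse) U :=
    hb.contDiffOn_inverse.of_le (by exact_mod_cast le_top)
  have h3 : ContDiffOn ℝ 1 (fderiv ℝ f) U := hf.fderiv_of_isOpen hb.isOpen (by norm_cast)
  exact h1.smul (h2.clm_apply h3)

/-- The divergence form of the Laplacian. -/
lemma IsMetricOn.trace_fderiv_gradDensity (hb : IsMetricOn b U)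
    {f : EuclideanSpace ℝ (Fin n) → ℝ} (hf : ContDiffOn ℝ 2 f U)
    {z : EuclideanSpace ℝ (Fin n)} (hz : z ∈ U) :
    traceL _ (fderiv ℝ (gradDensity b f) z) = - (volumeDensity b z * metricLaplacian b f z) := by
  have hUn := hb.isOpen.mem_nhds hz
  have hbd : HasFDerivAt b (fderiv ℝ b z) z :=
    ((hb.contDiffOn.contDiffAt hUn).differentiableAt (by simp)).hasFDerivAt
  have hI : HasFDerivAt (fun y => (b y).inverse) (fderiv ℝ (fun y => (b y).inverse) z) z :=
    ((hb.contDiffOn_inverse.contDiffAt hUn).differentiableAt (by simp)).hasFDerivAt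
  have hfD : HasFDerivAt (fderiv ℝ f) (fderiv ℝ (fderiv ℝ f) z) z :=
    (((hf.contDiffAt hUn).fderiv_right (m := 1) (by norm_cast)).differentiableAt
      (by simp)).hasFDerivAt
  have hv : HasFDerivAt (volumeDensity b) (fderiv ℝ (volumeDensity b) z) z :=
    ((hb.contDiffOn_volumeDensity.contDiffAt hUn).differentiableAt (by simp)).hasFDerivAt
  have hsymm : ∀ x v w, fderiv ℝ b z x v w = fderiv ℝ b z x w v := by
    intro x v w
    have h1 : ∀ v w, HasFDerivAt (fun y => b y v w) _ z := fun v w =>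
      (hbd.clm_apply (hasFDerivAt_const v z)).clm_apply (hasFDerivAt_const w z)
    have h2 := (h1 v w).unique ((h1 w v).congr_of_eventuallyEq
      (Filter.eventually_of_mem hUn fun y hy => hb.symm y hy v w))
    simpa using DFunLike.congr_fun h2 x
  set I := (b z).inverse with hIdef
  have hIs : ∀ α β : EuclideanSpace ℝ (Fin n) →L[ℝ] ℝ, α (I β) = β (I α) := hb.inverse_symm hz
  set W := I (fderiv ℝ f z) with hW
  set Q : EuclideanSpace ℝ (Fin n) →L[ℝ] EuclideanSpace ℝ (Fin n) →L[ℝ] ℝ :=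
    (fderiv ℝ b z).flip W with hQ
  have hDf : ∀ v, fderiv ℝ f z v = b z W v := fun v => by rw [hW, hb.apply_inverse hz]
  have h1 : fderiv ℝ (gradDensity b f) z
      = (fderiv ℝ (volumeDensity b) z).smulRight W
        + volumeDensity b z • (I ∘L fderiv ℝ (fderiv ℝ f) z - I ∘L Q) := by
    have h2 : HasFDerivAt (gradDensity b f) _ z := hv.smul (hI.clm_apply hfD)
    rw [h2.fderiv]
    ext1 u
    simp [hb.fderiv_inverse hz, ← hIdef, ← hW, hQ]
    module
  -- The traces of `I ∘L Q` and `I ∘L Q.flip` agree, so the terms in `Q` match those of `h1`. What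
  -- remains, half the trace of `I ∘L fderiv ℝ b z W`, is the derivative of the density along `W` by
  -- Jacobi's formula.
  have h2 : I ∘L hessian b f z = I ∘L fderiv ℝ (fderiv ℝ f) z
      - (1 / 2 : ℝ) • (I ∘L Q + I ∘L Q.flip - I ∘L fderiv ℝ b z W) := by
    ext1 u
    have h3 : hessian b f z u = fderiv ℝ (fderiv ℝ f) z u
        - (1 / 2 : ℝ) • (Q u + Q.flip u - fderiv ℝ b z W u) := by
      ext v
      rw [hessian_apply, hDf, hb.symm z hz, christoffelTensor, christoffelBilin_apply,
        hb.apply_inverse hz, christoffelSymm_apply]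
      simp [hQ, hsymm u v W, hsymm v u W]
    simp only [ContinuousLinearMap.comp_apply, h3, map_sub, map_smul, map_add, sub_apply,
      smul_apply, add_apply]
  rw [h1, metricLaplacian, ← hIdef, h2]
  simp only [map_add, map_sub, map_smul, traceL_smulRight, traceL_inverse_comp_flip hIs,
    hb.fderiv_volumeDensity hz, smul_eq_mul, ← hIdef]
  ring

end Density

/-! ### Divergence theorem and Green's identity in a coordinate domain -/

section Green

variable {n : ℕ}

/-- Integration by parts against the constant function `1`. -/
lemma integral_fderiv_eq_zero {f : EuclideanSpace ℝ (Fin n) → ℝ} (hf : ContDiff ℝ 1 f)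
    (hc : HasCompactSupport f) (v : EuclideanSpace ℝ (Fin n)) : ∫ x, fderiv ℝ f x v = 0 := by
  have h := integral_mul_fderiv_eq_neg_fderiv_mul_of_integrable
    (μ := (volume : Measure (EuclideanSpace ℝ (Fin n)))) (f := fun _ => (1 : ℝ)) (g := f) (v := v)
    (by simp)
    (by
      simp only [one_mul]
      exact ((hf.continuous_fderiv (by simp)).clm_apply continuous_const).integrable_of_hasCompactSupport
        (hc.fderiv_apply (𝕜 := ℝ) v))
    (by simpa using hf.continuous.integrable_of_hasCompactSupport hc)
    (by simp) (fun x _ => hf.differentiable (by simp) x)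
  simpa using h

/-- The divergence theorem without boundary term. The extension of `V` by zero is C¹ on the whole
space, because every point has a neighbourhood inside `U` or outside `K`. -/
lemma setIntegral_trace_fderiv_eq_zero
    {V : EuclideanSpace ℝ (Fin n) → EuclideanSpace ℝ (Fin n)}
    {U K : Set (EuclideanSpace ℝ (Fin n))} (hU : IsOpen U) (hK : IsCompact K) (hKU : K ⊆ U)
    (hV : ContDiffOn ℝ 1 V U) (h0 : ∀ z ∈ U, z ∉ K → V z = 0) :
    ∫ z in U, traceL _ (fderiv ℝ V z) = 0 := by
  classical
  set V' : EuclideanSpace ℝ (Fin n) → EuclideanSpace ℝ (Fin n) := U.indicator V with hV'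
  have h0' : ∀ z ∉ K, V' z = 0 := by
    intro z hz
    by_cases hzU : z ∈ U
    · rw [hV', indicator_of_mem hzU, h0 z hzU hz]
    · rw [hV', indicator_of_notMem hzU]
  have heq : ∀ z ∈ U, V' =ᶠ[𝓝 z] V := fun z hz =>
    Filter.eventually_of_mem (hU.mem_nhds hz) fun y hy => indicator_of_mem hy V
  have hev0 : ∀ z ∉ K, V' =ᶠ[𝓝 z] fun _ => 0 := fun z hz =>
    Filter.eventually_of_mem (hK.isClosed.isOpen_compl.mem_nhds hz) fun y hy => h0' y hy
  have hsm : ContDiff ℝ 1 V' := by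
    rw [contDiff_iff_contDiffAt]
    intro z
    by_cases hz : z ∈ U
    · exact (hV.contDiffAt (hU.mem_nhds hz)).congr_of_eventuallyEq (heq z hz)
    · exact contDiffAt_const.congr_of_eventuallyEq (hev0 z fun h => hz (hKU h))
  have hcs : HasCompactSupport V' := HasCompactSupport.intro hK h0'
  have h1 : ∫ z in U, traceL _ (fderiv ℝ V z) = ∫ z, traceL _ (fderiv ℝ V' z) := by
    rw [← integral_indicator hU.measurableSet]
    congr 1
    ext z
    by_cases hz : z ∈ U
    · rw [indicator_of_mem hz, (heq z hz).fderiv_eq]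
    · rw [indicator_of_notMem hz, (hev0 z fun h => hz (hKU h)).fderiv_eq]
      simp
  have hi : ∀ i : Fin n, ContDiff ℝ 1 (fun z => V' z i) := fun i =>
    (EuclideanSpace.proj (𝕜 := ℝ) i).contDiff.comp hsm
  have hci : ∀ i : Fin n, HasCompactSupport (fun z => V' z i) := fun i =>
    HasCompactSupport.intro hK fun z hz => by simp [h0' z hz]
  rw [h1]
  have h2 : ∀ z, traceL _ (fderiv ℝ V' z)
      = ∑ i, fderiv ℝ (fun y => V' y i) z (EuclideanSpace.single i 1) := by
    intro z
    rw [traceL_eq_sum]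
    refine Finset.sum_congr rfl fun i _ => ?_
    have h3 : HasFDerivAt (fun y => V' y i) _ z :=
      (EuclideanSpace.proj (𝕜 := ℝ) i).hasFDerivAt.comp z
        (hsm.differentiable (by simp) z).hasFDerivAt
    rw [h3.fderiv]
    rfl
  simp only [h2]
  rw [integral_finsetSum]
  · exact Finset.sum_eq_zero fun i _ => integral_fderiv_eq_zero (hi i) (hci i) _
  · intro i _
    exact (((hi i).continuous_fderiv (by simp)).clm_apply
      continuous_const).integrable_of_hasCompactSupport
        ((hci i).fderiv_apply (𝕜 := ℝ) (EuclideanSpace.single i 1))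

/-- Green's second identity in a coordinate domain. -/
lemma IsMetricOn.setIntegral_green {b : EuclideanSpace ℝ (Fin n) →
      EuclideanSpace ℝ (Fin n) →L[ℝ] EuclideanSpace ℝ (Fin n) →L[ℝ] ℝ}
    {U K : Set (EuclideanSpace ℝ (Fin n))} (hb : IsMetricOn b U) (hK : IsCompact K) (hKU : K ⊆ U)
    {φ f : EuclideanSpace ℝ (Fin n) → ℝ} (hφ : ContDiffOn ℝ 2 φ U) (hf : ContDiffOn ℝ 2 f U)
    (h0 : ∀ z ∈ U, z ∉ K → φ z = 0) :
    ∫ z in U, volumeDensity b z * (φ z * metricLaplacian b f z - f z * metricLaplacian b φ z)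
      = 0 := by
  -- The divergence of this field is minus the integrand: the products of the two gradients cancel
  -- by symmetry of the inverse metric.
  set V := fun z => φ z • gradDensity b f z - f z • gradDensity b φ z with hVdef
  have hc : ∀ {h : EuclideanSpace ℝ (Fin n) → ℝ}, ContDiffOn ℝ 2 h U → ContDiffOn ℝ 1 h U :=
    fun h => h.of_le (by norm_cast)
  have hV : ContDiffOn ℝ 1 V U :=
    ((hc hφ).smul (hb.contDiffOn_gradDensity hf)).sub ((hc hf).smul (hb.contDiffOn_gradDensity hφ))
  have hV0 : ∀ z ∈ U, z ∉ K → V z = 0 := by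
    intro z hz hzK
    have h1 : φ =ᶠ[𝓝 z] fun _ => 0 := Filter.eventually_of_mem
      ((hb.isOpen.inter hK.isClosed.isOpen_compl).mem_nhds ⟨hz, hzK⟩) fun y hy => h0 y hy.1 hy.2
    simp [hVdef, gradDensity, h1.fderiv_eq, h0 z hz hzK]
  have key := setIntegral_trace_fderiv_eq_zero hb.isOpen hK hKU hV hV0
  rw [← neg_eq_zero, ← integral_neg, ← key]
  refine setIntegral_congr_fun hb.isOpen.measurableSet fun z hz => ?_
  have hUn := hb.isOpen.mem_nhds hz
  have hd : ∀ {h : EuclideanSpace ℝ (Fin n) → ℝ}, ContDiffOn ℝ 2 h U →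
      HasFDerivAt h (fderiv ℝ h z) z := fun h =>
    ((h.contDiffAt hUn).differentiableAt (by simp)).hasFDerivAt
  have hg : ∀ {h : EuclideanSpace ℝ (Fin n) → ℝ}, ContDiffOn ℝ 2 h U →
      HasFDerivAt (gradDensity b h) (fderiv ℝ (gradDensity b h) z) z := fun h =>
    (((hb.contDiffOn_gradDensity h).contDiffAt hUn).differentiableAt (by simp)).hasFDerivAt
  have h1 : HasFDerivAt V _ z := ((hd hφ).smul (hg hf)).sub ((hd hf).smul (hg hφ))
  simp only [h1.fderiv, map_sub, map_add, map_smul, traceL_smulRight,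
    hb.trace_fderiv_gradDensity hf hz, hb.trace_fderiv_gradDensity hφ hz, gradDensity, smul_eq_mul,
    hb.inverse_symm hz (fderiv ℝ f z)]
  ring

end Green

/-! ### Parametrizations: a common treatment of inverse charts and of the covering of the end -/

section Parametrization

variable {n : ℕ} {X : Type*} [TopologicalSpace X] [ChartedSpace (EuclideanSpace ℝ (Fin n)) X]

/-- `ψ` is a smooth immersion of the open set `U` of `ℝⁿ` into the `n`-manifold `X`. -/
structure IsParam (ψ : EuclideanSpace ℝ (Fin n) → X) (U : Set (EuclideanSpace ℝ (Fin n))) :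
    Prop where
  isOpen : IsOpen U
  contMDiffOn : ContMDiffOn (𝓡 n) (𝓡 n) ∞ ψ U
  injective : ∀ z ∈ U, Function.Injective (mfderiv (𝓡 n) (𝓡 n) ψ z)

lemma IsParam.mono {ψ : EuclideanSpace ℝ (Fin n) → X} {U V : Set (EuclideanSpace ℝ (Fin n))}
    (h : IsParam ψ U) (hV : IsOpen V) (hVU : V ⊆ U) : IsParam ψ V :=
  ⟨hV, h.contMDiffOn.mono hVU, fun z hz => h.injective z (hVU hz)⟩

lemma IsParam.mdifferentiableAt {ψ : EuclideanSpace ℝ (Fin n) → X}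
    {U : Set (EuclideanSpace ℝ (Fin n))} (h : IsParam ψ U) {z : EuclideanSpace ℝ (Fin n)}
    (hz : z ∈ U) : MDifferentiableAt (𝓡 n) (𝓡 n) ψ z :=
  ((h.contMDiffOn z hz).contMDiffAt (h.isOpen.mem_nhds hz)).mdifferentiableAt (by simp)

lemma IsParam.contDiffOn_comp {ψ : EuclideanSpace ℝ (Fin n) → X}
    {U : Set (EuclideanSpace ℝ (Fin n))} (hψ : IsParam ψ U) {f : X → ℝ} {k : ℕ∞}
    (hf : ContMDiff (𝓡 n) 𝓘(ℝ, ℝ) k f) : ContDiffOn ℝ k (f ∘ ψ) U :=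
  contMDiffOn_iff_contDiffOn.1
    (hf.comp_contMDiffOn (hψ.contMDiffOn.of_le (by exact_mod_cast le_top)))

lemma isParam_of_isLocalDiffeomorphOn {ψ : EuclideanSpace ℝ (Fin n) → X}
    {U : Set (EuclideanSpace ℝ (Fin n))} (hU : IsOpen U)
    (h : IsLocalDiffeomorphOn (𝓡 n) (𝓡 n) ∞ ψ U) : IsParam ψ U := by
  refine ⟨hU, h.contMDiffOn, fun z hz => ?_⟩
  exact ((h ⟨z, hz⟩).mfderivToContinuousLinearEquiv (by simp)).injective

/-- The domain of the transition map from a parametrization to the chart at `p`. -/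
lemma IsParam.isOpen_transition {ψ : EuclideanSpace ℝ (Fin n) → X}
    {U : Set (EuclideanSpace ℝ (Fin n))} (hψ : IsParam ψ U) (p : X) :
    IsOpen (U ∩ ψ ⁻¹' (extChartAt (𝓡 n) p).source) :=
  hψ.contMDiffOn.continuousOn.isOpen_inter_preimage hψ.isOpen (isOpen_extChartAt_source p)

variable [IsManifold (𝓡 n) ∞ X]

lemma isParam_extChartAt_symm (p : X) :
    IsParam (extChartAt (𝓡 n) p).symm (extChartAt (𝓡 n) p).target := by
  have ho : IsOpen (extChartAt (𝓡 n) p).target := isOpen_extChartAt_target p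
  refine ⟨ho, contMDiffOn_extChartAt_symm p, fun z hz => ?_⟩
  have hs : (extChartAt (𝓡 n) p).symm z ∈ (extChartAt (𝓡 n) p).source :=
    (extChartAt (𝓡 n) p).map_target hz
  have h1 : MDifferentiableAt (𝓡 n) (𝓡 n) (extChartAt (𝓡 n) p).symm z :=
    ((contMDiffOn_extChartAt_symm (n := ∞) p z hz).contMDiffAt
      (ho.mem_nhds hz)).mdifferentiableAt (by simp)
  have h2 : MDifferentiableAt (𝓡 n) (𝓡 n) (extChartAt (𝓡 n) p) ((extChartAt (𝓡 n) p).symm z) :=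
    (contMDiffAt_extChartAt' (n := ∞) (by simpa using hs)).mdifferentiableAt (by simp)
  have h3 := mfderiv_comp z h2 h1
  have h4 : (extChartAt (𝓡 n) p) ∘ (extChartAt (𝓡 n) p).symm =ᶠ[𝓝 z] id :=
    Filter.eventually_of_mem (ho.mem_nhds hz) fun y hy => (extChartAt (𝓡 n) p).right_inv hy
  rw [h4.mfderiv_eq, mfderiv_id] at h3
  intro v w hvw
  have h5 := congrArg (mfderiv (𝓡 n) (𝓡 n) (extChartAt (𝓡 n) p) ((extChartAt (𝓡 n) p).symm z)) hvw
  have h6 := fun u => DFunLike.congr_fun h3 u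
  exact (h6 v).trans (h5.trans (h6 w).symm)

lemma pullbackMetric_apply (g : Metric n X) (ψ : EuclideanSpace ℝ (Fin n) → X)
    (z v w : EuclideanSpace ℝ (Fin n)) : pullbackMetric g ψ z v w =
      g.inner (ψ z) (mfderiv (𝓡 n) (𝓡 n) ψ z v) (mfderiv (𝓡 n) (𝓡 n) ψ z w) := rfl

/-- Gives smooth sections of the tangent bundle along `ψ`, into which the metric, a smooth section
of a bundle of forms, can be evaluated. -/
lemma contMDiffOn_mfderiv_apply {ψ : EuclideanSpace ℝ (Fin n) → X}
    {U : Set (EuclideanSpace ℝ (Fin n))} (hψ : IsParam ψ U) (v : EuclideanSpace ℝ (Fin n)) :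
    ContMDiffOn (𝓡 n) (𝓡 n).tangent ∞ (fun z => (Bundle.TotalSpace.mk'
      (EuclideanSpace ℝ (Fin n)) (E := TangentSpace (𝓡 n) (M := X)) (ψ z)
      (mfderiv (𝓡 n) (𝓡 n) ψ z v))) U := by
  have h1 := hψ.contMDiffOn.contMDiffOn_tangentMapWithin (m := ∞) (by simp)
    hψ.isOpen.uniqueMDiffOn
  have h2 : ContMDiff (𝓡 n) (𝓡 n).tangent ∞
      (fun z : EuclideanSpace ℝ (Fin n) =>
        (⟨z, v⟩ : TangentBundle (𝓡 n) (EuclideanSpace ℝ (Fin n)))) := fun z =>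
    contMDiffAt_vectorSpace_iff_contDiffAt.2 contDiffAt_const
  refine (h1.comp h2.contMDiffOn fun z hz => hz).congr fun z hz => ?_
  simp only [Function.comp_apply, tangentMapWithin]
  rw [mfderivWithin_of_isOpen hψ.isOpen hz]

lemma contDiffOn_pullbackMetric_apply (g : Metric n X) {ψ : EuclideanSpace ℝ (Fin n) → X}
    {U : Set (EuclideanSpace ℝ (Fin n))} (hψ : IsParam ψ U) (v w : EuclideanSpace ℝ (Fin n)) :
    ContDiffOn ℝ ∞ (fun z => pullbackMetric g ψ z v w) U := by
  intro z hz
  have h3 : ContMDiffWithinAt (𝓡 n) ((𝓡 n).prod 𝓘(ℝ)) ∞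
      (fun m ↦ Bundle.TotalSpace.mk' ℝ (E := Bundle.Trivial X ℝ) (ψ m)
        (g.inner (ψ m) (mfderiv (𝓡 n) (𝓡 n) ψ m v) (mfderiv (𝓡 n) (𝓡 n) ψ m w))) U z := by
    apply ContMDiffWithinAt.clm_bundle_apply₂ (F₁ := EuclideanSpace ℝ (Fin n))
      (F₂ := EuclideanSpace ℝ (Fin n))
    · exact ContMDiffAt.comp_contMDiffWithinAt z g.contMDiff.contMDiffAt (hψ.contMDiffOn z hz)
    · exact contMDiffOn_mfderiv_apply hψ v z hz
    · exact contMDiffOn_mfderiv_apply hψ w z hz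
  simp only [Bundle.contMDiffWithinAt_totalSpace] at h3
  exact h3.2.contDiffWithinAt

lemma isMetricOn_pullbackMetric (g : Metric n X) {ψ : EuclideanSpace ℝ (Fin n) → X}
    {U : Set (EuclideanSpace ℝ (Fin n))} (hψ : IsParam ψ U) :
    IsMetricOn (pullbackMetric g ψ) U where
  isOpen := hψ.isOpen
  contDiffOn := contDiffOn_clm_apply.2 fun v => contDiffOn_clm_apply.2 fun w =>
    contDiffOn_pullbackMetric_apply g hψ v w
  symm z _ _ _ := g.symm (ψ z) _ _
  pos z hz _ hv := g.pos (ψ z) _ fun h0 =>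
    hv (hψ.injective z hz (h0.trans (mfderiv (𝓡 n) (𝓡 n) ψ z).map_zero.symm))

lemma IsParam.contDiffOn_transition {ψ : EuclideanSpace ℝ (Fin n) → X}
    {U : Set (EuclideanSpace ℝ (Fin n))} (hψ : IsParam ψ U) (p : X) :
    ContDiffOn ℝ ∞ (extChartAt (𝓡 n) p ∘ ψ) (U ∩ ψ ⁻¹' (extChartAt (𝓡 n) p).source) := by
  refine contMDiffOn_iff_contDiffOn.1 ((contMDiffOn_extChartAt (x := p)).comp
    (hψ.contMDiffOn.mono inter_subset_left) fun z hz => ?_)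
  simpa using hz.2

lemma IsParam.fderiv_transition {ψ : EuclideanSpace ℝ (Fin n) → X}
    {U : Set (EuclideanSpace ℝ (Fin n))} (hψ : IsParam ψ U) (p : X)
    {z : EuclideanSpace ℝ (Fin n)} (hz : z ∈ U ∩ ψ ⁻¹' (extChartAt (𝓡 n) p).source)
    (v : EuclideanSpace ℝ (Fin n)) :
    fderiv ℝ (extChartAt (𝓡 n) p ∘ ψ) z v =
      mfderiv (𝓡 n) (𝓡 n) (extChartAt (𝓡 n) p) (ψ z) (mfderiv (𝓡 n) (𝓡 n) ψ z v) := by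
  have h2 : MDifferentiableAt (𝓡 n) (𝓡 n) (extChartAt (𝓡 n) p) (ψ z) :=
    (contMDiffAt_extChartAt' (n := ∞) (by simpa using hz.2)).mdifferentiableAt (by simp)
  have h3 := mfderiv_comp z h2 (hψ.mdifferentiableAt hz.1)
  rw [mfderiv_eq_fderiv] at h3
  exact DFunLike.congr_fun h3 v

lemma IsParam.pullbackMetric_transition (g : Metric n X) {ψ : EuclideanSpace ℝ (Fin n) → X}
    {U : Set (EuclideanSpace ℝ (Fin n))} (hψ : IsParam ψ U) (p : X)
    {z : EuclideanSpace ℝ (Fin n)} (hz : z ∈ U ∩ ψ ⁻¹' (extChartAt (𝓡 n) p).source)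
    (v w : EuclideanSpace ℝ (Fin n)) :
    pullbackMetric g ψ z v w = chartMetric g p (extChartAt (𝓡 n) p (ψ z))
      (fderiv ℝ (extChartAt (𝓡 n) p ∘ ψ) z v) (fderiv ℝ (extChartAt (𝓡 n) p ∘ ψ) z w) := by
  have hO := (hψ.isOpen_transition p).mem_nhds hz
  have hmem : (extChartAt (𝓡 n) p ∘ ψ) z ∈ (extChartAt (𝓡 n) p).target :=
    (extChartAt (𝓡 n) p).map_source hz.2
  have hτ : MDifferentiableAt (𝓡 n) (𝓡 n) (extChartAt (𝓡 n) p ∘ ψ) z :=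
    (((hψ.contDiffOn_transition p).contDiffAt hO).differentiableAt
      (by simp)).mdifferentiableAt
  have h1 := mfderiv_comp z ((isParam_extChartAt_symm p).mdifferentiableAt hmem) hτ
  have h2 : (extChartAt (𝓡 n) p).symm ∘ (extChartAt (𝓡 n) p ∘ ψ) =ᶠ[𝓝 z] ψ :=
    Filter.eventually_of_mem hO fun y hy => (extChartAt (𝓡 n) p).left_inv hy.2
  rw [h2.mfderiv_eq] at h1
  have h3 : ∀ v : EuclideanSpace ℝ (Fin n), (mfderiv (𝓡 n) (𝓡 n) ψ z v : EuclideanSpace ℝ (Fin n)) =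
      mfderiv (𝓡 n) (𝓡 n) (extChartAt (𝓡 n) p).symm (extChartAt (𝓡 n) p (ψ z))
        (fderiv ℝ (extChartAt (𝓡 n) p ∘ ψ) z v) := by
    intro v
    rw [← mfderiv_eq_fderiv]
    exact DFunLike.congr_fun h1 v
  have h4 : (extChartAt (𝓡 n) p).symm (extChartAt (𝓡 n) p (ψ z)) = ψ z :=
    (extChartAt (𝓡 n) p).left_inv hz.2
  -- The two base points are equal, but not by definition, so the forms on the two tangent spaces
  -- are compared by substituting one base point for the other.
  have key : ∀ x (_ : x = ψ z) (a b : EuclideanSpace ℝ (Fin n)),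
      (g.inner (ψ z) : EuclideanSpace ℝ (Fin n) →L[ℝ] EuclideanSpace ℝ (Fin n) →L[ℝ] ℝ) a b =
      (g.inner x : EuclideanSpace ℝ (Fin n) →L[ℝ] EuclideanSpace ℝ (Fin n) →L[ℝ] ℝ) a b := by
    rintro x rfl a b
    rfl
  rw [pullbackMetric_apply, chartMetric, pullbackMetric_apply]
  refine Eq.trans ?_ (key _ h4 _ _)
  rw [← h3 v, ← h3 w]

variable (g : Metric n X)

/-- Iterated covariant derivatives can be computed in any parametrization. -/
lemma nablaIter_eq {ψ : EuclideanSpace ℝ (Fin n) → X} {U : Set (EuclideanSpace ℝ (Fin n))}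
    (hψ : IsParam ψ U) {f : X → ℝ} {k : ℕ} (hf : ContMDiff (𝓡 n) 𝓘(ℝ, ℝ) k f)
    {z : EuclideanSpace ℝ (Fin n)} (hz : z ∈ U) (v : Fin k → EuclideanSpace ℝ (Fin n)) :
    nablaIter g f k (ψ z) (fun i => mfderiv (𝓡 n) (𝓡 n) ψ z (v i)) =
      iterCovDerivTensor (christoffelTensor (pullbackMetric g ψ)) (f ∘ ψ) k z v := by
  set p := ψ z with hp
  have hmem : z ∈ U ∩ ψ ⁻¹' (extChartAt (𝓡 n) p).source := ⟨hz, mem_extChartAt_source p⟩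
  have hb : IsMetricOn (chartMetric g p) (extChartAt (𝓡 n) p).target :=
    isMetricOn_pullbackMetric g (isParam_extChartAt_symm p)
  have hb' : IsMetricOn (pullbackMetric g ψ) (U ∩ ψ ⁻¹' (extChartAt (𝓡 n) p).source) :=
    isMetricOn_pullbackMetric g (hψ.mono (hψ.isOpen_transition p) inter_subset_left)
  have hmaps : MapsTo (extChartAt (𝓡 n) p ∘ ψ) (U ∩ ψ ⁻¹' (extChartAt (𝓡 n) p).source)
      (extChartAt (𝓡 n) p).target := fun y hy => (extChartAt (𝓡 n) p).map_source hy.2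
  have hfc : ContDiffOn ℝ k (f ∘ (extChartAt (𝓡 n) p).symm) (extChartAt (𝓡 n) p).target :=
    (isParam_extChartAt_symm p).contDiffOn_comp (k := k) hf
  have h1 := iterCovDerivTensor_comp hb hb' (hψ.contDiffOn_transition p) hmaps
    (fun y hy => hψ.pullbackMetric_transition g p hy)
    (f := f ∘ (extChartAt (𝓡 n) p).symm) (f' := f ∘ ψ)
    (fun y hy => (congrArg f ((extChartAt (𝓡 n) p).left_inv hy.2)).symm) hfc hmem v
  rw [h1]
  refine (iterCovDeriv_eq hb hfc (mem_extChartAt_target p) _).trans ?_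
  refine congrArg (iterCovDerivTensor _ _ k _) (funext fun i => ?_)
  exact (hψ.fderiv_transition p hmem (v i)).symm

/-- The Laplacian can be computed in any parametrization. -/
lemma laplacian_eq {ψ : EuclideanSpace ℝ (Fin n) → X} {U : Set (EuclideanSpace ℝ (Fin n))}
    (hψ : IsParam ψ U) {f : X → ℝ} (hf : ContMDiff (𝓡 n) 𝓘(ℝ, ℝ) 2 f)
    {z : EuclideanSpace ℝ (Fin n)} (hz : z ∈ U) :
    laplacian g f (ψ z) = metricLaplacian (pullbackMetric g ψ) (f ∘ ψ) z := by
  set p := ψ z with hp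
  have hmem : z ∈ U ∩ ψ ⁻¹' (extChartAt (𝓡 n) p).source := ⟨hz, mem_extChartAt_source p⟩
  have hb : IsMetricOn (chartMetric g p) (extChartAt (𝓡 n) p).target :=
    isMetricOn_pullbackMetric g (isParam_extChartAt_symm p)
  have hb' : IsMetricOn (pullbackMetric g ψ) (U ∩ ψ ⁻¹' (extChartAt (𝓡 n) p).source) :=
    isMetricOn_pullbackMetric g (hψ.mono (hψ.isOpen_transition p) inter_subset_left)
  have hmaps : MapsTo (extChartAt (𝓡 n) p ∘ ψ) (U ∩ ψ ⁻¹' (extChartAt (𝓡 n) p).source)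
      (extChartAt (𝓡 n) p).target := fun y hy => (extChartAt (𝓡 n) p).map_source hy.2
  have hfc : ContDiffOn ℝ 2 (f ∘ (extChartAt (𝓡 n) p).symm) (extChartAt (𝓡 n) p).target :=
    (isParam_extChartAt_symm p).contDiffOn_comp (k := 2) hf
  have hpt := mem_extChartAt_target (I := 𝓡 n) p
  rw [metricLaplacian_comp hb hb' (hψ.contDiffOn_transition p) hmaps
    (fun y hy => hψ.pullbackMetric_transition g p hy)
    (f := f ∘ (extChartAt (𝓡 n) p).symm) (f' := f ∘ ψ)
    (fun y hy => (congrArg f ((extChartAt (𝓡 n) p).left_inv hy.2)).symm) hfc hmem, laplacian,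
    coordLaplacian_eq hb hpt (hfc.contDiffAt (hb.isOpen.mem_nhds hpt))]
  rfl

/-- The definition of `laplacian` uses a different chart at each point. By `laplacian_eq` all values
near `p` can be computed in the one chart at `p`, where regularity is visible. -/
lemma contMDiff_laplacian {f : X → ℝ} {m k : ℕ∞} (hmk : m + 2 ≤ k)
    (hf : ContMDiff (𝓡 n) 𝓘(ℝ, ℝ) k f) : ContMDiff (𝓡 n) 𝓘(ℝ, ℝ) m (laplacian g f) := by
  have hf2 : ContMDiff (𝓡 n) 𝓘(ℝ, ℝ) 2 f := by
    have h2 : ((2 : ℕ∞) : WithTop ℕ∞) ≤ k := by exact_mod_cast le_add_self.trans hmk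
    exact hf.of_le h2
  intro p
  have hψ := isParam_extChartAt_symm (n := n) p
  have h1 : ContDiffOn ℝ m (metricLaplacian (chartMetric g p) (f ∘ (extChartAt (𝓡 n) p).symm))
      (extChartAt (𝓡 n) p).target :=
    contDiffOn_metricLaplacian (isMetricOn_pullbackMetric g hψ) hmk (hψ.contDiffOn_comp hf)
  have h2 : ContMDiffOn (𝓡 n) 𝓘(ℝ, ℝ) m
      (metricLaplacian (chartMetric g p) (f ∘ (extChartAt (𝓡 n) p).symm) ∘ extChartAt (𝓡 n) p)
      (extChartAt (𝓡 n) p).source :=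
    (contMDiffOn_iff_contDiffOn.2 h1).comp
      ((contMDiffOn_extChartAt (n := m) (x := p)).mono (by simp))
      fun x hx => (extChartAt (𝓡 n) p).map_source hx
  refine ((h2.congr fun x hx => ?_).contMDiffAt
    ((isOpen_extChartAt_source p).mem_nhds (mem_extChartAt_source p)))
  have h3 := laplacian_eq g hψ hf2 ((extChartAt (𝓡 n) p).map_source hx)
  rwa [(extChartAt (𝓡 n) p).left_inv hx] at h3

lemma continuous_laplacian {f : X → ℝ} (hf : ContMDiff (𝓡 n) 𝓘(ℝ, ℝ) 2 f) :
    Continuous (laplacian g f) :=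
  (contMDiff_laplacian g (m := 0) (k := 2) (by simp) hf).continuous

end Parametrization

lemma measurableSet_inter_preimage {α β : Type*} [TopologicalSpace α] [MeasurableSpace α]
    [OpensMeasurableSpace α] [TopologicalSpace β] [MeasurableSpace β] [BorelSpace β] {f : α → β}
    {U : Set α} (hU : MeasurableSet U) (hf : ContinuousOn f U) {A : Set β} (hA : MeasurableSet A) :
    MeasurableSet (U ∩ f ⁻¹' A) := by
  have h1 : Measurable (U.domRestrict f) := (continuousOn_iff_continuous_domRestrict.1 hf).measurable
  have h2 := (MeasurableEmbedding.subtype_coe hU).measurableSet_image.2 (h1 hA)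
  convert! h2 using 1
  ext x
  simp [and_comm]

/-! ### The Riemannian volume measure -/

section Volume

variable {n : ℕ} {X : Type*} [TopologicalSpace X] [ChartedSpace (EuclideanSpace ℝ (Fin n)) X]
  [IsManifold (𝓡 n) ∞ X] [MeasurableSpace X] [BorelSpace X] (g : Metric n X)
  {ψ : EuclideanSpace ℝ (Fin n) → X} {U : Set (EuclideanSpace ℝ (Fin n))}

/-- The Riemannian volume of a parametrization, pushed forward to the manifold. -/
def paramVolume (ψ : EuclideanSpace ℝ (Fin n) → X) (U : Set (EuclideanSpace ℝ (Fin n))) :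
    Measure X :=
  (((volume : Measure (EuclideanSpace ℝ (Fin n))).withDensity
      fun z => ENNReal.ofReal (volumeDensity (pullbackMetric g ψ) z)).restrict U).map ψ

lemma chartVolume_eq (p : X) : chartVolume g p
    = paramVolume g (extChartAt (𝓡 n) p).symm (extChartAt (𝓡 n) p).target := rfl

variable {g}

lemma IsParam.aemeasurable_density (hψ : IsParam ψ U) :
    AEMeasurable (fun z => ENNReal.ofReal (volumeDensity (pullbackMetric g ψ) z))
      (volume.restrict U) :=
  ((isMetricOn_pullbackMetric g hψ).contDiffOn_volumeDensity.continuousOn.aemeasurable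
    hψ.isOpen.measurableSet).ennreal_ofReal

lemma IsParam.aemeasurable (hψ : IsParam ψ U) (μ : Measure (EuclideanSpace ℝ (Fin n))) :
    AEMeasurable ψ (μ.restrict U) :=
  hψ.contMDiffOn.continuousOn.aemeasurable hψ.isOpen.measurableSet

lemma paramVolume_apply (hψ : IsParam ψ U) {A : Set X} (hA : MeasurableSet A) :
    paramVolume g ψ U A
      = ∫⁻ z in U ∩ ψ ⁻¹' A, ENNReal.ofReal (volumeDensity (pullbackMetric g ψ) z) := by
  have hm := measurableSet_inter_preimage hψ.isOpen.measurableSet hψ.contMDiffOn.continuousOn hA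
  rw [paramVolume, Measure.map_apply_of_aemeasurable (hψ.aemeasurable _) hA,
    Measure.restrict_apply' hψ.isOpen.measurableSet, inter_comm, withDensity_apply _ hm]

lemma integrable_paramVolume_iff (hψ : IsParam ψ U) {F : X → ℝ}
    (hF : AEStronglyMeasurable F (paramVolume g ψ U)) :
    Integrable F (paramVolume g ψ U)
      ↔ IntegrableOn (fun z => volumeDensity (pullbackMetric g ψ) z * F (ψ z)) U := by
  rw [paramVolume, integrable_map_measure hF (hψ.aemeasurable _),
    restrict_withDensity hψ.isOpen.measurableSet,
    integrable_withDensity_iff_integrable_smul₀' hψ.aemeasurable_density (by simp), IntegrableOn]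
  simp only [Function.comp_apply, smul_eq_mul,
    ENNReal.toReal_ofReal (show 0 ≤ volumeDensity (pullbackMetric g ψ) _ from Real.sqrt_nonneg _)]

lemma integral_paramVolume (hψ : IsParam ψ U) {F : X → ℝ}
    (hF : AEStronglyMeasurable F (paramVolume g ψ U)) :
    ∫ x, F x ∂(paramVolume g ψ U)
      = ∫ z in U, volumeDensity (pullbackMetric g ψ) z * F (ψ z) := by
  rw [paramVolume, integral_map (hψ.aemeasurable _) hF,
    restrict_withDensity hψ.isOpen.measurableSet,
    integral_withDensity_eq_integral_toReal_smul₀ hψ.aemeasurable_density (by simp)]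
  simp only [smul_eq_mul,
    ENNReal.toReal_ofReal (show 0 ≤ volumeDensity (pullbackMetric g ψ) _ from Real.sqrt_nonneg _)]

lemma chartVolume_inter_source (p : X) {A : Set X} (hA : MeasurableSet A) :
    chartVolume g p (A ∩ (extChartAt (𝓡 n) p).source) = chartVolume g p A := by
  have hψ := isParam_extChartAt_symm (n := n) p
  rw [chartVolume_eq, paramVolume_apply hψ hA, paramVolume_apply hψ
    (hA.inter (isOpen_extChartAt_source p).measurableSet)]
  congr 2
  ext y
  simp only [mem_inter_iff, mem_preimage]
  exact ⟨fun h => ⟨h.1, h.2.1⟩, fun h => ⟨h.1, h.2, (extChartAt (𝓡 n) p).map_target h.1⟩⟩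

variable [T2Space X]

/-- The change of variables formula for the transition map, whose Jacobian is the quotient of the
two volume densities by `det_gram_comp`. -/
lemma chartVolume_image (hψ : IsParam ψ U) {W : Set (EuclideanSpace ℝ (Fin n))}
    (hW : MeasurableSet W) (hWU : W ⊆ U) (hinj : InjOn ψ W) {p : X}
    (hp : MapsTo ψ W (extChartAt (𝓡 n) p).source) :
    chartVolume g p (ψ '' W)
      = ∫⁻ z in W, ENNReal.ofReal (volumeDensity (pullbackMetric g ψ) z) := by
  have hA : MeasurableSet (ψ '' W) :=
    hW.image_of_continuousOn_injOn (hψ.contMDiffOn.continuousOn.mono hWU) hinj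
  set φ := extChartAt (𝓡 n) p with hφ
  have hset : φ.target ∩ φ.symm ⁻¹' (ψ '' W) = (φ ∘ ψ) '' W := by
    ext y
    constructor
    · rintro ⟨hy, z, hz, hzy⟩
      exact ⟨z, hz, by rw [Function.comp_apply, hzy, φ.right_inv hy]⟩
    · rintro ⟨z, hz, rfl⟩
      exact ⟨φ.map_source (hp hz), z, hz, (φ.left_inv (hp hz)).symm⟩
  rw [chartVolume_eq, paramVolume_apply (isParam_extChartAt_symm p) hA, hset]
  have hmem : ∀ z ∈ W, z ∈ U ∩ ψ ⁻¹' φ.source := fun z hz => ⟨hWU hz, hp hz⟩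
  rw [lintegral_image_eq_lintegral_abs_det_fderiv_mul volume hW
    (f' := fun z => fderiv ℝ (φ ∘ ψ) z)]
  · refine setLIntegral_congr_fun hW fun z hz => ?_
    have h1 : pullbackMetric g ψ z = (chartMetric g p (φ (ψ z))).bilinearComp
        (fderiv ℝ (φ ∘ ψ) z) (fderiv ℝ (φ ∘ ψ) z) := by
      ext v w
      exact hψ.pullbackMetric_transition g p (hmem z hz) v w
    have h2 : volumeDensity (pullbackMetric g ψ) z
        = |(fderiv ℝ (φ ∘ ψ) z).det| * volumeDensity (chartMetric g p) (φ (ψ z)) := by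
      rw [volumeDensity_eq, h1, det_gram_comp, Real.sqrt_mul (sq_nonneg _), Real.sqrt_sq_eq_abs]
      rfl
    simp only [h2]
    rw [ENNReal.ofReal_mul (abs_nonneg _)]
    rfl
  · intro z hz
    exact (((hψ.contDiffOn_transition p).contDiffAt ((hψ.isOpen_transition p).mem_nhds
      (hmem z hz))).differentiableAt (by simp)).hasFDerivAt.hasFDerivWithinAt
  · exact (φ.injOn.comp hinj hp)

/-- Both sides are computed by the same integral, over the preimage of `A` in the chart at `q`. -/
lemma chartVolume_eq_chartVolume {p q : X} {A : Set X} (hA : MeasurableSet A)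
    (hp : A ⊆ (extChartAt (𝓡 n) p).source) (hq : A ⊆ (extChartAt (𝓡 n) q).source) :
    chartVolume g p A = chartVolume g q A := by
  set φ := extChartAt (𝓡 n) q with hφ
  have hψ := isParam_extChartAt_symm (n := n) q
  have hW := measurableSet_inter_preimage hψ.isOpen.measurableSet hψ.contMDiffOn.continuousOn hA
  have himg : φ.symm '' (φ.target ∩ φ.symm ⁻¹' A) = A := by
    ext x
    constructor
    · rintro ⟨y, hy, rfl⟩
      exact hy.2
    · intro hx
      exact ⟨φ x, ⟨φ.map_source (hq hx), by simpa [φ.left_inv (hq hx)] using hx⟩,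
        φ.left_inv (hq hx)⟩
  have hinj : InjOn φ.symm (φ.target ∩ φ.symm ⁻¹' A) := φ.symm.injOn.mono inter_subset_left
  have h1 := chartVolume_image (g := g) hψ hW inter_subset_left hinj (p := p)
    fun y hy => hp hy.2
  have h2 := chartVolume_image (g := g) hψ hW inter_subset_left hinj (p := q)
    fun y hy => hq hy.2
  rw [himg] at h1 h2
  rw [h1, h2]

variable [SecondCountableTopology X]

variable (n X) in
lemma exists_disjoint_chart_cover [Nonempty X] : ∃ (p : ℕ → X) (D : ℕ → Set X),
    (∀ i, MeasurableSet (D i)) ∧ Pairwise (Function.onFun Disjoint D) ∧ ⋃ i, D i = univ ∧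
    ∀ i, D i ⊆ (extChartAt (𝓡 n) (p i)).source := by
  obtain ⟨s, hs, hcov⟩ := TopologicalSpace.countable_cover_nhds
    (fun x : X => (isOpen_extChartAt_source (I := 𝓡 n) x).mem_nhds (mem_extChartAt_source x))
  have hne : s.Nonempty := by
    by_contra h
    rw [not_nonempty_iff_eq_empty] at h
    subst h
    simp only [mem_empty_iff_false, iUnion_of_empty, iUnion_empty] at hcov
    exact empty_ne_univ hcov
  obtain ⟨p, rfl⟩ := hs.exists_eq_range hne
  refine ⟨p, disjointed fun i => (extChartAt (𝓡 n) (p i)).source, fun i => ?_,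
    disjoint_disjointed _, ?_, disjointed_le _⟩
  · exact MeasurableSet.disjointed (fun i => (isOpen_extChartAt_source _).measurableSet) i
  · rw [iUnion_disjointed]
    simpa using hcov

/-- The supremum is squeezed. The measure `μ`, glued from chart volumes on disjoint pieces, agrees
with each chart volume inside the domain of that chart, hence dominates them all and so dominates
their supremum. -/
lemma riemannianVolume_eq_chartVolume [Nonempty X] {p : X} {A : Set X} (hA : MeasurableSet A)
    (hp : A ⊆ (extChartAt (𝓡 n) p).source) :
    riemannianVolume g A = chartVolume g p A := by
  obtain ⟨q, D, hD, hdisj, hcov, hDq⟩ := exists_disjoint_chart_cover n X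
  set μ : Measure X := Measure.sum fun i => (chartVolume g (q i)).restrict (D i) with hμ
  have hμA : ∀ {A : Set X}, MeasurableSet A → μ A = ∑' i, chartVolume g (q i) (A ∩ D i) := by
    intro A hA
    rw [hμ, Measure.sum_apply _ hA]
    exact tsum_congr fun i => Measure.restrict_apply hA
  have hsplit : ∀ (ν : Measure X) {A : Set X}, MeasurableSet A → ν A = ∑' i, ν (A ∩ D i) := by
    intro ν A hA
    rw [← measure_iUnion (fun i j hij => (hdisj hij).mono inter_subset_right inter_subset_right)
      fun i => hA.inter (hD i), ← inter_iUnion, hcov, inter_univ]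
  have heq : ∀ {p : X} {A : Set X}, MeasurableSet A → A ⊆ (extChartAt (𝓡 n) p).source →
      chartVolume g p A = μ A := by
    intro p A hA hp
    rw [hsplit _ hA, hμA hA]
    exact tsum_congr fun i => chartVolume_eq_chartVolume (hA.inter (hD i))
      (inter_subset_left.trans hp) (inter_subset_right.trans (hDq i))
  have hle : riemannianVolume g ≤ μ := by
    refine iSup_le fun p => Measure.le_iff.2 fun A hA => ?_
    rw [← chartVolume_inter_source p hA, heq (hA.inter (isOpen_extChartAt_source p).measurableSet)
      inter_subset_right]
    exact measure_mono inter_subset_left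
  refine le_antisymm ((hle A).trans (heq hA hp).ge) ?_
  exact (le_iSup (fun p => chartVolume g p) p) A

lemma restrict_riemannianVolume [Nonempty X] (p : X) :
    (riemannianVolume g).restrict (extChartAt (𝓡 n) p).source = chartVolume g p := by
  ext A hA
  rw [Measure.restrict_apply hA, riemannianVolume_eq_chartVolume
    (hA.inter (isOpen_extChartAt_source p).measurableSet) inter_subset_right,
    chartVolume_inter_source p hA]

lemma riemannianVolume_image [Nonempty X] (hψ : IsParam ψ U) {W : Set (EuclideanSpace ℝ (Fin n))}
    (hW : MeasurableSet W) (hWU : W ⊆ U) (hinj : InjOn ψ W) :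
    riemannianVolume g (ψ '' W)
      = ∫⁻ z in W, ENNReal.ofReal (volumeDensity (pullbackMetric g ψ) z) := by
  obtain ⟨q, D, hD, hdisj, hcov, hDq⟩ := exists_disjoint_chart_cover n X
  have hc := hψ.contMDiffOn.continuousOn.mono hWU
  have hWi : ∀ i, MeasurableSet (W ∩ ψ ⁻¹' D i) := fun i =>
    measurableSet_inter_preimage hW hc (hD i)
  have himg : ∀ i, MeasurableSet (ψ '' (W ∩ ψ ⁻¹' D i)) := fun i =>
    (hWi i).image_of_continuousOn_injOn (hc.mono inter_subset_left) (hinj.mono inter_subset_left)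
  have hWeq : W = ⋃ i, W ∩ ψ ⁻¹' D i := by
    rw [← inter_iUnion, ← preimage_iUnion, hcov, preimage_univ, inter_univ]
  conv_lhs => rw [hWeq, image_iUnion]
  conv_rhs => rw [hWeq]
  rw [measure_iUnion (fun i j hij => ?_) himg, lintegral_iUnion hWi]
  · refine tsum_congr fun i => ?_
    have hms : MapsTo ψ (W ∩ ψ ⁻¹' D i) (extChartAt (𝓡 n) (q i)).source := fun z hz => hDq i hz.2
    rw [riemannianVolume_eq_chartVolume (himg i) hms.image_subset,
      chartVolume_image hψ (hWi i) (inter_subset_left.trans hWU) (hinj.mono inter_subset_left) hms]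
  · exact fun i j hij => (hdisj hij).preimage ψ |>.mono inter_subset_right inter_subset_right
  · refine (hdisj hij).mono ?_ ?_
    all_goals
      rintro _ ⟨z, hz, rfl⟩
      exact hz.2

lemma riemannianVolume_lt_top_of_isCompact [Nonempty X] {K : Set X} (hK : IsCompact K) :
    riemannianVolume g K < ⊤ := by
  refine hK.measure_lt_top_of_nhdsWithin fun p _ => ?_
  set φ := extChartAt (𝓡 n) p with hφ
  have hψ := isParam_extChartAt_symm (n := n) p
  obtain ⟨L, hLn, hLt, hLc⟩ := local_compact_nhds (hψ.isOpen.mem_nhds (mem_extChartAt_target p))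
  have hLimg : IsCompact (φ.symm '' L) := hLc.image_of_continuousOn
    (hψ.contMDiffOn.continuousOn.mono hLt)
  have hnhds : φ.symm '' L ∈ 𝓝 p := by
    have h1 : φ ⁻¹' L ∈ 𝓝 p := (continuousAt_extChartAt p).preimage_mem_nhds hLn
    filter_upwards [h1, (isOpen_extChartAt_source (I := 𝓡 n) p).mem_nhds (mem_extChartAt_source p)]
      with x hx hxs
    exact ⟨φ x, hx, φ.left_inv hxs⟩
  refine ⟨φ.symm '' L, mem_nhdsWithin_of_mem_nhds hnhds, ?_⟩
  rw [riemannianVolume_image hψ hLc.measurableSet hLt (φ.symm.injOn.mono hLt)]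
  have h2 : ContinuousOn (volumeDensity (pullbackMetric g φ.symm)) L :=
    (isMetricOn_pullbackMetric g hψ).contDiffOn_volumeDensity.continuousOn.mono hLt
  exact (h2.integrableOn_compact hLc).lintegral_lt_top

end Volume

/-! ### Push-forward of volume under a finite covering -/

section Quotient

variable {n : ℕ} {X : Type*} [TopologicalSpace X] [ChartedSpace (EuclideanSpace ℝ (Fin n)) X]
  [IsManifold (𝓡 n) ∞ X] [MeasurableSpace X] [BorelSpace X] [T2Space X]
  [SecondCountableTopology X] [Nonempty X] {g : Metric n X}
  {ψ : EuclideanSpace ℝ (Fin n) → X} {U : Set (EuclideanSpace ℝ (Fin n))}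

/-- The push-forward of the volume under a locally injective parametrization all of whose fibres
have `N` points. -/
lemma paramVolume_eq_smul (hψ : IsParam ψ U) (hloc : ∀ z ∈ U, ∃ V ∈ 𝓝 z, InjOn ψ V) {Y : Set X}
    (hY : MeasurableSet Y) (hmaps : MapsTo ψ U Y) {N : ℕ}
    (hfib : ∀ x ∈ Y, {z ∈ U | ψ z = x}.encard = N) :
    paramVolume g ψ U = N • (riemannianVolume g).restrict Y := by
  classical
  -- Points outside `U` receive the empty set, so that the choice can be made over all points and
  -- every chosen set lies in `U`.
  have hloc' : ∀ z, ∃ V, (z ∈ U → V ∈ 𝓝[U] z) ∧ InjOn ψ V ∧ IsOpen V ∧ V ⊆ U := by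
    intro z
    by_cases hz : z ∈ U
    · obtain ⟨V, hV, hi⟩ := hloc z hz
      refine ⟨interior V ∩ U, fun _ => mem_nhdsWithin_of_mem_nhds (Filter.inter_mem
        (interior_mem_nhds.2 hV) (hψ.isOpen.mem_nhds hz)),
        hi.mono (inter_subset_left.trans interior_subset), isOpen_interior.inter hψ.isOpen,
        inter_subset_right⟩
    · exact ⟨∅, fun h => absurd h hz, injOn_empty _, isOpen_empty, empty_subset _⟩
  choose V hV hVinj hVo hVU using hloc'
  obtain ⟨t, _, htc, hcov⟩ := TopologicalSpace.countable_cover_nhdsWithin (s := U) (f := V) hV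
  -- The point `0` is added only to make the index set nonempty, so that ℕ enumerates it; its set is
  -- also contained in `U`.
  obtain ⟨e, he⟩ := (htc.insert 0).exists_eq_range (insert_nonempty _ _)
  have hUeq : ⋃ i, V (e i) = U := by
    refine subset_antisymm (iUnion_subset fun i => hVU _) (hcov.trans ?_)
    refine iUnion₂_subset fun x hx => ?_
    obtain ⟨i, rfl⟩ : x ∈ range e := he ▸ mem_insert_of_mem _ hx
    exact subset_iUnion (fun i => V (e i)) i
  set D := disjointed fun i => V (e i) with hDdef
  have hD : ∀ i, MeasurableSet (D i) := fun i =>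
    MeasurableSet.disjointed (fun i => (hVo (e i)).measurableSet) i
  have hdisj : Pairwise (Function.onFun Disjoint D) := disjoint_disjointed _
  have hDU : ⋃ i, D i = U := by rw [hDdef, iUnion_disjointed, hUeq]
  have hDsub : ∀ i, D i ⊆ U := fun i => hDU ▸ subset_iUnion D i
  have hDinj : ∀ i, InjOn ψ (D i) := fun i => (hVinj (e i)).mono (disjointed_le _ i)
  have hc := hψ.contMDiffOn.continuousOn
  have hDimg : ∀ i, MeasurableSet (ψ '' D i) := fun i =>
    (hD i).image_of_continuousOn_injOn (hc.mono (hDsub i)) (hDinj i)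
  -- The sets `D i` partition `U` and `ψ` is injective on each, so the images that contain `x`
  -- correspond to the points of the fibre over `x`.
  have hcount : ∀ x ∈ Y, ∑' i, (ψ '' D i).indicator (1 : X → ENNReal) x = N := by
    intro x hx
    have h1 : ∀ i, (ψ '' D i).indicator (1 : X → ENNReal) x
        = {i | x ∈ ψ '' D i}.indicator (fun _ => (1 : ENNReal)) i := fun i => by
      simp [indicator_apply]
    simp only [h1]
    rw [← tsum_subtype {i | x ∈ ψ '' D i} fun _ => (1 : ENNReal), ENNReal.tsum_set_one]
    have h2 : {i | x ∈ ψ '' D i}.encard = {z ∈ U | ψ z = x}.encard := by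
      have hidx : ∀ z ∈ U, ∃ i, z ∈ D i := fun z hz => by
        rw [← hDU] at hz
        exact mem_iUnion.1 hz
      choose! idx hidx using hidx
      have himg : {i | x ∈ ψ '' D i} = idx '' {z ∈ U | ψ z = x} := by
        ext i
        constructor
        · rintro ⟨z, hz, rfl⟩
          refine ⟨z, ⟨hDsub i hz, rfl⟩, ?_⟩
          by_contra hne
          exact disjoint_left.1 (hdisj hne) (hidx z (hDsub i hz)) hz
        · rintro ⟨z, ⟨hz, rfl⟩, rfl⟩
          exact ⟨z, hidx z hz, rfl⟩
      rw [himg]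
      refine InjOn.encard_image ?_
      rintro z ⟨hz, hzx⟩ w ⟨hw, hwx⟩ hzw
      exact hDinj (idx z) (hidx z hz) (hzw ▸ hidx w hw) (hzx.trans hwx.symm)
    rw [h2, hfib x hx]
    simp
  ext A hA
  rw [paramVolume_apply hψ hA, Measure.smul_apply, Measure.restrict_apply hA]
  have hsets : U ∩ ψ ⁻¹' A = ⋃ i, D i ∩ ψ ⁻¹' A := by rw [← iUnion_inter, hDU]
  have hDA : ∀ i, MeasurableSet (D i ∩ ψ ⁻¹' A) := fun i =>
    measurableSet_inter_preimage (hD i) (hc.mono (hDsub i)) hA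
  rw [hsets, lintegral_iUnion hDA fun i j hij =>
    (hdisj hij).mono inter_subset_left inter_subset_left]
  have h3 : ∀ i, ∫⁻ z in D i ∩ ψ ⁻¹' A, ENNReal.ofReal (volumeDensity (pullbackMetric g ψ) z)
      = ∫⁻ x in A ∩ Y, (ψ '' D i).indicator 1 x ∂(riemannianVolume g) := by
    intro i
    rw [← riemannianVolume_image hψ (hDA i) (inter_subset_left.trans (hDsub i))
      ((hDinj i).mono inter_subset_left), lintegral_indicator_one (hDimg i),
      Measure.restrict_apply (hDimg i), image_inter_preimage]
    congr 1
    ext x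
    constructor
    · rintro ⟨⟨z, hz, rfl⟩, hx⟩
      exact ⟨⟨z, hz, rfl⟩, hx, hmaps (hDsub i hz)⟩
    · rintro ⟨h, hx, _⟩
      exact ⟨h, hx⟩
  simp only [h3]
  rw [← lintegral_tsum fun i => (measurable_one.indicator (hDimg i)).aemeasurable,
    setLIntegral_congr_fun (hA.inter hY) fun x hx => hcount x hx.2]
  simp

end Quotient

/-! ### Locality and additivity of the Laplacian on the manifold -/

section Local

variable {n : ℕ} {X : Type*} [TopologicalSpace X] [ChartedSpace (EuclideanSpace ℝ (Fin n)) X]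
  [IsManifold (𝓡 n) ∞ X] (g : Metric n X)

lemma metricLaplacian_const {E : Type*} [NormedAddCommGroup E] [NormedSpace ℝ E]
    [FiniteDimensional ℝ E] (b : E → E →L[ℝ] E →L[ℝ] ℝ) (c : ℝ) (z : E) :
    metricLaplacian b (fun _ => c) z = 0 := by
  have h : hessian b (fun _ => c) z = 0 := by
    ext u v
    rw [hessian_apply]
    simp
  simp [metricLaplacian, h]

lemma laplacian_eq_chart {f : X → ℝ} (hf : ContMDiff (𝓡 n) 𝓘(ℝ, ℝ) 2 f) (x : X) :
    laplacian g f x = metricLaplacian (chartMetric g x) (f ∘ (extChartAt (𝓡 n) x).symm)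
      (extChartAt (𝓡 n) x x) := by
  have h := laplacian_eq g (isParam_extChartAt_symm (n := n) x) hf (mem_extChartAt_target x)
  rwa [extChartAt_to_inv] at h

lemma contDiffAt_chart {f : X → ℝ} (hf : ContMDiff (𝓡 n) 𝓘(ℝ, ℝ) 2 f) (x : X) :
    ContDiffAt ℝ 2 (f ∘ (extChartAt (𝓡 n) x).symm) (extChartAt (𝓡 n) x x) :=
  ((isParam_extChartAt_symm (n := n) x).contDiffOn_comp (k := 2) hf).contDiffAt
    ((isOpen_extChartAt_target x).mem_nhds (mem_extChartAt_target x))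

lemma laplacian_congr {f f' : X → ℝ} (hf : ContMDiff (𝓡 n) 𝓘(ℝ, ℝ) 2 f)
    (hf' : ContMDiff (𝓡 n) 𝓘(ℝ, ℝ) 2 f') {x : X} (h : f =ᶠ[𝓝 x] f') :
    laplacian g f x = laplacian g f' x := by
  rw [laplacian_eq_chart g hf, laplacian_eq_chart g hf']
  apply metricLaplacian_congr
  have h1 : Filter.Tendsto (extChartAt (𝓡 n) x).symm (𝓝 (extChartAt (𝓡 n) x x)) (𝓝 x) := by
    have := continuousAt_extChartAt_symm (I := 𝓡 n) x
    rwa [ContinuousAt, extChartAt_to_inv] at this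
  exact h1.eventually h

lemma laplacian_eq_zero {f : X → ℝ} (hf : ContMDiff (𝓡 n) 𝓘(ℝ, ℝ) 2 f) {x : X} {c : ℝ}
    (h : f =ᶠ[𝓝 x] fun _ => c) : laplacian g f x = 0 := by
  rw [laplacian_congr g hf contMDiff_const h, laplacian_eq_chart g contMDiff_const]
  exact metricLaplacian_const _ c _

lemma laplacian_add {φ f : X → ℝ} (hφ : ContMDiff (𝓡 n) 𝓘(ℝ, ℝ) 2 φ)
    (hf : ContMDiff (𝓡 n) 𝓘(ℝ, ℝ) 2 f) (x : X) :
    laplacian g (fun y => φ y + f y) x = laplacian g φ x + laplacian g f x := by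
  rw [laplacian_eq_chart g hf, laplacian_eq_chart g hφ,
    laplacian_eq_chart g (f := fun y => φ y + f y) (hφ.add hf)]
  exact metricLaplacian_add _ (contDiffAt_chart hφ x) (contDiffAt_chart hf x)

end Local

/-! ### Green's identity on the manifold -/

section Green

variable {n : ℕ} {X : Type*} [TopologicalSpace X] [ChartedSpace (EuclideanSpace ℝ (Fin n)) X]
  [IsManifold (𝓡 n) ∞ X] [MeasurableSpace X] [BorelSpace X] [T2Space X]
  [SecondCountableTopology X] [Nonempty X] (g : Metric n X)

instance : IsFiniteMeasureOnCompacts (riemannianVolume g) :=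
  ⟨fun _ hK => riemannianVolume_lt_top_of_isCompact hK⟩

/-- The integrand of Green's second identity. -/
def greenIntegrand (φ f : X → ℝ) (x : X) : ℝ := φ x * laplacian g f x - f x * laplacian g φ x

lemma continuous_greenIntegrand {φ f : X → ℝ} (hφ : ContMDiff (𝓡 n) 𝓘(ℝ, ℝ) 2 φ)
    (hf : ContMDiff (𝓡 n) 𝓘(ℝ, ℝ) 2 f) : Continuous (greenIntegrand g φ f) :=
  (hφ.continuous.mul (continuous_laplacian g hf)).sub
    (hf.continuous.mul (continuous_laplacian g hφ))

lemma greenIntegrand_eq_zero {φ f : X → ℝ} (hφ : ContMDiff (𝓡 n) 𝓘(ℝ, ℝ) 2 φ) {x : X}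
    (hx : x ∉ tsupport φ) : greenIntegrand g φ f x = 0 := by
  rw [greenIntegrand, image_eq_zero_of_notMem_tsupport hx,
    laplacian_eq_zero g hφ (notMem_tsupport_iff_eventuallyEq.1 hx)]
  simp

lemma integrable_greenIntegrand {φ f : X → ℝ} (hφ : ContMDiff (𝓡 n) 𝓘(ℝ, ℝ) 2 φ)
    (hf : ContMDiff (𝓡 n) 𝓘(ℝ, ℝ) 2 f) (hc : HasCompactSupport φ) :
    Integrable (greenIntegrand g φ f) (riemannianVolume g) :=
  (continuous_greenIntegrand g hφ hf).integrable_of_hasCompactSupport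
    (HasCompactSupport.intro hc fun _ hx => greenIntegrand_eq_zero g hφ hx)

lemma integral_greenIntegrand_of_chart {φ f : X → ℝ} (hφ : ContMDiff (𝓡 n) 𝓘(ℝ, ℝ) 2 φ)
    (hf : ContMDiff (𝓡 n) 𝓘(ℝ, ℝ) 2 f) (hc : HasCompactSupport φ) {p : X}
    (hp : tsupport φ ⊆ (extChartAt (𝓡 n) p).source) :
    ∫ x, greenIntegrand g φ f x ∂(riemannianVolume g) = 0 := by
  have hψ := isParam_extChartAt_symm (n := n) p
  set e := extChartAt (𝓡 n) p with he
  have h1 : ∫ x in e.source, greenIntegrand g φ f x ∂(riemannianVolume g)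
      = ∫ x, greenIntegrand g φ f x ∂(riemannianVolume g) :=
    setIntegral_eq_integral_of_forall_compl_eq_zero fun x hx =>
      greenIntegrand_eq_zero g hφ fun h => hx (hp h)
  have hmeas : AEStronglyMeasurable (greenIntegrand g φ f) (paramVolume g e.symm e.target) :=
    (continuous_greenIntegrand g hφ hf).aestronglyMeasurable
  rw [← h1, restrict_riemannianVolume, chartVolume_eq, integral_paramVolume hψ hmeas,
    ← (isMetricOn_pullbackMetric g hψ).setIntegral_green (K := e '' tsupport φ)
      (hc.isCompact.image_of_continuousOn ((continuousOn_extChartAt p).mono hp))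
      (fun y hy => by
        obtain ⟨x, hx, rfl⟩ := hy
        exact e.map_source (hp hx))
      (hψ.contDiffOn_comp (k := 2) hφ) (hψ.contDiffOn_comp (k := 2) hf) ?_]
  · refine setIntegral_congr_fun hψ.isOpen.measurableSet fun z hz => ?_
    simp only [greenIntegrand]
    rw [laplacian_eq g hψ hf hz, laplacian_eq g hψ hφ hz]
    rfl
  · intro z hz hzK
    exact image_eq_zero_of_notMem_tsupport (f := φ) (x := e.symm z) fun h => hzK ⟨_, h, e.right_inv hz⟩

/-- Green's second identity on a manifold, for functions one of which has compact support. -/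
theorem integral_greenIntegrand {φ f : X → ℝ} (hφ : ContMDiff (𝓡 n) 𝓘(ℝ, ℝ) 2 φ)
    (hf : ContMDiff (𝓡 n) 𝓘(ℝ, ℝ) 2 f) (hc : HasCompactSupport φ) :
    ∫ x, greenIntegrand g φ f x ∂(riemannianVolume g) = 0 := by
  classical
  have : LocallyCompactSpace X := ChartedSpace.locallyCompactSpace (EuclideanSpace ℝ (Fin n)) X
  obtain ⟨θ, hθ⟩ := SmoothPartitionOfUnity.exists_isSubordinate (𝓡 n) (M := X) isClosed_univ
    (fun p : X => (extChartAt (𝓡 n) p).source) (fun p => isOpen_extChartAt_source p)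
    (fun x _ => mem_iUnion.2 ⟨x, mem_extChartAt_source x⟩)
  have hfin := θ.locallyFinite.finite_nonempty_inter_compact hc.isCompact
  set J := hfin.toFinset with hJ
  have hpiece : ∀ i, ContMDiff (𝓡 n) 𝓘(ℝ, ℝ) 2 (fun x => θ i x * φ x) := fun i =>
    ((θ i).contMDiff.of_le (by norm_cast)).mul hφ
  have hpc : ∀ i, HasCompactSupport (fun x => θ i x * φ x) := fun i => hc.mul_left
  -- The integrand is additive in its first argument, so the identity passes from the pieces to
  -- their sum. Regularity and compact support are carried along, as they are needed to split the
  -- Laplacian and the integral.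
  have hsum : ∀ s : Finset X, ContMDiff (𝓡 n) 𝓘(ℝ, ℝ) 2 (fun x => ∑ i ∈ s, θ i x * φ x) ∧
      HasCompactSupport (fun x => ∑ i ∈ s, θ i x * φ x) ∧
      ∫ x, greenIntegrand g (fun x => ∑ i ∈ s, θ i x * φ x) f x ∂(riemannianVolume g) = 0 := by
    intro s
    induction s using Finset.induction_on with
    | empty =>
      simp only [Finset.sum_empty]
      refine ⟨contMDiff_const, HasCompactSupport.intro isCompact_empty fun x _ => rfl, ?_⟩
      have h0 : ∀ x, greenIntegrand g (fun _ => (0 : ℝ)) f x = 0 := fun x =>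
        greenIntegrand_eq_zero g contMDiff_const (by simp [tsupport])
      simp [h0]
    | insert i s hi ih =>
      obtain ⟨h1, h2, h3⟩ := ih
      simp only [Finset.sum_insert hi]
      refine ⟨(hpiece i).add h1, (hpc i).add h2, ?_⟩
      have h4 : ∀ x, greenIntegrand g (fun x => θ i x * φ x + ∑ j ∈ s, θ j x * φ x) f x
          = greenIntegrand g (fun x => θ i x * φ x) f x
            + greenIntegrand g (fun x => ∑ j ∈ s, θ j x * φ x) f x := by
        intro x
        simp only [greenIntegrand, laplacian_add g (hpiece i) h1]
        ring
      simp only [h4]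
      rw [integral_add (integrable_greenIntegrand g (hpiece i) hf (hpc i))
        (integrable_greenIntegrand g h1 hf h2), h3,
        integral_greenIntegrand_of_chart g (hpiece i) hf (hpc i) (p := i), add_zero]
      exact (closure_mono (Function.support_mul_subset_left _ _)).trans (hθ i)
  have heq : (fun x => ∑ i ∈ J, θ i x * φ x) = φ := by
    ext x
    rw [← Finset.sum_mul]
    by_cases hx : x ∈ tsupport φ
    · have h1 : ∑ i ∈ J, θ i x = 1 := by
        rw [← θ.sum_eq_one (mem_univ x)]
        refine (finsum_eq_sum_of_support_subset _ fun i hi => ?_).symm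
        simp only [hJ, Finite.coe_toFinset, mem_ofPred_eq]
        exact ⟨x, hi, hx⟩
      rw [h1, one_mul]
    · rw [image_eq_zero_of_notMem_tsupport hx, mul_zero]
  have := (hsum J).2.2
  rwa [heq] at this

end Green

/-! ### Symbol calculus outside a ball -/

section Symbols

variable {E F F' G : Type*} [NormedAddCommGroup E] [NormedSpace ℝ E]
  [NormedAddCommGroup F] [NormedSpace ℝ F] [NormedAddCommGroup F'] [NormedSpace ℝ F']
  [NormedAddCommGroup G] [NormedSpace ℝ G]

variable (E) in
/-- The complement of a closed ball. -/
def exterior (R : ℝ) : Set E := {z | R < ‖z‖}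

lemma isOpen_exterior (R : ℝ) : IsOpen (exterior E R) := isOpen_lt continuous_const continuous_norm

lemma exterior_subset {R R' : ℝ} (h : R ≤ R') : exterior E R' ⊆ exterior E R :=
  fun _ hz => h.trans_lt hz

/-- The functions `f` on `{‖z‖ > R}` with `Dᵏ f = O(‖z‖ ^ (m - k))` for `k ≤ N`. -/
structure IsSymbolUpTo (R : ℝ) (N : ℕ) (m : ℝ) (f : E → F) : Prop where
  contDiffOn : ContDiffOn ℝ ∞ f (exterior E R)
  bound : ∀ k ≤ N, ∃ K, ∀ z ∈ exterior E R, ‖iteratedFDeriv ℝ k f z‖ ≤ K * ‖z‖ ^ (m - k)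

/-- The functions `f` on `{‖z‖ > R}` with `Dᵏ f = O(‖z‖ ^ (m - k))` for all `k`. -/
def IsSymbol (R : ℝ) (m : ℝ) (f : E → F) : Prop := ∀ N, IsSymbolUpTo R N m f

variable {R : ℝ} {N : ℕ} {m a b : ℝ} {f : E → F} {h : E → F'}

lemma IsSymbol.contDiffOn (hf : IsSymbol R m f) : ContDiffOn ℝ ∞ f (exterior E R) :=
  (hf 0).contDiffOn

lemma IsSymbol.norm_le (hf : IsSymbol R m f) :
    ∃ K, ∀ z ∈ exterior E R, ‖f z‖ ≤ K * ‖z‖ ^ m := by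
  obtain ⟨K, hK⟩ := (hf 0).bound 0 le_rfl
  exact ⟨K, fun z hz => by simpa using hK z hz⟩

lemma IsSymbolUpTo.of_le {M : ℕ} (hf : IsSymbolUpTo R N m f) (hM : M ≤ N) :
    IsSymbolUpTo R M m f :=
  ⟨hf.contDiffOn, fun k hk => hf.bound k (hk.trans hM)⟩

lemma IsSymbol.mono_radius {R' : ℝ} (hf : IsSymbol R m f) (hR : R ≤ R') : IsSymbol R' m f :=
  fun N => ⟨hf.contDiffOn.mono (exterior_subset hR), fun k hk => by
    obtain ⟨K, hK⟩ := (hf N).bound k hk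
    exact ⟨K, fun z hz => hK z (exterior_subset hR hz)⟩⟩

lemma IsSymbolUpTo.congr {f' : E → F} (hf : IsSymbolUpTo R N m f)
    (hff' : ∀ z ∈ exterior E R, f' z = f z) : IsSymbolUpTo R N m f' := by
  refine ⟨hf.contDiffOn.congr hff', fun k hk => ?_⟩
  obtain ⟨K, hK⟩ := hf.bound k hk
  refine ⟨K, fun z hz => ?_⟩
  have : f' =ᶠ[𝓝 z] f := Filter.eventually_of_mem ((isOpen_exterior R).mem_nhds hz) hff'
  rw [(this.iteratedFDeriv ℝ k).self_of_nhds]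
  exact hK z hz

lemma IsSymbol.congr {f' : E → F} (hf : IsSymbol R m f)
    (hff' : ∀ z ∈ exterior E R, f' z = f z) : IsSymbol R m f' := fun N => (hf N).congr hff'

lemma isSymbolUpTo_zero_iff : IsSymbolUpTo R 0 m f ↔ ContDiffOn ℝ ∞ f (exterior E R) ∧
    ∃ K, ∀ z ∈ exterior E R, ‖f z‖ ≤ K * ‖z‖ ^ m := by
  constructor
  · intro hf
    obtain ⟨K, hK⟩ := hf.bound 0 le_rfl
    exact ⟨hf.contDiffOn, K, fun z hz => by simpa using hK z hz⟩
  · rintro ⟨h1, K, hK⟩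
    refine ⟨h1, fun k hk => ⟨K, fun z hz => ?_⟩⟩
    obtain rfl : k = 0 := Nat.le_zero.1 hk
    simpa using hK z hz

/-- The reason for truncating at `N`: operations whose derivative involves the operation itself,
such as powers and inverses, are treated by induction on `N` through this equivalence. -/
lemma isSymbolUpTo_succ_iff : IsSymbolUpTo R (N + 1) m f ↔
    IsSymbolUpTo R 0 m f ∧ IsSymbolUpTo R N (m - 1) (fderiv ℝ f) := by
  constructor
  · intro hf
    refine ⟨hf.of_le (Nat.zero_le _), hf.contDiffOn.fderiv_of_isOpen (isOpen_exterior R) (by simp),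
      fun k hk => ?_⟩
    obtain ⟨K, hK⟩ := hf.bound (k + 1) (by lia)
    refine ⟨K, fun z hz => ?_⟩
    rw [norm_iteratedFDeriv_fderiv]
    convert! hK z hz using 3
    push_cast
    ring
  · rintro ⟨h1, h2⟩
    refine ⟨h1.contDiffOn, fun k hk => ?_⟩
    cases k with
    | zero => exact h1.bound 0 le_rfl
    | succ k =>
      obtain ⟨K, hK⟩ := h2.bound k (by lia)
      refine ⟨K, fun z hz => ?_⟩
      rw [← norm_iteratedFDeriv_fderiv]
      convert! hK z hz using 3
      push_cast
      ring

lemma IsSymbol.fderiv (hf : IsSymbol R m f) : IsSymbol R (m - 1) (fderiv ℝ f) :=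
  fun N => (isSymbolUpTo_succ_iff.1 (hf (N + 1))).2

lemma isSymbol_of_fderiv (h1 : ContDiffOn ℝ ∞ f (exterior E R))
    (h2 : ∃ K, ∀ z ∈ exterior E R, ‖f z‖ ≤ K * ‖z‖ ^ m)
    (h3 : IsSymbol R (m - 1) (_root_.fderiv ℝ f)) : IsSymbol R m f := by
  have h0 := isSymbolUpTo_zero_iff.2 ⟨h1, h2⟩
  intro N
  cases N with
  | zero => exact h0
  | succ N => exact isSymbolUpTo_succ_iff.2 ⟨h0, h3 N⟩

variable [Fact (0 < R)]

lemma norm_pos_of_mem_exterior {z : E} (hz : z ∈ exterior E R) : 0 < ‖z‖ :=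
  (Fact.out : 0 < R).trans hz

/-- Leibniz's formula: in each term the exponents `a - i` and `b - (k - i)` add up to `a + b - k`.
-/
lemma IsSymbolUpTo.bilin (B : F →L[ℝ] F' →L[ℝ] G) (hf : IsSymbolUpTo R N a f)
    (hh : IsSymbolUpTo R N b h) : IsSymbolUpTo R N (a + b) (fun z => B (f z) (h z)) := by
  refine ⟨contDiffOn_bilin B hf.contDiffOn hh.contDiffOn, fun k hk => ?_⟩
  have hf' := hf.bound
  have hh' := hh.bound
  choose! K hK using hf'
  choose! L hL using hh'
  refine ⟨‖B‖ * ∑ i ∈ Finset.range (k + 1), (k.choose i : ℝ) * K i * L (k - i), fun z hz => ?_⟩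
  have h1 := B.norm_iteratedFDerivWithin_le_of_bilinear (N := ∞) hf.contDiffOn hh.contDiffOn
    (isOpen_exterior R).uniqueDiffOn hz (n := k) (by exact_mod_cast le_top)
  rw [iteratedFDerivWithin_of_isOpen k (isOpen_exterior R) hz] at h1
  refine h1.trans ?_
  rw [mul_assoc, Finset.sum_mul]
  refine mul_le_mul_of_nonneg_left (Finset.sum_le_sum fun i hi => ?_) (norm_nonneg _)
  have hik : i ≤ k := by simpa [Nat.lt_succ_iff] using hi
  rw [iteratedFDerivWithin_of_isOpen i (isOpen_exterior R) hz,
    iteratedFDerivWithin_of_isOpen (k - i) (isOpen_exterior R) hz]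
  have hz0 := norm_pos_of_mem_exterior hz
  have e1 := hK i (hik.trans hk) z hz
  have e2 := hL (k - i) ((Nat.sub_le _ _).trans hk) z hz
  have e3 : ‖z‖ ^ (a + b - k) = ‖z‖ ^ (a - i) * ‖z‖ ^ (b - (k - i : ℕ)) := by
    rw [← Real.rpow_add hz0]
    congr 1
    rw [Nat.cast_sub hik]
    ring
  calc (k.choose i : ℝ) * ‖iteratedFDeriv ℝ i f z‖ * ‖iteratedFDeriv ℝ (k - i) h z‖
      ≤ (k.choose i : ℝ) * (K i * ‖z‖ ^ (a - i)) * (L (k - i) * ‖z‖ ^ (b - (k - i : ℕ))) := by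
        refine mul_le_mul (mul_le_mul_of_nonneg_left e1 (Nat.cast_nonneg _)) e2 (norm_nonneg _)
          (mul_nonneg (Nat.cast_nonneg _) ((norm_nonneg _).trans e1))
    _ = _ := by rw [e3]; ring

lemma IsSymbol.bilin (B : F →L[ℝ] F' →L[ℝ] G) (hf : IsSymbol R a f) (hh : IsSymbol R b h) :
    IsSymbol R (a + b) (fun z => B (f z) (h z)) := fun N => (hf N).bilin B (hh N)

lemma IsSymbolUpTo.of_order_eq (hf : IsSymbolUpTo R N a f) (hab : a = b) :
    IsSymbolUpTo R N b f := hab ▸ hf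

lemma IsSymbol.of_order_eq (hf : IsSymbol R a f) (hab : a = b) : IsSymbol R b f := hab ▸ hf

variable (E R) in
lemma isSymbol_const (c : F) : IsSymbol R 0 (fun _ : E => c) := by
  refine fun N => ⟨contDiffOn_const, fun k _ => ⟨‖c‖, fun z hz => ?_⟩⟩
  cases k with
  | zero => simp
  | succ k =>
    rw [iteratedFDeriv_const_of_ne (by simp)]
    have := norm_pos_of_mem_exterior hz
    simp only [Pi.zero_apply, norm_zero]
    positivity

lemma IsSymbolUpTo.clm (L : F →L[ℝ] G) (hf : IsSymbolUpTo R N m f) :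
    IsSymbolUpTo R N m (fun z => L (f z)) :=
  (IsSymbolUpTo.bilin (ContinuousLinearMap.id ℝ (F →L[ℝ] G)) (isSymbol_const E R L N)
    hf).of_order_eq (zero_add m)

lemma IsSymbol.clm (L : F →L[ℝ] G) (hf : IsSymbol R m f) : IsSymbol R m (fun z => L (f z)) :=
  fun N => (hf N).clm L

/-- Outside the ball of radius `R > 0`, the factor `‖z‖ ^ (a - b)` with a nonpositive exponent is at
most `R ^ (a - b)`. -/
lemma IsSymbolUpTo.of_order_le (hf : IsSymbolUpTo R N a f) (hab : a ≤ b) :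
    IsSymbolUpTo R N b f := by
  refine ⟨hf.contDiffOn, fun k hk => ?_⟩
  obtain ⟨K, hK⟩ := hf.bound k hk
  refine ⟨|K| * R ^ (a - b), fun z hz => (hK z hz).trans ?_⟩
  have hz0 := norm_pos_of_mem_exterior hz
  have e : ‖z‖ ^ (a - k) = ‖z‖ ^ (a - b) * ‖z‖ ^ (b - k) := by
    rw [← Real.rpow_add hz0]
    congr 1
    ring
  rw [e, mul_assoc]
  have e2 : ‖z‖ ^ (a - b) ≤ R ^ (a - b) :=
    Real.rpow_le_rpow_of_nonpos (Fact.out : 0 < R) (le_of_lt hz) (by linarith)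
  refine mul_le_mul (le_abs_self K) (mul_le_mul_of_nonneg_right e2 (by positivity)) (by positivity)
    (abs_nonneg _)

lemma IsSymbol.of_order_le (hf : IsSymbol R a f) (hab : a ≤ b) : IsSymbol R b f :=
  fun N => (hf N).of_order_le hab

lemma IsSymbolUpTo.add {f' : E → F} (hf : IsSymbolUpTo R N m f) (hf' : IsSymbolUpTo R N m f') :
    IsSymbolUpTo R N m (fun z => f z + f' z) := by
  refine ⟨hf.contDiffOn.add hf'.contDiffOn, fun k hk => ?_⟩
  obtain ⟨K, hK⟩ := hf.bound k hk
  obtain ⟨L, hL⟩ := hf'.bound k hk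
  refine ⟨K + L, fun z hz => ?_⟩
  have ho := (isOpen_exterior (E := E) R).mem_nhds hz
  have hk' : (k : WithTop ℕ∞) ≤ ∞ := by exact_mod_cast le_top
  have e : iteratedFDeriv ℝ k (fun z => f z + f' z) z
      = iteratedFDeriv ℝ k f z + iteratedFDeriv ℝ k f' z :=
    fun_iteratedFDeriv_add_apply ((hf.contDiffOn.contDiffAt ho).of_le hk')
      ((hf'.contDiffOn.contDiffAt ho).of_le hk')
  rw [e, add_mul]
  exact (norm_add_le _ _).trans (add_le_add (hK z hz) (hL z hz))

lemma IsSymbol.add {f' : E → F} (hf : IsSymbol R m f) (hf' : IsSymbol R m f') :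
    IsSymbol R m (fun z => f z + f' z) := fun N => (hf N).add (hf' N)

lemma IsSymbolUpTo.neg (hf : IsSymbolUpTo R N m f) : IsSymbolUpTo R N m (fun z => - f z) :=
  hf.clm (-ContinuousLinearMap.id ℝ F)

lemma IsSymbol.neg (hf : IsSymbol R m f) : IsSymbol R m (fun z => - f z) :=
  fun N => (hf N).neg

lemma IsSymbol.sub {f' : E → F} (hf : IsSymbol R m f) (hf' : IsSymbol R m f') :
    IsSymbol R m (fun z => f z - f' z) :=
  (hf.add hf'.neg).congr fun _ _ => sub_eq_add_neg _ _

variable (E R) in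
lemma isSymbol_id : IsSymbol R 1 (fun z : E => z) := by
  refine isSymbol_of_fderiv contDiffOn_id ⟨1, fun z _ => by simp⟩ ?_
  refine (isSymbol_const E R (ContinuousLinearMap.id ℝ E)).of_order_eq (by ring) |>.congr ?_
  intro z _
  exact fderiv_fun_id

/-- Real powers of an elliptic symbol. -/
lemma IsSymbol.rpow {φ : E → ℝ} (hφ : IsSymbol R a φ) {c : ℝ} (hc : 0 < c)
    (hlow : ∀ z ∈ exterior E R, c * ‖z‖ ^ a ≤ φ z) (p : ℝ) :
    IsSymbol R (a * p) (fun z => φ z ^ p) := by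
  have hpos : ∀ z ∈ exterior E R, 0 < φ z := fun z hz =>
    lt_of_lt_of_le (mul_pos hc (Real.rpow_pos_of_pos (norm_pos_of_mem_exterior hz) _)) (hlow z hz)
  have h0 : ∀ p : ℝ, IsSymbolUpTo R 0 (a * p) (fun z => φ z ^ p) := by
    intro p
    refine isSymbolUpTo_zero_iff.2 ⟨hφ.contDiffOn.rpow_const_of_ne fun z hz => (hpos z hz).ne', ?_⟩
    obtain ⟨K, hK⟩ := hφ.norm_le
    -- A nonnegative power is bounded through the upper bound on `φ`, a negative one through the
    -- lower bound.
    rcases le_or_gt 0 p with hp | hp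
    · refine ⟨|K| ^ p, fun z hz => ?_⟩
      have hz0 := norm_pos_of_mem_exterior hz
      rw [Real.norm_of_nonneg (Real.rpow_nonneg (hpos z hz).le p), Real.rpow_mul hz0.le,
        ← Real.mul_rpow (abs_nonneg _) (by positivity)]
      refine Real.rpow_le_rpow (hpos z hz).le ?_ hp
      refine (le_abs_self _).trans ((hK z hz).trans ?_)
      exact mul_le_mul_of_nonneg_right (le_abs_self K) (by positivity)
    · refine ⟨c ^ p, fun z hz => ?_⟩
      have hz0 := norm_pos_of_mem_exterior hz
      rw [Real.norm_of_nonneg (Real.rpow_nonneg (hpos z hz).le p), Real.rpow_mul hz0.le,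
        ← Real.mul_rpow hc.le (by positivity)]
      exact Real.rpow_le_rpow_of_nonpos (by positivity) (hlow z hz) hp.le
  intro N
  induction N generalizing p with
  | zero => exact h0 p
  | succ N ih =>
    refine isSymbolUpTo_succ_iff.2 ⟨h0 p, ?_⟩
    -- The derivative of a power is a lower power times the derivative of `φ`; since the exponent
    -- changes, the induction is over all exponents at once.
    have h1 : IsSymbolUpTo R N (a * (p - 1) + (a - 1))
        (fun z => (p * φ z ^ (p - 1)) • _root_.fderiv ℝ φ z) :=
      IsSymbolUpTo.bilin (ContinuousLinearMap.lsmul ℝ ℝ)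
        ((ih (p - 1)).clm (p • ContinuousLinearMap.id ℝ ℝ)) (hφ.fderiv N)
    refine (h1.of_order_eq (by ring)).congr fun z hz => ?_
    have hd : HasFDerivAt φ (_root_.fderiv ℝ φ z) z := ((hφ.contDiffOn.contDiffAt
      ((isOpen_exterior R).mem_nhds hz)).differentiableAt (by simp)).hasFDerivAt
    exact (hd.rpow_const (Or.inl (hpos z hz).ne')).fderiv

/-- If `e` has negative order and `|e| ≤ 1/2` then `(1 + e) ^ p - 1` has the order of `e`. -/
lemma IsSymbol.one_add_rpow_sub_one {e : E → ℝ} (he : IsSymbol R a e) (ha : a ≤ 0)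
    (hsmall : ∀ z ∈ exterior E R, |e z| ≤ 1 / 2) (p : ℝ) :
    IsSymbol R a (fun z => (1 + e z) ^ p - 1) := by
  have h1 : IsSymbol R 0 (fun z => 1 + e z) := (isSymbol_const E R (1 : ℝ)).add (he.of_order_le ha)
  have hlow : ∀ z ∈ exterior E R, (1 / 2 : ℝ) * ‖z‖ ^ (0 : ℝ) ≤ 1 + e z := fun z hz => by
    have := abs_le.1 (hsmall z hz)
    rw [Real.rpow_zero]
    linarith
  have hpow := fun q => h1.rpow (by norm_num) hlow q
  have hd : ∀ z ∈ exterior E R, HasFDerivAt (fun z => (1 + e z) ^ p - 1)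
      ((p * (1 + e z) ^ (p - 1)) • _root_.fderiv ℝ e z) z := fun z hz => by
    have hd : HasFDerivAt e (_root_.fderiv ℝ e z) z := ((he.contDiffOn.contDiffAt
      ((isOpen_exterior R).mem_nhds hz)).differentiableAt (by simp)).hasFDerivAt
    have h2 := hlow z hz
    rw [Real.rpow_zero] at h2
    exact ((hd.const_add 1).rpow_const (Or.inl (by linarith))).sub_const 1
  refine isSymbol_of_fderiv ((hpow p).contDiffOn.sub contDiffOn_const) ?_ ?_
  · obtain ⟨K, hK⟩ := he.norm_le
    -- The size of the function itself comes from the mean value inequality for `t ^ p` on `[1/2,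
    -- 3/2]`, where `1 + e` takes its values.
    obtain ⟨C, hC⟩ : ∃ C : ℝ, ∀ t ∈ Icc (1 / 2 : ℝ) (3 / 2), ‖p * t ^ (p - 1)‖ ≤ C := by
      refine isCompact_Icc.exists_bound_of_continuousOn (ContinuousOn.mul continuousOn_const ?_)
      exact continuousOn_id.rpow_const fun t ht => Or.inl (by have := ht.1; simp only [id]; linarith)
    refine ⟨C * K, fun z hz => ?_⟩
    have hz := abs_le.1 (hsmall z hz)
    have h3 := (convex_Icc (1 / 2 : ℝ) (3 / 2)).norm_image_sub_le_of_norm_hasDerivWithin_le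
      (f := fun t : ℝ => t ^ p) (f' := fun t : ℝ => p * t ^ (p - 1)) (x := 1) (y := 1 + e z)
      (fun t ht => (Real.hasDerivAt_rpow_const (Or.inl (by
        have := ht.1; linarith))).hasDerivWithinAt) hC
      (by norm_num) (by constructor <;> linarith)
    have hC0 : 0 ≤ C := (norm_nonneg _).trans (hC 1 (by norm_num))
    rw [Real.one_rpow, add_sub_cancel_left] at h3
    rw [mul_assoc]
    exact h3.trans (mul_le_mul_of_nonneg_left (hK z (by assumption)) hC0)
  · have h4 : IsSymbol R (0 * (p - 1) + (a - 1))
        (fun z => (p * (1 + e z) ^ (p - 1)) • _root_.fderiv ℝ e z) :=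
      IsSymbol.bilin (ContinuousLinearMap.lsmul ℝ ℝ)
        ((hpow (p - 1)).clm (p • ContinuousLinearMap.id ℝ ℝ)) he.fderiv
    exact (h4.of_order_eq (by ring)).congr fun z hz => (hd z hz).fderiv

end Symbols

/-! ### Powers of the norm as symbols -/

section Norm

variable {E : Type*} [NormedAddCommGroup E] [InnerProductSpace ℝ E] {R : ℝ} [Fact (0 < R)]

variable (E R) in
-- The norm squared is bilinear in the identity, a symbol of order `1`; then its power `p / 2` is
-- taken.
lemma isSymbol_norm_rpow (p : ℝ) : IsSymbol R p (fun z : E => ‖z‖ ^ p) := by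
  have h1 : IsSymbol R (1 + 1) (fun z : E => inner ℝ z z) :=
    (isSymbol_id E R).bilin (innerSL ℝ) (isSymbol_id E R)
  have h2 := (h1.of_order_eq (by norm_num : (1 : ℝ) + 1 = 2)).rpow (c := 1) one_pos
    (fun _ _ => by
      rw [real_inner_self_eq_norm_sq, one_mul]
      exact_mod_cast le_rfl) (p / 2)
  refine (h2.of_order_eq (by ring)).congr fun z _ => ?_
  rw [real_inner_self_eq_norm_sq, ← Real.rpow_natCast, ← Real.rpow_mul (norm_nonneg z)]
  congr 1
  push_cast
  ring

variable (E R) in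
lemma isSymbol_norm : IsSymbol R 1 (fun z : E => ‖z‖) :=
  (isSymbol_norm_rpow E R 1).congr fun _ _ => (Real.rpow_one _).symm

end Norm

/-! ### Metrics asymptotic to the Euclidean one -/

section FlatEnd

variable {E : Type*} [NormedAddCommGroup E] [InnerProductSpace ℝ E] [FiniteDimensional ℝ E]

variable (E) in
/-- The Euclidean metric. -/
def flatMetric : E →L[ℝ] E →L[ℝ] ℝ := innerSL ℝ

lemma flatMetric_apply (v w : E) : flatMetric E v w = inner ℝ v w := rfl

lemma isMetricOn_flatMetric : IsMetricOn (fun _ => flatMetric E) univ where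
  isOpen := isOpen_univ
  contDiffOn := contDiffOn_const
  symm _ _ _ _ := real_inner_comm _ _
  pos _ _ _ hv := real_inner_self_pos.2 hv

lemma flatMetric_apply_inverse (α : E →L[ℝ] ℝ) : flatMetric E ((flatMetric E).inverse α) = α :=
  isMetricOn_flatMetric.apply_inverse (mem_univ (0 : E)) α

lemma flatMetric_inverse_apply (v : E) : (flatMetric E).inverse (flatMetric E v) = v :=
  isMetricOn_flatMetric.inverse_apply (mem_univ (0 : E)) v

/-- The Euclidean Laplacian, with the sign of geometers. -/
def flatLaplacian (f : E → ℝ) (z : E) : ℝ :=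
  - traceL E ((flatMetric E).inverse ∘L fderiv ℝ (fderiv ℝ f) z)

/-- `b` is a metric on `{‖z‖ > R}` which is uniformly close to the Euclidean metric, and
approaches it with the rate `‖z‖ ^ (-m)`, together with all derivatives. -/
structure IsFlatEnd (R m : ℝ) (b : E → E →L[ℝ] E →L[ℝ] ℝ) : Prop where
  isSymbol : IsSymbol R (-m) (fun z => b z - flatMetric E)
  order_nonneg : 0 ≤ m
  symm : ∀ z ∈ exterior E R, ∀ v w, b z v w = b z w v
  norm_sub_le : ∀ z ∈ exterior E R, ‖b z - flatMetric E‖ ≤ 1 / 2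

variable {R m : ℝ} {b : E → E →L[ℝ] E →L[ℝ] ℝ}

/-- The bound `1/2` on the difference makes the two metrics uniformly equivalent. It is the source
of the constants `2` in the following comparisons, which are not optimal. -/
lemma IsFlatEnd.abs_sub_le (hb : IsFlatEnd R m b) {z : E} (hz : z ∈ exterior E R) (v : E) :
    |b z v v - ‖v‖ ^ 2| ≤ 1 / 2 * ‖v‖ ^ 2 := by
  have h := (b z - flatMetric E).le_opNorm₂ v v
  rw [sub_apply, sub_apply, flatMetric_apply,
    real_inner_self_eq_norm_sq, Real.norm_eq_abs] at h
  nlinarith [hb.norm_sub_le z hz, sq_nonneg ‖v‖]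

lemma IsFlatEnd.norm_sq_le (hb : IsFlatEnd R m b) {z : E} (hz : z ∈ exterior E R) (v : E) :
    ‖v‖ ^ 2 ≤ 2 * b z v v := by
  have := abs_le.1 (hb.abs_sub_le hz v)
  linarith

lemma IsFlatEnd.apply_le (hb : IsFlatEnd R m b) {z : E} (hz : z ∈ exterior E R) (v : E) :
    b z v v ≤ 2 * ‖v‖ ^ 2 := by
  have := abs_le.1 (hb.abs_sub_le hz v)
  nlinarith [sq_nonneg ‖v‖]

lemma IsFlatEnd.norm_le (hb : IsFlatEnd R m b) {z : E} (hz : z ∈ exterior E R) (v : E) :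
    ‖v‖ ≤ 2 * √(b z v v) := by
  have h := hb.norm_sq_le hz v
  have h0 : 0 ≤ b z v v := by nlinarith [sq_nonneg ‖v‖]
  refine abs_le_of_sq_le_sq' ?_ (by positivity) |>.2
  rw [mul_pow, Real.sq_sqrt h0]
  linarith

lemma IsFlatEnd.sqrt_le (hb : IsFlatEnd R m b) {z : E} (hz : z ∈ exterior E R) (v : E) :
    √(b z v v) ≤ 2 * ‖v‖ := by
  rw [Real.sqrt_le_left (by positivity)]
  nlinarith [hb.apply_le hz v, sq_nonneg ‖v‖]

lemma IsFlatEnd.isMetricOn (hb : IsFlatEnd R m b) : IsMetricOn b (exterior E R) where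
  isOpen := isOpen_exterior R
  contDiffOn := (hb.isSymbol.contDiffOn.add contDiffOn_const).congr fun z _ =>
    (sub_add_cancel (b z) (flatMetric E)).symm
  symm := hb.symm
  pos z hz v hv := by
    have := hb.norm_sq_le hz v
    have : 0 < ‖v‖ := norm_pos_iff.2 hv
    nlinarith

lemma IsFlatEnd.norm_inverse_le (hb : IsFlatEnd R m b) {z : E} (hz : z ∈ exterior E R) :
    ‖(b z).inverse‖ ≤ 2 := by
  refine ContinuousLinearMap.opNorm_le_bound _ (by norm_num) fun α => ?_
  have h := hb.norm_sq_le hz ((b z).inverse α)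
  rw [hb.isMetricOn.apply_inverse hz] at h
  have h2 := (le_abs_self _).trans (α.le_opNorm ((b z).inverse α))
  rcases (norm_nonneg ((b z).inverse α)).eq_or_lt with h0 | h0
  · rw [← h0]; positivity
  · nlinarith

variable [Fact (0 < R)]

lemma IsFlatEnd.isSymbol_fderiv (hb : IsFlatEnd R m b) : IsSymbol R (-m - 1) (fderiv ℝ b) := by
  refine hb.isSymbol.fderiv.congr fun z hz => ?_
  rw [fderiv_sub_const]

/-- By `fderiv_inverse` the derivative is the product of `-b⁻¹`, the derivative of `b`, and `b⁻¹`.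
So bounds on `b⁻¹` up to order `N` give those of order `N + 1`. -/
lemma IsFlatEnd.isSymbol_inverse (hb : IsFlatEnd R m b) :
    IsSymbol R 0 (fun z => (b z).inverse) := by
  have h0 : IsSymbolUpTo R 0 0 (fun z => (b z).inverse) := by
    refine isSymbolUpTo_zero_iff.2 ⟨hb.isMetricOn.contDiffOn_inverse, 2, fun z hz => ?_⟩
    simpa using hb.norm_inverse_le hz
  intro N
  induction N with
  | zero => exact h0
  | succ N ih =>
    refine isSymbolUpTo_succ_iff.2 ⟨h0, ?_⟩
    let Fl : ((E →L[ℝ] E) →L[ℝ] ((E →L[ℝ] ℝ) →L[ℝ] E) →L[ℝ] ((E →L[ℝ] ℝ) →L[ℝ] E)) :=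
      ContinuousLinearMap.compL ℝ (E →L[ℝ] ℝ) E E
    have h1 : IsSymbolUpTo R N (0 + (-m - 1)) (fun z =>
        ContinuousLinearMap.compL ℝ E (E →L[ℝ] E →L[ℝ] ℝ) (E →L[ℝ] E)
          (ContinuousLinearMap.compL ℝ E (E →L[ℝ] ℝ) E (b z).inverse) (fderiv ℝ b z)) :=
      (ih.clm (ContinuousLinearMap.compL ℝ E (E →L[ℝ] ℝ) E)).bilin _ (hb.isSymbol_fderiv N)
    have h2 : IsSymbolUpTo R N (0 + (0 + (-m - 1))) (fun z =>
        ContinuousLinearMap.compL ℝ E (E →L[ℝ] E) ((E →L[ℝ] ℝ) →L[ℝ] E)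
          (Fl.flip (b z).inverse)
          (ContinuousLinearMap.compL ℝ E (E →L[ℝ] E →L[ℝ] ℝ) (E →L[ℝ] E)
          (ContinuousLinearMap.compL ℝ E (E →L[ℝ] ℝ) E (b z).inverse) (fderiv ℝ b z))) :=
      (ih.clm Fl.flip).bilin _ h1
    -- The derivative of `b` has order `-m - 1`, which is at most the required `-1`.
    have h3 := h2.of_order_le (show 0 + (0 + (-m - 1)) ≤ 0 - 1 by linarith [hb.order_nonneg])
    refine h3.neg.congr fun z hz => ?_
    ext u α
    rw [hb.isMetricOn.fderiv_inverse hz]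
    rfl

/-- The resolvent identity b⁻¹ - h⁻¹ = -b⁻¹ (b - h) h⁻¹: the decay of `b - h` is inherited. -/
lemma IsFlatEnd.isSymbol_inverse_sub (hb : IsFlatEnd R m b) :
    IsSymbol R (-m) (fun z => (b z).inverse - (flatMetric E).inverse) := by
  let L : (E →L[ℝ] E →L[ℝ] ℝ) →L[ℝ] ((E →L[ℝ] ℝ) →L[ℝ] (E →L[ℝ] ℝ)) :=
    (ContinuousLinearMap.compL ℝ (E →L[ℝ] ℝ) E (E →L[ℝ] ℝ)).flip (flatMetric E).inverse
  have h := (hb.isSymbol_inverse.bilin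
    (ContinuousLinearMap.compL ℝ (E →L[ℝ] ℝ) (E →L[ℝ] ℝ) E) (hb.isSymbol.clm L)).neg
  refine (h.of_order_eq (zero_add _)).congr fun z hz => ?_
  ext1 α
  have e : ((b z).inverse - (flatMetric E).inverse) α = - (b z).inverse
      ((b z - flatMetric E) ((flatMetric E).inverse α)) := by
    rw [sub_apply, sub_apply, map_sub, hb.isMetricOn.inverse_apply hz, flatMetric_apply_inverse]
    abel
  rw [e]
  rfl

lemma IsFlatEnd.isSymbol_christoffelTensor (hb : IsFlatEnd R m b) :
    IsSymbol R (-m - 1) (christoffelTensor b) :=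
  (hb.isSymbol_inverse.bilin (christoffelBilin E) hb.isSymbol_fderiv).of_order_eq (zero_add _)

/-- The Christoffel symbols have order at most `-1`, so the zeroth order part of a covariant
derivative lowers the order by one, as the ordinary derivative does. -/
lemma IsFlatEnd.isSymbol_iterCovDerivTensor (hb : IsFlatEnd R m b) {f : E → ℝ} {a : ℝ}
    (hf : IsSymbol R a f) (k : ℕ) :
    IsSymbol R (a - k) (iterCovDerivTensor (christoffelTensor b) f k) := by
  induction k with
  | zero =>
    exact (hf.clm ((continuousMultilinearCurryFin0 ℝ E ℝ).symm.toContinuousLinearEquiv :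
      ℝ →L[ℝ] E [×0]→L[ℝ] ℝ)).of_order_eq (by simp)
  | succ k ih =>
    have h1 := hb.isSymbol_christoffelTensor.of_order_le
      (show -m - 1 ≤ -1 by linarith [hb.order_nonneg])
    have h2 := (h1.bilin (connectionBilin E k) ih).of_order_eq
      (show -1 + (a - k) = a - k - 1 by ring)
    exact ((ih.fderiv.sub h2).clm (uncurryL E k)).of_order_eq (by push_cast; ring)

lemma isSymbol_flatLaplacian {f : E → ℝ} {a : ℝ} (hf : IsSymbol R a f) :
    IsSymbol R (a - 2) (flatLaplacian f) :=
  ((hf.fderiv.fderiv.clm (ContinuousLinearMap.compL ℝ E (E →L[ℝ] ℝ) E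
    (flatMetric E).inverse)).clm (traceL E)).neg.of_order_eq (by ring)

lemma metricLaplacian_sub_flatLaplacian (b : E → E →L[ℝ] E →L[ℝ] ℝ) (f : E → ℝ) (z : E) :
    metricLaplacian b f z - flatLaplacian f z =
      traceL E ((b z).inverse ∘L
        (ContinuousLinearMap.compL ℝ E E ℝ (fderiv ℝ f z) ∘L christoffelTensor b z))
      - traceL E (((b z).inverse - (flatMetric E).inverse) ∘L fderiv ℝ (fderiv ℝ f) z) := by
  rw [metricLaplacian, flatLaplacian, hessian, ContinuousLinearMap.comp_sub,
    ContinuousLinearMap.sub_comp, map_sub, map_sub]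
  ring

/-- Two corrections separate the Laplacians: the Christoffel symbols contracted with the
differential, and the difference of inverse metrics contracted with the second derivative. Each
gains `m` over the order `a - 2` of the flat Laplacian. -/
lemma IsFlatEnd.isSymbol_metricLaplacian_sub (hb : IsFlatEnd R m b) {f : E → ℝ} {a : ℝ}
    (hf : IsSymbol R a f) :
    IsSymbol R (a - 2 - m) (fun z => metricLaplacian b f z - flatLaplacian f z) := by
  have h1 : IsSymbol R (a - 1 + (-m - 1)) (fun z =>
      ContinuousLinearMap.compL ℝ E E ℝ (fderiv ℝ f z) ∘L christoffelTensor b z) :=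
    (hf.fderiv.clm (ContinuousLinearMap.compL ℝ E E ℝ)).bilin
      (ContinuousLinearMap.compL ℝ E (E →L[ℝ] E) (E →L[ℝ] ℝ)) hb.isSymbol_christoffelTensor
  have h2 := ((hb.isSymbol_inverse.bilin (ContinuousLinearMap.compL ℝ E (E →L[ℝ] ℝ) E)
    h1).clm (traceL E)).of_order_eq (show 0 + (a - 1 + (-m - 1)) = a - 2 - m by ring)
  have h3 := ((hb.isSymbol_inverse_sub.bilin (ContinuousLinearMap.compL ℝ E (E →L[ℝ] ℝ) E)
    hf.fderiv.fderiv).clm (traceL E)).of_order_eq (show -m + (a - 1 - 1) = a - 2 - m by ring)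
  exact (h2.sub h3).congr fun z _ => metricLaplacian_sub_flatLaplacian b f z

lemma norm_traceL_comp_le {F : Type*} [NormedAddCommGroup F] [NormedSpace ℝ F] (A : F →L[ℝ] E)
    (B : E →L[ℝ] F) : |traceL E (A ∘L B)| ≤ ‖traceL E‖ * (‖A‖ * ‖B‖) :=
  ((traceL E).le_opNorm _).trans
    (mul_le_mul_of_nonneg_left (A.opNorm_comp_le B) (norm_nonneg _))

lemma IsFlatEnd.abs_metricLaplacian_le (hb : IsFlatEnd R m b) {z : E} (hz : z ∈ exterior E R) (f : E → ℝ) :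
    |metricLaplacian b f z| ≤ 2 * ‖traceL E‖ * ‖hessian b f z‖ := by
  rw [metricLaplacian, abs_neg]
  refine (norm_traceL_comp_le _ _).trans ?_
  have := mul_le_mul_of_nonneg_right (hb.norm_inverse_le hz) (norm_nonneg (hessian b f z))
  have := mul_le_mul_of_nonneg_left this (norm_nonneg (traceL E))
  linarith

/-- A pointwise version with a constant independent of `f`, as it has to serve the cutoff functions
of all radii at once. -/
lemma IsFlatEnd.abs_metricLaplacian_sub_le (hb : IsFlatEnd R m b) : ∃ C, 0 ≤ C ∧
    ∀ (f : E → ℝ), ∀ z ∈ exterior E R, |metricLaplacian b f z - flatLaplacian f z|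
      ≤ C * ‖z‖ ^ (-m) * (‖fderiv ℝ (fderiv ℝ f) z‖ + ‖fderiv ℝ f z‖ * ‖z‖⁻¹) := by
  obtain ⟨K, hK⟩ := hb.isSymbol_inverse_sub.norm_le
  obtain ⟨L, hL⟩ := hb.isSymbol_christoffelTensor.norm_le
  set T := ‖traceL E‖ with hT
  refine ⟨T * (2 * ‖ContinuousLinearMap.compL ℝ E E ℝ‖ * |L| + |K|), by positivity,
    fun f z hz => ?_⟩
  have hz0 := norm_pos_of_mem_exterior hz
  have e : ‖z‖ ^ (-m - 1) = ‖z‖ ^ (-m) * ‖z‖⁻¹ := by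
    rw [Real.rpow_sub hz0, Real.rpow_one, div_eq_mul_inv]
  have hL' : ‖christoffelTensor b z‖ ≤ |L| * (‖z‖ ^ (-m) * ‖z‖⁻¹) := by
    rw [← e]
    exact (hL z hz).trans (mul_le_mul_of_nonneg_right (le_abs_self L) (by positivity))
  have hK' : ‖(b z).inverse - (flatMetric E).inverse‖ ≤ |K| * ‖z‖ ^ (-m) :=
    (hK z hz).trans (mul_le_mul_of_nonneg_right (le_abs_self K) (by positivity))
  rw [metricLaplacian_sub_flatLaplacian]
  refine (abs_sub _ _).trans ?_
  have h1 : ‖ContinuousLinearMap.compL ℝ E E ℝ (fderiv ℝ f z) ∘L christoffelTensor b z‖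
      ≤ ‖ContinuousLinearMap.compL ℝ E E ℝ‖ * ‖fderiv ℝ f z‖ * (|L| * (‖z‖ ^ (-m) * ‖z‖⁻¹)) :=
    (ContinuousLinearMap.opNorm_comp_le _ _).trans
      (mul_le_mul (ContinuousLinearMap.le_opNorm _ _) hL' (norm_nonneg _) (by positivity))
  have h2 := (norm_traceL_comp_le (b z).inverse
    (ContinuousLinearMap.compL ℝ E E ℝ (fderiv ℝ f z) ∘L christoffelTensor b z)).trans
      (mul_le_mul_of_nonneg_left (mul_le_mul (hb.norm_inverse_le hz) h1 (norm_nonneg _)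
        (by norm_num)) (norm_nonneg _))
  have h3 := (norm_traceL_comp_le ((b z).inverse - (flatMetric E).inverse)
    (fderiv ℝ (fderiv ℝ f) z)).trans (mul_le_mul_of_nonneg_left
      (mul_le_mul_of_nonneg_right hK' (norm_nonneg _)) (norm_nonneg _))
  refine (add_le_add h2 h3).trans ?_
  rw [← hT]
  have n1 : 0 ≤ T * (2 * ‖ContinuousLinearMap.compL ℝ E E ℝ‖ * |L|) * ‖z‖ ^ (-m)
    * ‖fderiv ℝ (fderiv ℝ f) z‖ := by positivity
  have n2 : 0 ≤ T * |K| * ‖z‖ ^ (-m) * (‖fderiv ℝ f z‖ * ‖z‖⁻¹) := by positivity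
  nlinarith

end FlatEnd

/-! ### Radial functions, written through `‖z‖ ^ 2` to stay smooth at the origin -/

section Radial

variable {E : Type*} [NormedAddCommGroup E] [InnerProductSpace ℝ E] [FiniteDimensional ℝ E]

lemma hasFDerivAt_comp_norm_sq {F : ℝ → ℝ} {z : E} {F' : ℝ} (h : HasDerivAt F F' (‖z‖ ^ 2)) :
    HasFDerivAt (fun y : E => F (‖y‖ ^ 2)) ((2 * F') • flatMetric E z) z := by
  have h1 : HasFDerivAt (fun y : E => ‖y‖ ^ 2) (2 • (innerSL ℝ z)) z :=
    (hasStrictFDerivAt_norm_sq z).hasFDerivAt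
  refine (h.comp_hasFDerivAt z h1).congr_fderiv ?_
  ext v
  simp [flatMetric_apply]
  ring

lemma hasFDerivAt_fderiv_comp_norm_sq {F F₁ : ℝ → ℝ} {z : E} {F₂ : ℝ}
    (h : ∀ᶠ t in 𝓝 (‖z‖ ^ 2), HasDerivAt F (F₁ t) t) (h' : HasDerivAt F₁ F₂ (‖z‖ ^ 2)) :
    HasFDerivAt (fderiv ℝ (fun y : E => F (‖y‖ ^ 2)))
      ((2 * F₁ (‖z‖ ^ 2)) • flatMetric E
        + (4 * F₂) • (flatMetric E z).smulRight (flatMetric E z)) z := by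
  have hc : Filter.Tendsto (fun y : E => ‖y‖ ^ 2) (𝓝 z) (𝓝 (‖z‖ ^ 2)) :=
    (continuous_norm.pow 2).tendsto z
  have h1 : fderiv ℝ (fun y : E => F (‖y‖ ^ 2)) =ᶠ[𝓝 z]
      fun y => (2 * F₁ (‖y‖ ^ 2)) • flatMetric E y :=
    (hc.eventually h).mono fun y hy => (hasFDerivAt_comp_norm_sq hy).fderiv
  have h2 : HasFDerivAt (fun y : E => (2 * F₁ (‖y‖ ^ 2)) • flatMetric E y) _ z :=
    ((hasFDerivAt_comp_norm_sq h').const_mul 2).smul (flatMetric E).hasFDerivAt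
  refine (h2.congr_of_eventuallyEq h1).congr_fderiv ?_
  ext v w
  simp [flatMetric_apply]
  ring

/-- The Euclidean Laplacian of a function of `‖z‖ ^ 2`. -/
lemma flatLaplacian_comp_norm_sq {F F₁ : ℝ → ℝ} {z : E} {F₂ : ℝ}
    (h : ∀ᶠ t in 𝓝 (‖z‖ ^ 2), HasDerivAt F (F₁ t) t) (h' : HasDerivAt F₁ F₂ (‖z‖ ^ 2)) :
    flatLaplacian (fun y : E => F (‖y‖ ^ 2)) z
      = - (2 * Module.finrank ℝ E * F₁ (‖z‖ ^ 2) + 4 * ‖z‖ ^ 2 * F₂) := by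
  rw [flatLaplacian, (hasFDerivAt_fderiv_comp_norm_sq h h').fderiv, ContinuousLinearMap.comp_add,
    ContinuousLinearMap.comp_smul, ContinuousLinearMap.comp_smul]
  have e1 : (flatMetric E).inverse ∘L flatMetric E
      = ContinuousLinearMap.id ℝ E := by
    ext1 v
    exact flatMetric_inverse_apply v
  have e2 : (flatMetric E).inverse ∘L
      (flatMetric E z).smulRight (flatMetric E z)
      = (flatMetric E z).smulRight z := by
    ext1 v
    simp only [ContinuousLinearMap.comp_apply, ContinuousLinearMap.smulRight_apply, map_smul]
    congr 1
    exact flatMetric_inverse_apply z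
  have e3 : traceL E (ContinuousLinearMap.id ℝ E) = Module.finrank ℝ E := by
    rw [traceL_apply]
    exact LinearMap.trace_id ℝ E
  rw [e1, e2, map_add, map_smul, map_smul, traceL_smulRight, e3]
  simp only [smul_eq_mul, flatMetric_apply, real_inner_self_eq_norm_sq]
  ring

/-- With p = (2 - N)/2 the formula for functions of `‖z‖ ^ 2` gives -2p (N + 2p - 2) ‖z‖^{2p-2}, and
the bracket vanishes. -/
lemma flatLaplacian_norm_rpow {z : E} (hz : z ≠ 0) :
    flatLaplacian (fun y : E => ‖y‖ ^ (2 - (Module.finrank ℝ E : ℝ))) z = 0 := by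
  set N : ℝ := (Module.finrank ℝ E : ℝ) with hN
  set p : ℝ := (2 - N) / 2 with hp
  have e : (fun y : E => ‖y‖ ^ (2 - N)) = fun y => (‖y‖ ^ 2) ^ p := by
    ext y
    rw [← Real.rpow_natCast, ← Real.rpow_mul (norm_nonneg y)]
    congr 1
    rw [hp]
    push_cast
    ring
  have hz2 : 0 < ‖z‖ ^ 2 := by positivity
  rw [e, flatLaplacian_comp_norm_sq (F := fun t => t ^ p) (F₁ := fun t => p * t ^ (p - 1))
    (F₂ := p * ((p - 1) * (‖z‖ ^ 2) ^ (p - 1 - 1)))]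
  · rw [← hN, Real.rpow_sub_one hz2.ne' (p - 1), hp]
    field_simp
    ring
  · filter_upwards [lt_mem_nhds hz2] with t ht
    exact Real.hasDerivAt_rpow_const (Or.inl ht.ne')
  · exact (Real.hasDerivAt_rpow_const (Or.inl hz2.ne')).const_mul p

end Radial

/-! ### Euclidean cutoff functions and the flux of the fundamental solution -/

section Cutoff

/-- A smooth function which is `1` on `(-∞, 1]` and `0` on `[4, ∞)`. -/
def bump (t : ℝ) : ℝ := Real.smoothTransition ((4 - t) / 3)

lemma contDiff_bump {m : ℕ∞} : ContDiff ℝ m bump :=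
  Real.smoothTransition.contDiff.comp ((contDiff_const.sub contDiff_id).div_const 3)

lemma bump_nonneg (t : ℝ) : 0 ≤ bump t := Real.smoothTransition.nonneg _

lemma bump_le_one (t : ℝ) : bump t ≤ 1 := Real.smoothTransition.le_one _

lemma bump_eq_one {t : ℝ} (ht : t ≤ 1) : bump t = 1 :=
  Real.smoothTransition.one_of_one_le (by linarith)

lemma bump_eq_zero {t : ℝ} (ht : 4 ≤ t) : bump t = 0 :=
  Real.smoothTransition.zero_of_nonpos (by linarith)

lemma hasDerivAt_bump (t : ℝ) : HasDerivAt bump (deriv bump t) t :=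
  ((contDiff_bump (m := 1)).differentiable (by simp) t).hasDerivAt

lemma contDiff_deriv_bump : ContDiff ℝ ∞ (deriv bump) :=
  (contDiff_infty_iff_deriv.1 (contDiff_bump (m := ⊤))).2

lemma hasDerivAt_deriv_bump (t : ℝ) : HasDerivAt (deriv bump) (deriv (deriv bump) t) t :=
  (contDiff_deriv_bump.differentiable (by simp) t).hasDerivAt

lemma continuous_deriv_deriv_bump : Continuous (deriv (deriv bump)) :=
  contDiff_deriv_bump.continuous_deriv (by simp)

lemma deriv_bump_eq_zero {t : ℝ} (ht : t < 1 ∨ 4 < t) : deriv bump t = 0 := by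
  rcases ht with ht | ht
  · have h : bump =ᶠ[𝓝 t] fun _ => 1 :=
      (gt_mem_nhds ht).mono fun y hy => bump_eq_one hy.le
    rw [h.deriv_eq, deriv_const]
  · have h : bump =ᶠ[𝓝 t] fun _ => 0 :=
      (lt_mem_nhds ht).mono fun y hy => bump_eq_zero hy.le
    rw [h.deriv_eq, deriv_const]

lemma deriv_deriv_bump_eq_zero {t : ℝ} (ht : t < 1 ∨ 4 < t) : deriv (deriv bump) t = 0 := by
  rcases ht with ht | ht
  · have h : deriv bump =ᶠ[𝓝 t] fun _ => 0 :=
      (gt_mem_nhds ht).mono fun y hy => deriv_bump_eq_zero (Or.inl hy)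
    rw [h.deriv_eq, deriv_const]
  · have h : deriv bump =ᶠ[𝓝 t] fun _ => 0 :=
      (lt_mem_nhds ht).mono fun y hy => deriv_bump_eq_zero (Or.inr hy)
    rw [h.deriv_eq, deriv_const]

/-- Both functions are continuous and supported in `[1, 4]`. The weights `t` and `t ^ 2` are the
scale-invariant ones: with t = ‖z‖²/s² they yield bounds on cutoff functions in which `s` does not
appear. -/
lemma exists_bump_bound : ∃ M, 0 ≤ M ∧ ∀ t : ℝ,
    |deriv bump t * t| ≤ M ∧ |deriv (deriv bump) t * t ^ 2| ≤ M := by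
  have h : ∀ F : ℝ → ℝ, Continuous F → (∀ t, t < 1 ∨ 4 < t → F t = 0) →
      ∃ M, 0 ≤ M ∧ ∀ t, |F t| ≤ M := by
    intro F hF h0
    obtain ⟨M, hM⟩ := isCompact_Icc.exists_bound_of_continuousOn (s := Icc (1 : ℝ) 4)
      hF.continuousOn
    refine ⟨|M|, abs_nonneg _, fun t => ?_⟩
    by_cases ht : t ∈ Icc (1 : ℝ) 4
    · exact (hM t ht).trans (le_abs_self M)
    · rw [h0 t (by
        by_contra! hc
        exact ht ⟨hc.1, hc.2⟩), abs_zero]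
      exact abs_nonneg M
  obtain ⟨M, hM0, hM⟩ := h (fun t => deriv bump t * t)
    (contDiff_deriv_bump.continuous.mul continuous_id)
    fun t ht => by rw [deriv_bump_eq_zero ht, zero_mul]
  obtain ⟨L, hL0, hL⟩ := h (fun t => deriv (deriv bump) t * t ^ 2)
    (continuous_deriv_deriv_bump.mul (continuous_id.pow 2))
    fun t ht => by rw [deriv_deriv_bump_eq_zero ht, zero_mul]
  exact ⟨M + L, by positivity, fun t =>
    ⟨(hM t).trans (by linarith), (hL t).trans (by linarith)⟩⟩

variable {E : Type*} [NormedAddCommGroup E] [InnerProductSpace ℝ E]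

/-- A cutoff function, which is `1` for `‖z‖ ≤ s` and `0` for `‖z‖ ≥ 2 s`. -/
def cutoff (s : ℝ) (z : E) : ℝ := bump (‖z‖ ^ 2 / s ^ 2)

lemma contDiff_cutoff (s : ℝ) {m : ℕ∞} : ContDiff ℝ m (cutoff s : E → ℝ) :=
  contDiff_bump.comp ((contDiff_norm_sq ℝ).div_const _)

lemma cutoff_eventuallyEq_one {s : ℝ} {z : E} (hz : ‖z‖ < s) :
    (cutoff s : E → ℝ) =ᶠ[𝓝 z] fun _ => 1 := by
  filter_upwards [(isOpen_lt continuous_norm continuous_const).mem_nhds hz] with y hy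
  have hs : 0 < s := (norm_nonneg y).trans_lt hy
  refine bump_eq_one ?_
  rw [div_le_one (by positivity)]
  exact pow_le_pow_left₀ (norm_nonneg y) (le_of_lt hy) 2

lemma hasDerivAt_bump_div (s t : ℝ) :
    HasDerivAt (fun t => bump (t / s ^ 2)) (deriv bump (t / s ^ 2) / s ^ 2) t := by
  refine ((hasDerivAt_bump (t / s ^ 2)).comp t
    ((hasDerivAt_id t).div_const (s ^ 2))).congr_deriv ?_
  ring

lemma hasDerivAt_deriv_bump_div (s t : ℝ) :
    HasDerivAt (fun t => deriv bump (t / s ^ 2) / s ^ 2)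
      (deriv (deriv bump) (t / s ^ 2) / s ^ 4) t := by
  refine (((hasDerivAt_deriv_bump (t / s ^ 2)).comp t
    ((hasDerivAt_id t).div_const (s ^ 2))).div_const (s ^ 2)).congr_deriv ?_
  rw [mul_one_div, div_div]
  congr 1
  ring

variable [FiniteDimensional ℝ E]

variable (E) in
lemma norm_flatMetric_le : ‖flatMetric E‖ ≤ 1 := norm_innerSL_le ℝ

lemma norm_flatMetric_apply (z : E) : ‖flatMetric E z‖ = ‖z‖ := innerSL_apply_norm ℝ z

variable (E) in
lemma exists_cutoff_bound : ∃ C, 0 ≤ C ∧ ∀ s : ℝ, 0 < s → ∀ z : E, z ≠ 0 →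
    ‖fderiv ℝ (cutoff s) z‖ ≤ C * ‖z‖⁻¹ ∧
      ‖fderiv ℝ (fderiv ℝ (cutoff s)) z‖ ≤ C * (‖z‖ ^ 2)⁻¹ := by
  obtain ⟨M, hM0, hM⟩ := exists_bump_bound
  -- The second derivative of F(‖z‖²) has coefficients 2F' and 4F'', each bounded through `M`,
  -- whence 2M + 4M.
  refine ⟨6 * M, by positivity, fun s hs z hz => ?_⟩
  have hz0 : 0 < ‖z‖ := norm_pos_iff.2 hz
  set x := ‖z‖ ^ 2 / s ^ 2 with hx
  have e1 : deriv bump x / s ^ 2 = deriv bump x * x * (‖z‖ ^ 2)⁻¹ := by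
    rw [hx]; field_simp
  have e2 : deriv (deriv bump) x / s ^ 4
      = deriv (deriv bump) x * x ^ 2 * ((‖z‖ ^ 2)⁻¹ * (‖z‖ ^ 2)⁻¹) := by
    rw [hx]; field_simp
  have b1 : |deriv bump x / s ^ 2| ≤ M * (‖z‖ ^ 2)⁻¹ := by
    rw [e1, abs_mul, abs_of_nonneg (by positivity : 0 ≤ (‖z‖ ^ 2)⁻¹)]
    exact mul_le_mul_of_nonneg_right (hM x).1 (by positivity)
  have b2 : |deriv (deriv bump) x / s ^ 4| ≤ M * ((‖z‖ ^ 2)⁻¹ * (‖z‖ ^ 2)⁻¹) := by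
    rw [e2, abs_mul, abs_of_nonneg (by positivity : 0 ≤ (‖z‖ ^ 2)⁻¹ * (‖z‖ ^ 2)⁻¹)]
    exact mul_le_mul_of_nonneg_right (hM x).2 (by positivity)
  constructor
  · have h := (hasFDerivAt_comp_norm_sq (hasDerivAt_bump_div s (‖z‖ ^ 2))).fderiv
    change fderiv ℝ (cutoff s) z = _ at h
    rw [h, norm_smul, norm_flatMetric_apply, Real.norm_eq_abs, abs_mul, abs_two]
    calc 2 * |deriv bump x / s ^ 2| * ‖z‖ ≤ 2 * (M * (‖z‖ ^ 2)⁻¹) * ‖z‖ := by gcongr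
      _ = 2 * M * ‖z‖⁻¹ := by field_simp
      _ ≤ 6 * M * ‖z‖⁻¹ := by gcongr; norm_num
  · have h := (hasFDerivAt_fderiv_comp_norm_sq (z := z)
      (Filter.Eventually.of_forall (hasDerivAt_bump_div s))
      (hasDerivAt_deriv_bump_div s (‖z‖ ^ 2))).fderiv
    change fderiv ℝ (fderiv ℝ (cutoff s)) z = _ at h
    rw [h]
    refine (norm_add_le _ _).trans ?_
    rw [norm_smul, norm_smul, ContinuousLinearMap.norm_smulRight_apply, norm_flatMetric_apply,
      Real.norm_eq_abs, Real.norm_eq_abs, abs_mul, abs_mul, abs_two,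
      abs_of_pos (by norm_num : (0 : ℝ) < 4)]
    calc 2 * |deriv bump x / s ^ 2| * ‖flatMetric E‖
          + 4 * |deriv (deriv bump) x / s ^ 4| * (‖z‖ * ‖z‖)
        ≤ 2 * (M * (‖z‖ ^ 2)⁻¹) * 1
          + 4 * (M * ((‖z‖ ^ 2)⁻¹ * (‖z‖ ^ 2)⁻¹)) * (‖z‖ * ‖z‖) := by
          gcongr
          exact norm_flatMetric_le E
      _ = 6 * M * (‖z‖ ^ 2)⁻¹ := by field_simp; ring

lemma flatLaplacian_cutoff (s : ℝ) (z : E) : flatLaplacian (cutoff s) z =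
    - (2 * Module.finrank ℝ E * (deriv bump (‖z‖ ^ 2 / s ^ 2) / s ^ 2)
      + 4 * ‖z‖ ^ 2 * (deriv (deriv bump) (‖z‖ ^ 2 / s ^ 2) / s ^ 4)) :=
  flatLaplacian_comp_norm_sq (F := fun t => bump (t / s ^ 2))
    (Filter.Eventually.of_forall (hasDerivAt_bump_div s)) (hasDerivAt_deriv_bump_div s _)

/-- The flux of the gradient of the fundamental solution. -/
lemma integral_norm_rpow_mul_flatLaplacian_cutoff [MeasurableSpace E] [BorelSpace E]
    [Nontrivial E] {s : ℝ} (hs : 0 < s) :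
    ∫ z : E, ‖z‖ ^ (2 - (Module.finrank ℝ E : ℝ)) * flatLaplacian (cutoff s) z
      = (Module.finrank ℝ E - 2) * (volume : Measure E).toSphere.real univ := by
  set N := Module.finrank ℝ E with hN
  have hN1 : 1 ≤ N := Module.finrank_pos
  have h1 := integral_fun_norm_addHaar (volume : Measure E)
    (fun r : ℝ => r ^ (2 - (N : ℝ)) * - (2 * N * (deriv bump (r ^ 2 / s ^ 2) / s ^ 2)
      + 4 * r ^ 2 * (deriv (deriv bump) (r ^ 2 / s ^ 2) / s ^ 4)))
  simp only [flatLaplacian_cutoff]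
  rw [h1, Measure.toSphere_real_apply_univ, ← hN]
  -- An antiderivative of the radial integrand, in which r^{N-1} r^{2-N} = r. It vanishes for r > 2s
  -- and takes the value -(N - 2) at 0, so the radial integral is N - 2 for every `s`.
  set A : ℝ → ℝ := fun r => - (2 * (r ^ 2 / s ^ 2) * deriv bump (r ^ 2 / s ^ 2)
    + (N - 2) * bump (r ^ 2 / s ^ 2)) with hA
  have hq : ∀ r : ℝ, HasDerivAt (fun r : ℝ => r ^ 2 / s ^ 2) (2 * r / s ^ 2) r := fun r => by
    simpa using (hasDerivAt_pow 2 r).div_const (s ^ 2)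
  have hA' : ∀ r : ℝ, HasDerivAt A (- (2 * N * (deriv bump (r ^ 2 / s ^ 2) / s ^ 2)
      + 4 * r ^ 2 * (deriv (deriv bump) (r ^ 2 / s ^ 2) / s ^ 4)) * r) r := fun r => by
    have h := ((((hq r).const_mul 2).mul ((hasDerivAt_deriv_bump _).comp r (hq r))).add
      (((hasDerivAt_bump _).comp r (hq r)).const_mul ((N : ℝ) - 2))).neg
    convert! h using 1
    simp only [Function.comp_apply]
    field_simp
    ring
  have hev : ∀ r : ℝ, 2 * s < r → 4 < r ^ 2 / s ^ 2 := fun r hr => by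
    rw [lt_div_iff₀ (by positivity)]
    nlinarith
  have h2 : ∫ r in Ioi (0 : ℝ), - (2 * N * (deriv bump (r ^ 2 / s ^ 2) / s ^ 2)
      + 4 * r ^ 2 * (deriv (deriv bump) (r ^ 2 / s ^ 2) / s ^ 4)) * r = 0 - A 0 := by
    refine integral_Ioi_of_hasDerivAt_of_tendsto' (fun r _ => hA' r) ?_ ?_
    · have hc : Continuous fun r : ℝ => - (2 * N * (deriv bump (r ^ 2 / s ^ 2) / s ^ 2)
          + 4 * r ^ 2 * (deriv (deriv bump) (r ^ 2 / s ^ 2) / s ^ 4)) * r := by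
        have c0 : Continuous fun r : ℝ => r ^ 2 / s ^ 2 := (continuous_id.pow 2).div_const _
        have c1 := contDiff_deriv_bump.continuous.comp c0
        have c2 := continuous_deriv_deriv_bump.comp c0
        exact (((c1.div_const _).const_mul _).add
          (((continuous_id.pow 2).const_mul 4).mul (c2.div_const _))).neg.mul continuous_id
      refine (hc.integrable_of_hasCompactSupport (HasCompactSupport.intro
        (isCompact_Icc (a := - (2 * s)) (b := 2 * s)) fun r hr => ?_)).integrableOn
      have h4 : 4 < r ^ 2 / s ^ 2 := by
        have h5 : 2 * s < |r| := by
          by_contra! hc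
          exact hr (abs_le.1 hc)
        have := hev _ h5
        rwa [sq_abs] at this
      rw [deriv_bump_eq_zero (Or.inr h4), deriv_deriv_bump_eq_zero (Or.inr h4)]
      simp
    · refine tendsto_const_nhds.congr' ?_
      filter_upwards [Filter.eventually_gt_atTop (2 * s)] with r hr
      rw [hA]
      simp only
      rw [deriv_bump_eq_zero (Or.inr (hev r hr)), bump_eq_zero (hev r hr).le]
      simp
  have h3 : ∫ r in Ioi (0 : ℝ), r ^ (N - 1) • (r ^ (2 - (N : ℝ)) *
      - (2 * N * (deriv bump (r ^ 2 / s ^ 2) / s ^ 2)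
      + 4 * r ^ 2 * (deriv (deriv bump) (r ^ 2 / s ^ 2) / s ^ 4))) = 0 - A 0 := by
    rw [← h2]
    refine setIntegral_congr_fun measurableSet_Ioi fun r hr => ?_
    have hr0 : (0 : ℝ) < r := hr
    have e : r ^ (N - 1) * r ^ (2 - (N : ℝ)) = r := by
      rw [← Real.rpow_natCast, ← Real.rpow_add hr0, Nat.cast_sub hN1]
      conv_rhs => rw [← Real.rpow_one r]
      congr 1
      push_cast
      ring
    simp only [smul_eq_mul]
    rw [← mul_assoc, e, mul_comm]
  rw [h3, hA]
  simp only [ne_eq, OfNat.ofNat_ne_zero, not_false_eq_true, zero_pow, zero_div, mul_zero, zero_mul,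
    zero_add]
  rw [bump_eq_one (by norm_num)]
  simp only [nsmul_eq_mul, smul_eq_mul]
  ring

/-- Comparison with the integrable function `(1 + ‖z‖) ^ δ`: away from the ball of radius `R`, `1 +
‖z‖` is at most a multiple of `‖z‖`. -/
lemma integrableOn_norm_rpow [MeasurableSpace E] [BorelSpace E] {R δ : ℝ} (hR : 0 < R)
    (hδ : δ < - (Module.finrank ℝ E : ℝ)) :
    IntegrableOn (fun z : E => ‖z‖ ^ δ) (exterior E R) := by
  have h := (integrable_one_add_norm (μ := (volume : Measure E)) (r := -δ) (by linarith)).const_mul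
    ((1 / R + 1) ^ (-δ))
  rw [neg_neg] at h
  refine h.integrableOn.mono' ?_ ?_
  · exact (continuousOn_id.norm.rpow_const fun z hz =>
      Or.inl (hR.trans hz).ne').aestronglyMeasurable (isOpen_exterior R).measurableSet
  · refine (ae_restrict_iff' (isOpen_exterior R).measurableSet).2 (Filter.Eventually.of_forall
      fun z hz => ?_)
    have hz' : R < ‖z‖ := hz
    have hz0 : 0 < ‖z‖ := hR.trans hz'
    rw [Real.norm_of_nonneg (by positivity)]
    have h1 : 1 + ‖z‖ ≤ (1 / R + 1) * ‖z‖ := by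
      have : 1 ≤ 1 / R * ‖z‖ := by
        rw [one_div_mul_eq_div, le_div_iff₀ hR]
        linarith
      linarith
    have hδ0 : δ ≤ 0 := by
      have : (0 : ℝ) ≤ Module.finrank ℝ E := Nat.cast_nonneg _
      linarith
    have h2 := Real.rpow_le_rpow_of_nonpos (by positivity) h1 hδ0
    rw [Real.mul_rpow (by positivity) hz0.le] at h2
    calc ‖z‖ ^ δ = (1 / R + 1) ^ (-δ) * ((1 / R + 1) ^ δ * ‖z‖ ^ δ) := by
          rw [← mul_assoc, ← Real.rpow_add (by positivity), neg_add_cancel, Real.rpow_zero, one_mul]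
      _ ≤ _ := by gcongr

end Cutoff

/-! ### Powers of an asymptotic radius -/

section Power

variable {E : Type*} [NormedAddCommGroup E] [InnerProductSpace ℝ E] [FiniteDimensional ℝ E]
  {R m : ℝ} {b : E → E →L[ℝ] E →L[ℝ] ℝ}

/-- `P` is close to the norm, with an error of order `1 - m`. -/
structure IsRadiusSymbol (R m : ℝ) (P : E → ℝ) : Prop where
  isSymbol : IsSymbol R (1 - m) (fun z => P z - ‖z‖)
  abs_sub_le : ∀ z ∈ exterior E R, |P z - ‖z‖| ≤ ‖z‖ / 2

variable {P : E → ℝ} [Fact (0 < R)]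

/-- Write P = ‖z‖ (1 + e) with `e` of order `-m` and at most `1/2` in absolute value; the difference
is ‖z‖^p ((1 + e)^p - 1). -/
lemma IsRadiusSymbol.isSymbol_rpow_sub (hP : IsRadiusSymbol R m P) (hm : 0 ≤ m) (p : ℝ) :
    IsSymbol R (p - m) (fun z => P z ^ p - ‖z‖ ^ p) := by
  have he : IsSymbol R (-m) (fun z => (P z - ‖z‖) * ‖z‖ ^ (-1 : ℝ)) :=
    (hP.isSymbol.bilin (ContinuousLinearMap.mul ℝ ℝ) (isSymbol_norm_rpow E R (-1))).of_order_eq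
      (by ring)
  have hsmall : ∀ z ∈ exterior E R, |(P z - ‖z‖) * ‖z‖ ^ (-1 : ℝ)| ≤ 1 / 2 := fun z hz => by
    have hz0 := norm_pos_of_mem_exterior hz
    rw [Real.rpow_neg_one, abs_mul, abs_of_pos (inv_pos.2 hz0), ← div_eq_mul_inv, div_le_iff₀ hz0]
    linarith [hP.abs_sub_le z hz]
  have h := (isSymbol_norm_rpow E R p).bilin (ContinuousLinearMap.mul ℝ ℝ)
    (he.one_add_rpow_sub_one (by linarith) hsmall p)
  refine (h.of_order_eq (sub_eq_add_neg p m).symm).congr fun z hz => ?_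
  have hz0 := norm_pos_of_mem_exterior hz
  have h1 := abs_le.1 (hsmall z hz)
  have e : P z = ‖z‖ * (1 + (P z - ‖z‖) * ‖z‖ ^ (-1 : ℝ)) := by
    rw [Real.rpow_neg_one]
    field_simp
    ring
  conv_lhs => rw [e]
  rw [Real.mul_rpow hz0.le (by linarith), ContinuousLinearMap.mul_apply']
  ring

lemma IsRadiusSymbol.isSymbol_rpow (hP : IsRadiusSymbol R m P) (hm : 0 ≤ m) (p : ℝ) :
    IsSymbol R p (fun z => P z ^ p) :=
  (((hP.isSymbol_rpow_sub hm p).of_order_le (by linarith)).add (isSymbol_norm_rpow E R p)).congr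
    fun z _ => (sub_add_cancel _ _).symm

lemma flatLaplacian_sub {f h : E → ℝ} {z : E} (hf : ContDiffAt ℝ 2 f z)
    (hh : ContDiffAt ℝ 2 h z) :
    flatLaplacian (fun y => f y - h y) z = flatLaplacian f z - flatLaplacian h z := by
  have hd : ∀ {h : E → ℝ}, ContDiffAt ℝ 2 h z → ∀ᶠ y in 𝓝 z, HasFDerivAt h (fderiv ℝ h y) y :=
    fun h => (h.eventually (by simp)).mono fun y hy => (hy.differentiableAt (by simp)).hasFDerivAt
  have hD : ∀ {h : E → ℝ}, ContDiffAt ℝ 2 h z →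
      HasFDerivAt (fderiv ℝ h) (fderiv ℝ (fderiv ℝ h) z) z := fun h =>
    ((h.fderiv_right (m := 1) (by norm_cast)).differentiableAt (by simp)).hasFDerivAt
  have h1 : fderiv ℝ (fun y => f y - h y) =ᶠ[𝓝 z] fun y => fderiv ℝ f y - fderiv ℝ h y := by
    filter_upwards [hd hf, hd hh] with y h1 h2 using (h1.sub h2).fderiv
  rw [flatLaplacian, (((hD hf).sub (hD hh)).congr_of_eventuallyEq h1).fderiv,
    ContinuousLinearMap.comp_sub, map_sub, flatLaplacian, flatLaplacian]
  ring

/-- The Laplacian of the power `2 - n` of the radius function. -/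
lemma IsFlatEnd.isSymbol_metricLaplacian_rpow (hb : IsFlatEnd R m b) (hP : IsRadiusSymbol R m P) :
    IsSymbol R (- (Module.finrank ℝ E : ℝ) - m)
      (metricLaplacian b (fun z => P z ^ (2 - (Module.finrank ℝ E : ℝ)))) := by
  set p := 2 - (Module.finrank ℝ E : ℝ) with hp
  have hf := hP.isSymbol_rpow hb.order_nonneg p
  -- The Laplacian of `P ^ p` is split into (Δ_b - Δ₀) P^p, Δ₀ (P^p - ‖z‖^p) and Δ₀ ‖z‖^p. The first
  -- two have order p - 2 - m, and the last vanishes by harmonicity.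
  have h1 := hb.isSymbol_metricLaplacian_sub hf
  have h2 := isSymbol_flatLaplacian (hP.isSymbol_rpow_sub hb.order_nonneg p)
  have h3 := (h1.of_order_eq (show p - 2 - m = - (Module.finrank ℝ E : ℝ) - m by
    rw [hp]; ring)).add (h2.of_order_eq (show p - m - 2 = - (Module.finrank ℝ E : ℝ) - m by
    rw [hp]; ring))
  refine h3.congr fun z hz => ?_
  have hz0 := norm_pos_of_mem_exterior hz
  have c1 : ContDiffAt ℝ 2 (fun z => P z ^ p) z :=
    (hf.contDiffOn.contDiffAt ((isOpen_exterior R).mem_nhds hz)).of_le (by norm_cast)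
  have c2 : ContDiffAt ℝ 2 (fun z : E => ‖z‖ ^ p) z :=
    ((isSymbol_norm_rpow E R p).contDiffOn.contDiffAt ((isOpen_exterior R).mem_nhds hz)).of_le
      (by norm_cast)
  rw [flatLaplacian_sub c1 c2, hp, flatLaplacian_norm_rpow (norm_pos_iff.1 hz0)]
  ring

end Power

/-! ### Volume density at infinity -/

section Density

variable {n : ℕ}

variable (n) in
-- The determinant is Lipschitz on the closed ball of radius `1/2` about the Euclidean metric, where
-- it takes the value `1`, and |√d - 1| ≤ |d - 1| for d ≥ 0.
lemma exists_sqrt_det_gram_bound : ∃ C, 0 ≤ C ∧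
    ∀ B : EuclideanSpace ℝ (Fin n) →L[ℝ] EuclideanSpace ℝ (Fin n) →L[ℝ] ℝ,
      ‖B - flatMetric (EuclideanSpace ℝ (Fin n))‖ ≤ 1 / 2 → 0 ≤ (gram B).det →
        |√(gram B).det - 1| ≤ C * ‖B - flatMetric (EuclideanSpace ℝ (Fin n))‖ := by
  set I := flatMetric (EuclideanSpace ℝ (Fin n)) with hI
  set D : (EuclideanSpace ℝ (Fin n) →L[ℝ] EuclideanSpace ℝ (Fin n) →L[ℝ] ℝ) → ℝ :=
    fun B => (gram B).det with hD
  have hD1 : ContDiff ℝ 1 D := contDiff_det_gram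
  have hone : D I = 1 := by
    have : gram I = 1 := by
      ext i j
      simp [gram, hI, flatMetric_apply, Matrix.one_apply, EuclideanSpace.inner_single_left]
    simp [hD, this]
  obtain ⟨C, hC⟩ := (isCompact_closedBall I (1 / 2)).exists_bound_of_continuousOn
    (hD1.continuous_fderiv (by simp)).continuousOn
  refine ⟨|C|, abs_nonneg C, fun B hB h0 => ?_⟩
  have h1 := (convex_closedBall I (1 / 2)).norm_image_sub_le_of_norm_fderiv_le (𝕜 := ℝ) (f := D)
    (fun y _ => hD1.differentiable (by simp) y) hC (x := I) (y := B) (by simp)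
    (by rwa [mem_closedBall_iff_norm])
  rw [hone] at h1
  have h2 : |√(D B) - 1| ≤ |D B - 1| := by
    have e : D B - 1 = (√(D B) - 1) * (√(D B) + 1) := by
      have := Real.mul_self_sqrt h0
      change √(D B) * √(D B) = D B at this
      linarith
    have h3 := Real.sqrt_nonneg (D B)
    rw [e, abs_mul]
    refine le_mul_of_one_le_right (abs_nonneg _) ?_
    rw [abs_of_nonneg (by linarith)]
    linarith
  exact h2.trans (h1.trans (mul_le_mul_of_nonneg_right (le_abs_self C) (norm_nonneg _)))

lemma IsFlatEnd.exists_volumeDensity_bound {R m : ℝ} [Fact (0 < R)] {b : EuclideanSpace ℝ (Fin n) →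
      EuclideanSpace ℝ (Fin n) →L[ℝ] EuclideanSpace ℝ (Fin n) →L[ℝ] ℝ} (hb : IsFlatEnd R m b) :
    ∃ C, 0 ≤ C ∧ ∀ z ∈ exterior (EuclideanSpace ℝ (Fin n)) R,
      |volumeDensity b z - 1| ≤ C * ‖z‖ ^ (-m) ∧ volumeDensity b z ≤ C := by
  obtain ⟨C, hC0, hC⟩ := exists_sqrt_det_gram_bound n
  obtain ⟨K, hK⟩ := hb.isSymbol.norm_le
  refine ⟨max (C * |K|) (C + 1), by positivity, fun z hz => ?_⟩
  have hz0 := norm_pos_of_mem_exterior hz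
  have h1 := hC (b z) (hb.norm_sub_le z hz) (hb.isMetricOn.det_gram_pos hz).le
  rw [← volumeDensity_eq] at h1
  constructor
  · refine h1.trans ?_
    calc C * ‖b z - flatMetric _‖ ≤ C * (|K| * ‖z‖ ^ (-m)) := by
          gcongr
          exact (hK z hz).trans (mul_le_mul_of_nonneg_right (le_abs_self K) (by positivity))
      _ = C * |K| * ‖z‖ ^ (-m) := by ring
      _ ≤ _ := by gcongr; exact le_max_left _ _
  · have := (le_abs_self _).trans (h1.trans (mul_le_mul_of_nonneg_left (hb.norm_sub_le z hz) hC0))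
    exact le_trans (by linarith) (le_max_right _ _)

end Density

/-! ### The end of an ALE manifold and its covering by an exterior domain -/

section Ends

variable {n : ℕ} {X : Type*} [TopologicalSpace X] [ChartedSpace (EuclideanSpace ℝ (Fin n)) X]
  [IsManifold (𝓡 n) ∞ X] {g : Metric n X}
  {G : Subgroup (EuclideanSpace ℝ (Fin n) ≃ₗᵢ[ℝ] EuclideanSpace ℝ (Fin n))}

namespace AsymptoticCoordinates

variable (c : AsymptoticCoordinates g G)

lemma isParam_lift : IsParam c.lift (exterior (EuclideanSpace ℝ (Fin n)) c.R) :=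
  isParam_of_isLocalDiffeomorphOn (isOpen_exterior c.R) c.isLocalDiffeomorphOn

lemma isParam_lift_exterior {t : ℝ} (ht : c.R ≤ t) :
    IsParam c.lift (exterior (EuclideanSpace ℝ (Fin n)) t) :=
  c.isParam_lift.mono (isOpen_exterior t) (exterior_subset ht)

lemma radius_toQuotient_lift {z : EuclideanSpace ℝ (Fin n)} (hz : c.R < ‖z‖) :
    radius G (c.toQuotient (c.lift z)) = ‖z‖ := by
  rw [c.toQuotient_lift z hz]
  rfl

lemma exists_lift_eq {x : X} (hx : x ∉ c.core) :
    ∃ z, c.R < ‖z‖ ∧ c.lift z = x := by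
  obtain ⟨z, hz⟩ := Quotient.exists_rep (c.toQuotient x)
  have h1 : c.R < radius G (c.toQuotient x) := c.bijOn.mapsTo hx
  have h2 : c.R < ‖z‖ := by
    rw [← hz] at h1
    exact h1
  exact ⟨z, h2, c.bijOn.injOn (c.lift_mem z h2) hx ((c.toQuotient_lift z h2).trans hz)⟩

lemma lift_eq_lift_iff {z w : EuclideanSpace ℝ (Fin n)} (hz : c.R < ‖z‖) (hw : c.R < ‖w‖) :
    c.lift z = c.lift w ↔ ∃ a ∈ G, a z = w := by
  constructor
  · intro h
    have h1 := c.toQuotient_lift z hz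
    rw [h, c.toQuotient_lift w hw] at h1
    exact Quotient.exact h1.symm
  · intro h
    refine c.bijOn.injOn (c.lift_mem z hz) (c.lift_mem w hw) ?_
    rw [c.toQuotient_lift z hz, c.toQuotient_lift w hw]
    exact Quotient.sound h

/-- The part of the manifold inside the radius `t`. -/
def inner (t : ℝ) : Set X := c.core ∪ {x ∈ c.coreᶜ | radius G (c.toQuotient x) ≤ t}

lemma lift_mem_inner {t : ℝ} {z : EuclideanSpace ℝ (Fin n)} (hz : c.R < ‖z‖) :
    c.lift z ∈ c.inner t ↔ ‖z‖ ≤ t := by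
  have h := c.lift_mem z hz
  constructor
  · rintro (h1 | ⟨_, h1⟩)
    · exact absurd h1 h
    · rwa [c.radius_toQuotient_lift hz] at h1
  · intro h1
    exact Or.inr ⟨h, by rwa [c.radius_toQuotient_lift hz]⟩

lemma exists_lift_of_notMem_inner {t : ℝ} {x : X} (hx : x ∉ c.inner t) :
    ∃ z, c.R < ‖z‖ ∧ t < ‖z‖ ∧ c.lift z = x := by
  obtain ⟨z, hz, rfl⟩ := c.exists_lift_eq (fun h => hx (Or.inl h))
  exact ⟨z, hz, not_le.1 fun h => hx ((c.lift_mem_inner hz).2 h), rfl⟩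

lemma isCompact_inner' {t : ℝ} (ht : c.R < t) : IsCompact (c.inner t) := c.isCompact_inner t ht

/-- The fibre is a `G`-orbit, contained in the exterior domain as `G` preserves norms; freeness of
the action makes the orbit map injective. -/
lemma encard_fibre (hG : IsFreeRotationGroup G) [Finite G] {t : ℝ} (ht : c.R ≤ t) {x : X}
    (hx : x ∈ (c.inner t)ᶜ) :
    {z ∈ exterior (EuclideanSpace ℝ (Fin n)) t | c.lift z = x}.encard = Nat.card G := by
  obtain ⟨w, hw, hwt, rfl⟩ := c.exists_lift_of_notMem_inner hx
  have hset : {z ∈ exterior (EuclideanSpace ℝ (Fin n)) t | c.lift z = c.lift w}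
      = (fun a : G => (a : EuclideanSpace ℝ (Fin n) ≃ₗᵢ[ℝ] EuclideanSpace ℝ (Fin n)) w) '' univ := by
    ext z
    constructor
    · rintro ⟨hz, h⟩
      obtain ⟨a, ha, rfl⟩ := (c.lift_eq_lift_iff hw (ht.trans_lt hz)).1 h.symm
      exact ⟨⟨a, ha⟩, mem_univ _, rfl⟩
    · rintro ⟨a, -, rfl⟩
      have hn : ‖(a : EuclideanSpace ℝ (Fin n) ≃ₗᵢ[ℝ] EuclideanSpace ℝ (Fin n)) w‖ = ‖w‖ :=
        LinearIsometryEquiv.norm_map _ _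
      refine ⟨?_, ((c.lift_eq_lift_iff hw ?_).2 ⟨a, a.2, rfl⟩).symm⟩
      · change t < _
        rwa [hn]
      · rwa [hn]
  have hinj : Function.Injective
      (fun a : G => (a : EuclideanSpace ℝ (Fin n) ≃ₗᵢ[ℝ] EuclideanSpace ℝ (Fin n)) w) := by
    intro a a' h
    have hw0 : w ≠ 0 := norm_pos_iff.1 (c.R_pos.trans hw)
    have h1 := hG.free (a'⁻¹ * a) (G.mul_mem (G.inv_mem a'.2) a.2) w hw0 (by
      change (a' : EuclideanSpace ℝ (Fin n) ≃ₗᵢ[ℝ] EuclideanSpace ℝ (Fin n)).symm _ = w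
      rw [LinearIsometryEquiv.symm_apply_eq]
      exact h)
    exact Subtype.ext (inv_mul_eq_one.1 h1).symm
  rw [hset, hinj.encard_image, encard_univ, ENat.card_eq_coe_natCard]

lemma exists_injOn_nhds {z : EuclideanSpace ℝ (Fin n)} (hz : c.R < ‖z‖) :
    ∃ V ∈ 𝓝 z, InjOn c.lift V := by
  obtain ⟨Φ, hΦ, h⟩ := c.isLocalDiffeomorphOn ⟨z, hz⟩
  exact ⟨Φ.source, Φ.open_source.mem_nhds hΦ, Φ.toPartialEquiv.injOn.congr h.symm⟩

section Measure

variable [MeasurableSpace X] [BorelSpace X] [T2Space X] [SecondCountableTopology X] [Nonempty X]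
  [Finite G] {t δ : ℝ}

lemma measurableSet_inner (ht : c.R < t) : MeasurableSet (c.inner t) :=
  (c.isCompact_inner' ht).isClosed.measurableSet

lemma paramVolume_lift (hG : IsFreeRotationGroup G) (ht : c.R < t) :
    paramVolume g c.lift (exterior (EuclideanSpace ℝ (Fin n)) t)
      = Nat.card G • (riemannianVolume g).restrict (c.inner t)ᶜ :=
  paramVolume_eq_smul (c.isParam_lift_exterior ht.le)
    (fun _ hz => c.exists_injOn_nhds (ht.trans hz)) (c.measurableSet_inner ht).compl
    (fun _ hz h => absurd ((c.lift_mem_inner (ht.trans hz)).1 h) (not_le.2 hz))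
    (fun _ hx => c.encard_fibre hG ht.le hx)

/-- On the compact inner part continuity suffices; on the end the volume is a fixed multiple of the
push-forward from the covering. -/
lemma integrable_of_end (hG : IsFreeRotationGroup G) (ht : c.R < t) {F : X → ℝ}
    (hF : Continuous F) (h : IntegrableOn (fun z => volumeDensity (pullbackMetric g c.lift) z
      * F (c.lift z)) (exterior (EuclideanSpace ℝ (Fin n)) t)) :
    Integrable F (riemannianVolume g) := by
  rw [← integrableOn_univ, ← union_compl_self (c.inner t)]
  refine (hF.continuousOn.integrableOn_compact (c.isCompact_inner' ht)).union ?_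
  have h1 := (integrable_paramVolume_iff (c.isParam_lift_exterior ht.le)
    hF.aestronglyMeasurable).2 h
  rw [c.paramVolume_lift hG ht, ← Nat.cast_smul_eq_nsmul ENNReal] at h1
  have hN : (Nat.card G : ENNReal) ≠ 0 := by
    exact_mod_cast Nat.card_pos.ne'
  exact (integrable_smul_measure hN (ENNReal.natCast_ne_top _)).1 h1

lemma integral_eq_of_end (hG : IsFreeRotationGroup G) (ht : c.R < t) {F : X → ℝ}
    (hF : Continuous F) (h0 : ∀ x ∈ c.inner t, F x = 0) :
    ∫ x, F x ∂(riemannianVolume g) = (Nat.card G : ℝ)⁻¹ *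
      ∫ z in exterior (EuclideanSpace ℝ (Fin n)) t,
        volumeDensity (pullbackMetric g c.lift) z * F (c.lift z) := by
  have h1 := integral_paramVolume (g := g) (c.isParam_lift_exterior ht.le) (F := F)
    hF.aestronglyMeasurable
  have hN : (Nat.card G : ℝ) ≠ 0 := by
    exact_mod_cast Nat.card_pos.ne'
  rw [← h1, c.paramVolume_lift hG ht, ← Nat.cast_smul_eq_nsmul ENNReal, integral_smul_measure,
    setIntegral_eq_integral_of_forall_compl_eq_zero fun x hx => h0 x (notMem_compl_iff.1 hx)]
  simp only [ENNReal.toReal_natCast, smul_eq_mul]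
  rw [inv_mul_cancel_left₀ hN]

end Measure

/-- The metric and the radius function are close to the Euclidean ones outside radius `t`. -/
structure IsAdapted (ρ : X → ℝ) (t : ℝ) : Prop where
  lt : c.R < t
  isFlatEnd : IsFlatEnd t n (pullbackMetric g c.lift)
  isRadiusSymbol : IsRadiusSymbol t n (ρ ∘ c.lift)

variable {c}

/-- The decay is assumed component by component, so the tensor is rebuilt as the finite sum of its
components times the products `L i j` of coordinate covectors. -/
lemma isSymbol_metric_sub (c : AsymptoticCoordinates g G) [Fact (0 < c.R)] :
    IsSymbol c.R (-n)
      (fun z => pullbackMetric g c.lift z - flatMetric (EuclideanSpace ℝ (Fin n))) := by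
  have hb := isMetricOn_pullbackMetric g c.isParam_lift
  let L : Fin n → Fin n → (ℝ →L[ℝ] EuclideanSpace ℝ (Fin n) →L[ℝ] EuclideanSpace ℝ (Fin n) →L[ℝ] ℝ) :=
    fun i j => (ContinuousLinearMap.id ℝ ℝ).smulRight
      ((EuclideanSpace.proj i : EuclideanSpace ℝ (Fin n) →L[ℝ] ℝ).smulRight
        (EuclideanSpace.proj j : EuclideanSpace ℝ (Fin n) →L[ℝ] ℝ))
  have h1 : ∀ i j, IsSymbol c.R (-n) (fun z => L i j
      (pullbackMetric g c.lift z (EuclideanSpace.single i 1) (EuclideanSpace.single j 1)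
        - if i = j then 1 else 0)) := by
    intro i j
    refine IsSymbol.clm (L i j) fun N => ⟨?_, fun k _ => ?_⟩
    · exact ((hb.contDiffOn.clm_apply contDiffOn_const).clm_apply contDiffOn_const).sub
        contDiffOn_const
    · obtain ⟨K, -, hK⟩ := c.metric_decay k i j
      exact ⟨K, hK⟩
  have h2 : ∀ (s : Finset (Fin n × Fin n)), IsSymbol c.R (-n) (fun z => ∑ p ∈ s, L p.1 p.2
      (pullbackMetric g c.lift z (EuclideanSpace.single p.1 1) (EuclideanSpace.single p.2 1)
        - if p.1 = p.2 then 1 else 0)) := by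
    intro s
    induction s using Finset.induction_on with
    | empty =>
      refine fun N => ⟨contDiffOn_const, fun k _ => ⟨0, fun z _ => ?_⟩⟩
      simp only [Finset.sum_empty, zero_mul, norm_le_zero_iff]
      rw [show (fun _ : EuclideanSpace ℝ (Fin n) =>
        (0 : EuclideanSpace ℝ (Fin n) →L[ℝ] EuclideanSpace ℝ (Fin n) →L[ℝ] ℝ)) = 0 from rfl]
      simp
    | insert p s hp ih =>
      simp only [Finset.sum_insert hp]
      exact (h1 p.1 p.2).add ih
  refine (h2 Finset.univ).congr fun z _ => ?_
  ext v w
  rw [bilin_expand]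
  simp only [sum_apply, Finset.univ_product_univ.symm, Finset.sum_product]
  refine Finset.sum_congr rfl fun i _ => Finset.sum_congr rfl fun j _ => ?_
  simp only [gram, Matrix.of_apply, sub_apply, flatMetric_apply, L,
    ContinuousLinearMap.smulRight_apply, smul_apply, ContinuousLinearMap.id_apply, smul_eq_mul,
    EuclideanSpace.inner_single_left, PiLp.proj_apply]
  simp
  ring

/-- As `n > 0`, the errors of relative size r^{-n} become smaller than `1/2` once the inner radius
is large enough. -/
lemma exists_isAdapted (hn : 0 < n) {ρ : X → ℝ} (hρ : c.IsRadiusFunction ρ) :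
    ∃ t, c.IsAdapted ρ t := by
  have : Fact (0 < c.R) := ⟨c.R_pos⟩
  have hs := c.isSymbol_metric_sub
  obtain ⟨K, hK⟩ := hs.norm_le
  have hr : IsSymbol c.R (1 - n) (fun z => (ρ ∘ c.lift) z - ‖z‖) := by
    refine fun N => ⟨?_, fun k _ => ?_⟩
    · exact (c.isParam_lift.contDiffOn_comp (k := ⊤) hρ.contMDiff).sub
        (isSymbol_norm _ c.R).contDiffOn
    · obtain ⟨K, -, hK⟩ := hρ.decay k
      exact ⟨K, hK⟩
  obtain ⟨L, hL⟩ := hr.norm_le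
  have hlim := tendsto_rpow_neg_atTop (y := (n : ℝ)) (by exact_mod_cast hn)
  have hK2 : ∀ᶠ t : ℝ in Filter.atTop, |K| * t ^ (-n : ℝ) < 1 / 2 :=
    (hlim.const_mul |K|).eventually (gt_mem_nhds (by simp))
  have hL2 : ∀ᶠ t : ℝ in Filter.atTop, |L| * t ^ (-n : ℝ) < 1 / 2 :=
    (hlim.const_mul |L|).eventually (gt_mem_nhds (by simp))
  obtain ⟨t, h1, h2, ht⟩ := (hK2.and (hL2.and (Filter.eventually_gt_atTop c.R))).exists
  have ht0 : 0 < t := c.R_pos.trans ht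
  have hmono : ∀ z ∈ exterior (EuclideanSpace ℝ (Fin n)) t, ‖z‖ ^ (-n : ℝ) ≤ t ^ (-n : ℝ) :=
    fun z hz => Real.rpow_le_rpow_of_nonpos ht0 (le_of_lt hz) (by simp)
  have hsub := exterior_subset (E := EuclideanSpace ℝ (Fin n)) ht.le
  refine ⟨t, ht, ⟨hs.mono_radius ht.le, Nat.cast_nonneg n, fun z _ v w => g.symm _ _ _,
    fun z hz => ?_⟩, ⟨hr.mono_radius ht.le, fun z hz => ?_⟩⟩
  · refine (hK z (hsub hz)).trans ((mul_le_mul (le_abs_self K) (hmono z hz) (by positivity)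
      (abs_nonneg K)).trans h1.le)
  · have hz0 : 0 < ‖z‖ := ht0.trans hz
    have h3 := hL z (hsub hz)
    rw [show (1 : ℝ) - n = -n + 1 by ring, Real.rpow_add_one hz0.ne', ← mul_assoc] at h3
    have h4 : L * ‖z‖ ^ (-n : ℝ) ≤ 1 / 2 :=
      (mul_le_mul (le_abs_self L) (hmono z hz) (by positivity) (abs_nonneg L)).trans h2.le
    refine h3.trans ((mul_le_mul_of_nonneg_right h4 hz0.le).trans ?_)
    linarith

/-! ### Cutoff functions -/

open Classical in
variable (c) in
/-- The cutoff function of radius `s` on the manifold. -/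
def cutoff (s : ℝ) (x : X) : ℝ :=
  if x ∈ c.core then 1 else bump (radius G (c.toQuotient x) ^ 2 / s ^ 2)

lemma cutoff_lift (s : ℝ) {z : EuclideanSpace ℝ (Fin n)} (hz : c.R < ‖z‖) :
    c.cutoff s (c.lift z) = ALE.cutoff s z := by
  rw [cutoff, if_neg (c.lift_mem z hz), c.radius_toQuotient_lift hz]
  rfl

lemma cutoff_nonneg (s : ℝ) (x : X) : 0 ≤ c.cutoff s x := by
  rw [cutoff]
  split_ifs
  exacts [zero_le_one, bump_nonneg _]

lemma cutoff_le_one (s : ℝ) (x : X) : c.cutoff s x ≤ 1 := by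
  rw [cutoff]
  split_ifs
  exacts [le_rfl, bump_le_one _]

lemma cutoff_eq_one {s : ℝ} {x : X} (hx : x ∈ c.inner s) : c.cutoff s x = 1 := by
  by_cases h : x ∈ c.core
  · rw [cutoff, if_pos h]
  · obtain ⟨z, hz, rfl⟩ := c.exists_lift_eq h
    rw [c.lift_mem_inner hz] at hx
    rw [c.cutoff_lift s hz]
    have hs : 0 < s := (c.R_pos.trans hz).trans_le hx
    refine bump_eq_one ?_
    rw [div_le_one (by positivity)]
    exact pow_le_pow_left₀ (norm_nonneg z) hx 2

lemma cutoff_eq_zero {s : ℝ} (hs : 0 < s) {x : X} (hx : x ∉ c.inner (2 * s)) :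
    c.cutoff s x = 0 := by
  obtain ⟨z, hz, hzs, rfl⟩ := c.exists_lift_of_notMem_inner hx
  rw [c.cutoff_lift s hz]
  refine bump_eq_zero ?_
  rw [le_div_iff₀ (by positivity)]
  nlinarith

variable {ρ : X → ℝ} {t s : ℝ} [T2Space X]

lemma hasCompactSupport_cutoff (hs : 0 < s) (hRs : c.R < 2 * s) :
    HasCompactSupport (c.cutoff s) :=
  HasCompactSupport.intro (c.isCompact_inner' hRs) fun _ hx => cutoff_eq_zero hs hx

/-- Near a point of the end the cutoff is the Euclidean one composed with a local inverse of `lift`.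
-/
lemma contMDiffAt_cutoff_lift (s : ℝ) {z : EuclideanSpace ℝ (Fin n)} (hz : c.R < ‖z‖) :
    ContMDiffAt (𝓡 n) 𝓘(ℝ, ℝ) ∞ (c.cutoff s) (c.lift z) := by
  have hd := c.isLocalDiffeomorphOn ⟨z, hz⟩
  have h1 : ContMDiffAt (𝓡 n) (𝓡 n) ∞ hd.localInverse (c.lift z) := hd.localInverse_contMDiffAt
  have h2 : hd.localInverse (c.lift z) = z := hd.localInverse_left_inv hd.localInverse_mem_target
  have h3 : ContMDiffAt (𝓡 n) 𝓘(ℝ, ℝ) ∞ (ALE.cutoff s ∘ hd.localInverse) (c.lift z) :=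
    (contDiff_cutoff s (m := ⊤)).contMDiff.contMDiffAt.comp _ h1
  refine h3.congr_of_eventuallyEq ?_
  have h4 : ∀ᶠ x in 𝓝 (c.lift z), c.R < ‖hd.localInverse x‖ := by
    refine h1.continuousAt.eventually ((isOpen_exterior c.R).mem_nhds ?_)
    rw [h2]
    exact hz
  filter_upwards [h4, hd.localInverse_eventuallyEq_right] with x hx hx'
  have h5 : c.lift (hd.localInverse x) = x := hx'
  rw [Function.comp_apply, ← c.cutoff_lift s hx, h5]

/-- The radius function tends to infinity only at the end. -/
lemma IsAdapted.inner_mem_nhds (h : c.IsAdapted ρ t) (hρ : Continuous ρ) {x : X} (hx : x ∈ c.inner t)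
    (hts : t < s) : c.inner s ∈ 𝓝 x := by
  -- Points of the end close to `x` have ρ < ρ(x) + 1, hence ‖z‖ ≤ T because ‖z‖/2 ≤ ρ. Those with
  -- ‖z‖ ≥ s then lie in the image of the compact set `A`, which is closed and misses `x`.
  set T := 2 * (ρ x + 1) with hT
  set A : Set (EuclideanSpace ℝ (Fin n)) := {z | s ≤ ‖z‖} ∩ Metric.closedBall 0 T with hA
  have hsub : ∀ z ∈ A, t < ‖z‖ := fun z hz => hts.trans_le hz.1
  have hAc : IsCompact (c.lift '' A) := by
    refine IsCompact.image_of_continuousOn ?_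
      ((c.isParam_lift_exterior h.lt.le).contMDiffOn.continuousOn.mono hsub)
    exact (isCompact_closedBall 0 T).inter_left (isClosed_le continuous_const continuous_norm)
  have hxA : x ∈ (c.lift '' A)ᶜ := by
    rintro ⟨z, hz, rfl⟩
    exact absurd ((c.lift_mem_inner (h.lt.trans (hsub z hz))).1 hx) (not_le.2 (hsub z hz))
  filter_upwards [hAc.isClosed.isOpen_compl.mem_nhds hxA,
    (isOpen_lt hρ continuous_const).mem_nhds (show ρ x < ρ x + 1 by linarith)] with y hy hy'
  by_contra hys
  obtain ⟨z, hz, hzs, rfl⟩ := c.exists_lift_of_notMem_inner hys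
  refine hy ⟨z, ⟨le_of_lt hzs, ?_⟩, rfl⟩
  rw [mem_closedBall_zero_iff, hT]
  have h1 := abs_le.1 (h.isRadiusSymbol.abs_sub_le z (hts.trans hzs))
  have h2 : ρ (c.lift z) < ρ x + 1 := hy'
  have h3 : (ρ ∘ c.lift) z = ρ (c.lift z) := rfl
  linarith

lemma IsAdapted.cutoff_eventuallyEq_one (h : c.IsAdapted ρ t) (hρ : Continuous ρ) {x : X}
    (hx : x ∈ c.inner t) (hts : t < s) : c.cutoff s =ᶠ[𝓝 x] fun _ => 1 := by
  filter_upwards [h.inner_mem_nhds hρ hx hts] with y hy using cutoff_eq_one hy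

lemma IsAdapted.contMDiff_cutoff (h : c.IsAdapted ρ t) (hρ : Continuous ρ) (hts : t < s) :
    ContMDiff (𝓡 n) 𝓘(ℝ, ℝ) ∞ (c.cutoff s) := by
  intro x
  by_cases hx : x ∈ c.inner t
  · exact contMDiffAt_const.congr_of_eventuallyEq (h.cutoff_eventuallyEq_one hρ hx hts)
  · obtain ⟨z, hz, -, rfl⟩ := c.exists_lift_of_notMem_inner hx
    exact contMDiffAt_cutoff_lift s hz

end AsymptoticCoordinates

end Ends

/-! ### Uniform estimates for the Laplacian of cutoff functions -/

section CutoffLaplacian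

variable {E : Type*} [NormedAddCommGroup E] [InnerProductSpace ℝ E] [FiniteDimensional ℝ E]
  {R m : ℝ} {b : E → E →L[ℝ] E →L[ℝ] ℝ}

lemma abs_flatLaplacian_le (f : E → ℝ) (z : E) : |flatLaplacian f z|
    ≤ ‖traceL E‖ * (‖(flatMetric E).inverse‖ * ‖fderiv ℝ (fderiv ℝ f) z‖) := by
  rw [flatLaplacian, abs_neg]
  exact norm_traceL_comp_le _ _

/-- The constant does not depend on `s`. The third bound keeps the additional decay `‖z‖ ^ (-m)`,
without which the fluxes for the two metrics could not be compared. -/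
lemma IsFlatEnd.exists_cutoff_bound [Fact (0 < R)] (hb : IsFlatEnd R m b) : ∃ C, 0 ≤ C ∧
    ∀ s : ℝ, 0 < s → ∀ z ∈ exterior E R,
      ‖fderiv ℝ (ALE.cutoff s) z‖ ≤ C * ‖z‖⁻¹ ∧
      |metricLaplacian b (ALE.cutoff s) z| ≤ C * (‖z‖ ^ 2)⁻¹ ∧
      |metricLaplacian b (ALE.cutoff s) z - flatLaplacian (ALE.cutoff s) z|
        ≤ C * ‖z‖ ^ (-m) * (‖z‖ ^ 2)⁻¹ := by
  obtain ⟨K, hK0, hK⟩ := ALE.exists_cutoff_bound E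
  obtain ⟨L, hL0, hL⟩ := hb.abs_metricLaplacian_sub_le
  set M := ‖traceL E‖ * ‖(flatMetric E).inverse‖ with hM
  have hR : 0 < R := Fact.out
  refine ⟨K + L * (2 * K) + (L * (2 * K) * R ^ (-m) + M * K), by positivity, fun s hs z hz => ?_⟩
  have hz0 := norm_pos_of_mem_exterior hz
  obtain ⟨h1, h2⟩ := hK s hs z (norm_pos_iff.1 hz0)
  have h3 : |metricLaplacian b (ALE.cutoff s) z - flatLaplacian (ALE.cutoff s) z|
      ≤ L * (2 * K) * ‖z‖ ^ (-m) * (‖z‖ ^ 2)⁻¹ := by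
    refine (hL (ALE.cutoff s) z hz).trans ?_
    calc L * ‖z‖ ^ (-m) * (‖fderiv ℝ (fderiv ℝ (ALE.cutoff s)) z‖
          + ‖fderiv ℝ (ALE.cutoff s) z‖ * ‖z‖⁻¹)
        ≤ L * ‖z‖ ^ (-m) * (K * (‖z‖ ^ 2)⁻¹ + K * ‖z‖⁻¹ * ‖z‖⁻¹) := by gcongr
      _ = L * (2 * K) * ‖z‖ ^ (-m) * (‖z‖ ^ 2)⁻¹ := by field_simp; ring
  have h4 : ‖z‖ ^ (-m) ≤ R ^ (-m) :=
    Real.rpow_le_rpow_of_nonpos hR (le_of_lt hz) (by linarith [hb.order_nonneg])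
  have h5 : |flatLaplacian (ALE.cutoff s) z| ≤ M * K * (‖z‖ ^ 2)⁻¹ := by
    refine (abs_flatLaplacian_le _ z).trans ?_
    rw [← mul_assoc, ← hM, mul_assoc M]
    exact mul_le_mul_of_nonneg_left h2 (by positivity)
  have hp : 0 ≤ L * (2 * K) * R ^ (-m) + M * K := by positivity
  have hp' : 0 ≤ L * (2 * K) := by positivity
  refine ⟨h1.trans ?_, ?_, h3.trans ?_⟩
  · gcongr
    linarith
  · have h6 : |metricLaplacian b (ALE.cutoff s) z|
        ≤ |metricLaplacian b (ALE.cutoff s) z - flatLaplacian (ALE.cutoff s) z|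
          + |flatLaplacian (ALE.cutoff s) z| := by
      have := abs_add_le (metricLaplacian b (ALE.cutoff s) z - flatLaplacian (ALE.cutoff s) z)
        (flatLaplacian (ALE.cutoff s) z)
      rwa [sub_add_cancel] at this
    refine h6.trans ((add_le_add h3 h5).trans ?_)
    have hp2 : 0 ≤ K + L * (2 * K) := by positivity
    calc L * (2 * K) * ‖z‖ ^ (-m) * (‖z‖ ^ 2)⁻¹ + M * K * (‖z‖ ^ 2)⁻¹
        ≤ L * (2 * K) * R ^ (-m) * (‖z‖ ^ 2)⁻¹ + M * K * (‖z‖ ^ 2)⁻¹ := by gcongr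
      _ = (L * (2 * K) * R ^ (-m) + M * K) * (‖z‖ ^ 2)⁻¹ := by ring
      _ ≤ _ := mul_le_mul_of_nonneg_right (by linarith) (by positivity)
  · gcongr
    linarith

lemma metricLaplacian_cutoff_eq_zero (b : E → E →L[ℝ] E →L[ℝ] ℝ) {s : ℝ} {z : E} (hz : ‖z‖ < s) :
    metricLaplacian b (ALE.cutoff s) z = 0 := by
  rw [metricLaplacian_congr b (cutoff_eventuallyEq_one hz), metricLaplacian_const]

lemma flatLaplacian_cutoff_eq_zero {s : ℝ} {z : E} (hz : ‖z‖ < s) :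
    flatLaplacian (ALE.cutoff s) z = 0 := by
  rw [flatLaplacian, (cutoff_eventuallyEq_one hz).fderiv.fderiv_eq]
  simp

lemma fderiv_cutoff_eq_zero {s : ℝ} {z : E} (hz : ‖z‖ < s) :
    fderiv ℝ (ALE.cutoff s) z = 0 := by
  rw [(cutoff_eventuallyEq_one hz).fderiv_eq]
  simp

/-- Integrals of functions that are uniformly integrable and supported near infinity. -/
lemma tendsto_setIntegral_exterior [MeasurableSpace E] [BorelSpace E] (hR : 0 < R) {C δ : ℝ}
    (hδ : δ < - (Module.finrank ℝ E : ℝ)) {f : ℕ → E → ℝ}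
    (hf : ∀ᶠ k in Filter.atTop, ContinuousOn (f k) (exterior E R))
    (hle : ∀ᶠ k in Filter.atTop, ∀ z ∈ exterior E R, |f k z| ≤ C * ‖z‖ ^ δ)
    (h0 : ∀ᶠ k : ℕ in Filter.atTop, ∀ z ∈ exterior E R, ‖z‖ < k → f k z = 0) :
    Filter.Tendsto (fun k => ∫ z in exterior E R, f k z) Filter.atTop (𝓝 0) := by
  have hm := (isOpen_exterior (E := E) R).measurableSet
  rw [← integral_zero E ℝ (μ := volume.restrict (exterior E R))]
  refine tendsto_integral_filter_of_dominated_convergence (fun z => C * ‖z‖ ^ δ) ?_ ?_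
    ((integrableOn_norm_rpow hR hδ).const_mul C) ?_
  · exact hf.mono fun k hk => hk.aestronglyMeasurable hm
  · exact hle.mono fun k hk => (ae_restrict_iff' hm).2 (Filter.Eventually.of_forall hk)
  · refine (ae_restrict_iff' hm).2 (Filter.Eventually.of_forall fun z hz => ?_)
    refine tendsto_const_nhds.congr' ?_
    filter_upwards [h0, (tendsto_natCast_atTop_atTop (R := ℝ)).eventually_gt_atTop ‖z‖] with k hk hk'
    exact (hk z hz hk').symm

end CutoffLaplacian

lemma rpow_le_of_comparable {x y : ℝ} (hy : 0 < y) (h1 : y / 2 ≤ x) (h2 : x ≤ 2 * y) (p : ℝ) :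
    x ^ p ≤ 2 ^ |p| * y ^ p := by
  rcases le_total 0 p with hp | hp
  · rw [abs_of_nonneg hp, ← Real.mul_rpow (by norm_num) hy.le]
    exact Real.rpow_le_rpow (by linarith) h2 hp
  · have h := Real.rpow_le_rpow_of_nonpos (by linarith) h1 hp
    rw [Real.div_rpow hy.le (by norm_num)] at h
    rw [abs_of_nonpos hp, Real.rpow_neg (by norm_num)]
    rwa [div_eq_inv_mul] at h

/-! ### Weighted estimates in the end, and the symmetry of the Laplacian -/

section Analysis

variable {n : ℕ} {X : Type*} [TopologicalSpace X] [ChartedSpace (EuclideanSpace ℝ (Fin n)) X]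
  [IsManifold (𝓡 n) ∞ X] {g : Metric n X}
  {G : Subgroup (EuclideanSpace ℝ (Fin n) ≃ₗᵢ[ℝ] EuclideanSpace ℝ (Fin n))}
  {c : AsymptoticCoordinates g G} {ρ : X → ℝ} {t : ℝ}

namespace AsymptoticCoordinates.IsAdapted

lemma pos (h : c.IsAdapted ρ t) : 0 < t := c.R_pos.trans h.lt

lemma isParam (h : c.IsAdapted ρ t) : IsParam c.lift (exterior (EuclideanSpace ℝ (Fin n)) t) :=
  c.isParam_lift_exterior h.lt.le

lemma half_norm_le (h : c.IsAdapted ρ t) {z : EuclideanSpace ℝ (Fin n)} (hz : t < ‖z‖) :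
    ‖z‖ / 2 ≤ ρ (c.lift z) := by
  have h1 : |ρ (c.lift z) - ‖z‖| ≤ ‖z‖ / 2 := h.isRadiusSymbol.abs_sub_le z hz
  linarith [(abs_le.1 h1).1]

lemma le_two_norm (h : c.IsAdapted ρ t) {z : EuclideanSpace ℝ (Fin n)} (hz : t < ‖z‖) :
    ρ (c.lift z) ≤ 2 * ‖z‖ := by
  have h1 : |ρ (c.lift z) - ‖z‖| ≤ ‖z‖ / 2 := h.isRadiusSymbol.abs_sub_le z hz
  linarith [(abs_le.1 h1).2, norm_nonneg z]

lemma rpow_le (h : c.IsAdapted ρ t) {z : EuclideanSpace ℝ (Fin n)} (hz : t < ‖z‖) (p : ℝ) :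
    ρ (c.lift z) ^ p ≤ 2 ^ |p| * ‖z‖ ^ p :=
  rpow_le_of_comparable (h.pos.trans hz) (h.half_norm_le hz) (h.le_two_norm hz) p

lemma norm_rpow_le (h : c.IsAdapted ρ t) {z : EuclideanSpace ℝ (Fin n)} (hz : t < ‖z‖) (p : ℝ) :
    ‖z‖ ^ p ≤ 2 ^ |p| * ρ (c.lift z) ^ p := by
  have := h.half_norm_le hz
  have := h.le_two_norm hz
  have := h.pos.trans hz
  exact rpow_le_of_comparable (by linarith) (by linarith) (by linarith) p

lemma exists_iterCovDeriv_bound (h : c.IsAdapted ρ t) {f : X → ℝ} {k : ℕ} {β : ℝ}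
    (hf : f ∈ weightedC g ρ k β) {j : ℕ} (hj : j ≤ k) : ∃ C, 0 ≤ C ∧
      ∀ z, t < ‖z‖ → ∀ v : Fin j → EuclideanSpace ℝ (Fin n),
        |iterCovDeriv (pullbackMetric g c.lift) (f ∘ c.lift) j z v|
          ≤ C * ‖z‖ ^ (β - j) * ∏ i, ‖v i‖ := by
  obtain ⟨C, hC⟩ := hf.2 j hj
  -- One power of `2` compares `ρ` with the norm, the other compares the lengths of the `j` vectors
  -- in the two metrics.
  refine ⟨|C| * 2 ^ |β - j| * 2 ^ j, by positivity, fun z hz v => ?_⟩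
  have hfj : ContMDiff (𝓡 n) 𝓘(ℝ, ℝ) j f := hf.1.of_le (by exact_mod_cast hj)
  have h1 := hC (c.lift z) (fun i => mfderiv (𝓡 n) (𝓡 n) c.lift z (v i))
  rw [nablaIter_eq g h.isParam hfj hz, ← iterCovDeriv_eq (isMetricOn_pullbackMetric g h.isParam)
    (h.isParam.contDiffOn_comp (k := j) hfj) hz] at h1
  have h2 : ∏ i, √(g.inner (c.lift z) (mfderiv (𝓡 n) (𝓡 n) c.lift z (v i))
      (mfderiv (𝓡 n) (𝓡 n) c.lift z (v i))) ≤ ∏ i, (2 * ‖v i‖) :=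
    Finset.prod_le_prod (fun i _ => Real.sqrt_nonneg _) fun i _ => h.isFlatEnd.sqrt_le hz (v i)
  rw [Finset.prod_mul_distrib, Finset.prod_const, Finset.card_univ, Fintype.card_fin] at h2
  have hρ0 : 0 ≤ ρ (c.lift z) := by linarith [h.half_norm_le hz, norm_nonneg z]
  calc _ ≤ _ := h1
    _ ≤ |C| * (2 ^ |β - j| * ‖z‖ ^ (β - j)) * (2 ^ j * ∏ i, ‖v i‖) := by
      refine mul_le_mul ?_ h2 (Finset.prod_nonneg fun i _ => Real.sqrt_nonneg _) (by positivity)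
      exact mul_le_mul (le_abs_self C) (h.rpow_le hz _) (Real.rpow_nonneg hρ0 _) (abs_nonneg C)
    _ = _ := by ring

/-- The weighted bounds on a function in asymptotic coordinates. -/
lemma exists_bound (h : c.IsAdapted ρ t) {f : X → ℝ} {β : ℝ} (hf : f ∈ weightedC g ρ 2 β) :
    ∃ C, 0 ≤ C ∧ ∀ z, t < ‖z‖ → |f (c.lift z)| ≤ C * ‖z‖ ^ β ∧
      ‖fderiv ℝ (f ∘ c.lift) z‖ ≤ C * ‖z‖ ^ (β - 1) ∧
      |laplacian g f (c.lift z)| ≤ C * ‖z‖ ^ (β - 2) := by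
  obtain ⟨C₀, h0, hC₀⟩ := h.exists_iterCovDeriv_bound hf (Nat.zero_le 2)
  obtain ⟨C₁, h1, hC₁⟩ := h.exists_iterCovDeriv_bound hf one_le_two
  obtain ⟨C₂, h2, hC₂⟩ := h.exists_iterCovDeriv_bound hf le_rfl
  have : Fact (0 < t) := ⟨h.pos⟩
  set T := ‖traceL (EuclideanSpace ℝ (Fin n))‖
  refine ⟨C₀ + C₁ + 2 * T * C₂, by positivity, fun z hz => ?_⟩
  have hz0 : 0 < ‖z‖ := h.pos.trans hz
  have hT : 0 ≤ 2 * T * C₂ := by positivity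
  refine ⟨?_, ?_, ?_⟩
  · have := hC₀ z hz ![]
    simp only [iterCovDeriv, Function.comp_apply, Nat.cast_zero, sub_zero, Finset.univ_eq_empty,
      Finset.prod_empty, mul_one] at this
    refine this.trans ?_
    gcongr
    linarith
  · refine ContinuousLinearMap.opNorm_le_bound _ (by positivity) fun v => ?_
    have := hC₁ z hz ![v]
    rw [iterCovDeriv_one] at this
    simp only [Matrix.cons_val_fin_one, Finset.univ_unique, Finset.prod_const, Finset.card_singleton,
      pow_one, Nat.cast_one] at this
    refine this.trans ?_
    gcongr
    linarith
  · have hc : ContMDiff (𝓡 n) 𝓘(ℝ, ℝ) 2 f := hf.1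
    have hd : ContDiffAt ℝ 2 (f ∘ c.lift) z :=
      (h.isParam.contDiffOn_comp (k := 2) hc).contDiffAt (h.isParam.isOpen.mem_nhds hz)
    have hH : ‖hessian (pullbackMetric g c.lift) (f ∘ c.lift) z‖ ≤ C₂ * ‖z‖ ^ (β - 2) := by
      refine ContinuousLinearMap.opNorm_le_bound₂ _ (by positivity) fun v w => ?_
      have := hC₂ z hz ![v, w]
      rw [iterCovDeriv_two _ hd] at this
      simpa [Fin.prod_univ_two, mul_assoc] using this
    rw [laplacian_eq g h.isParam hc hz]
    refine (h.isFlatEnd.abs_metricLaplacian_le hz _).trans ?_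
    calc 2 * T * ‖hessian (pullbackMetric g c.lift) (f ∘ c.lift) z‖
        ≤ 2 * T * (C₂ * ‖z‖ ^ (β - 2)) := by gcongr
      _ = 2 * T * C₂ * ‖z‖ ^ (β - 2) := by ring
      _ ≤ _ := by
        gcongr
        linarith

variable [MeasurableSpace X] [BorelSpace X] [T2Space X] [SecondCountableTopology X] [Nonempty X]
  [Finite G]

lemma continuousOn_density_mul (h : c.IsAdapted ρ t) {F : X → ℝ} (hF : Continuous F) :
    ContinuousOn (fun z => volumeDensity (pullbackMetric g c.lift) z * F (c.lift z))
      (exterior (EuclideanSpace ℝ (Fin n)) t) :=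
  h.isFlatEnd.isMetricOn.contDiffOn_volumeDensity.continuousOn.mul
    (hF.comp_continuousOn h.isParam.contMDiffOn.continuousOn)

lemma integrable_of_le (h : c.IsAdapted ρ t) (hG : IsFreeRotationGroup G) {F : X → ℝ}
    (hF : Continuous F) {C δ : ℝ} (hδ : δ < -n)
    (hle : ∀ z, t < ‖z‖ → |F (c.lift z)| ≤ C * ‖z‖ ^ δ) : Integrable F (riemannianVolume g) := by
  have : Fact (0 < t) := ⟨h.pos⟩
  obtain ⟨D, hD0, hD⟩ := h.isFlatEnd.exists_volumeDensity_bound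
  refine c.integrable_of_end hG h.lt hF ?_
  have hm := (isOpen_exterior (E := EuclideanSpace ℝ (Fin n)) t).measurableSet
  refine ((integrableOn_norm_rpow (E := EuclideanSpace ℝ (Fin n)) h.pos (δ := δ)
    (by simpa using hδ)).const_mul (D * C)).mono'
    ((h.continuousOn_density_mul hF).aestronglyMeasurable hm)
    ((ae_restrict_iff' hm).2 (Filter.Eventually.of_forall fun z hz => ?_))
  have h0 : 0 ≤ volumeDensity (pullbackMetric g c.lift) z := Real.sqrt_nonneg _
  rw [Real.norm_eq_abs, abs_mul, abs_of_nonneg h0, mul_assoc]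
  exact mul_le_mul (hD z hz).2 (hle z hz) (abs_nonneg _) hD0

lemma eventually_lt (t : ℝ) : ∀ᶠ k : ℕ in Filter.atTop, t < k :=
  (tendsto_natCast_atTop_atTop (R := ℝ)).eventually_gt_atTop t

/-- Integrals can be computed with cutoff functions. -/
lemma tendsto_integral_cutoff (h : c.IsAdapted ρ t) (hρ : Continuous ρ) {F : X → ℝ}
    (hF : Integrable F (riemannianVolume g)) :
    Filter.Tendsto (fun k : ℕ => ∫ x, c.cutoff k x * F x ∂(riemannianVolume g)) Filter.atTop
      (𝓝 (∫ x, F x ∂(riemannianVolume g))) := by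
  refine tendsto_integral_filter_of_dominated_convergence (fun x => |F x|) ?_ ?_ hF.abs ?_
  · filter_upwards [eventually_lt t] with k hk
    exact (h.contMDiff_cutoff hρ hk).continuous.aestronglyMeasurable.mul hF.1
  · refine Filter.Eventually.of_forall fun k => Filter.Eventually.of_forall fun x => ?_
    rw [Real.norm_eq_abs, abs_mul, abs_of_nonneg (cutoff_nonneg _ x)]
    exact mul_le_of_le_one_left (abs_nonneg _) (cutoff_le_one _ x)
  · refine Filter.Eventually.of_forall fun x => ?_
    refine tendsto_const_nhds.congr' ?_
    filter_upwards [eventually_lt (radius G (c.toQuotient x))] with k hk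
    rw [cutoff_eq_one, one_mul]
    by_cases hx : x ∈ c.core
    · exact Or.inl hx
    · exact Or.inr ⟨hx, hk.le⟩

lemma tendsto_integral_end (h : c.IsAdapted ρ t) (hG : IsFreeRotationGroup G) {C δ : ℝ}
    (hδ : δ < -n) {F : ℕ → X → ℝ} (hF : ∀ k : ℕ, t < k → Continuous (F k))
    (h0 : ∀ k : ℕ, t < k → ∀ x ∈ c.inner t, F k x = 0)
    (hle : ∀ k : ℕ, t < k → ∀ z, t < ‖z‖ → |F k (c.lift z)| ≤ C * ‖z‖ ^ δ)
    (h1 : ∀ k : ℕ, t < k → ∀ z, t < ‖z‖ → ‖z‖ < k → F k (c.lift z) = 0) :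
    Filter.Tendsto (fun k => ∫ x, F k x ∂(riemannianVolume g)) Filter.atTop (𝓝 0) := by
  have : Fact (0 < t) := ⟨h.pos⟩
  obtain ⟨D, hD0, hD⟩ := h.isFlatEnd.exists_volumeDensity_bound
  have h2 := (tendsto_setIntegral_exterior (E := EuclideanSpace ℝ (Fin n)) (R := t) h.pos
    (C := D * C) (δ := δ) (by simpa using hδ)
    (f := fun k z => volumeDensity (pullbackMetric g c.lift) z * F k (c.lift z))
    ((eventually_lt t).mono fun k hk => h.continuousOn_density_mul (hF k hk))
    ((eventually_lt t).mono fun k hk z hz => by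
      have h0 : 0 ≤ volumeDensity (pullbackMetric g c.lift) z := Real.sqrt_nonneg _
      rw [abs_mul, abs_of_nonneg h0, mul_assoc]
      exact mul_le_mul (hD z hz).2 (hle k hk z hz) (abs_nonneg _) hD0)
    ((eventually_lt t).mono fun k hk z hz hzk => by
      rw [h1 k hk z hz hzk, mul_zero])).const_mul (Nat.card G : ℝ)⁻¹
  rw [mul_zero] at h2
  refine h2.congr' ?_
  filter_upwards [eventually_lt t] with k hk
  exact (c.integral_eq_of_end hG h.lt (hF k hk) (h0 k hk)).symm

lemma integrable_mul_laplacian (h : c.IsAdapted ρ t) (hG : IsFreeRotationGroup G)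
    {β γ : ℝ} {u v : X → ℝ} (hβγ : β + γ < 2 - n) (hu : u ∈ weightedC g ρ 2 β)
    (hv : v ∈ weightedC g ρ 2 γ) :
    Integrable (fun x => u x * laplacian g v x) (riemannianVolume g) := by
  obtain ⟨C, hC0, hC⟩ := h.exists_bound hu
  obtain ⟨D, hD0, hD⟩ := h.exists_bound hv
  have hv2 : ContMDiff (𝓡 n) 𝓘(ℝ, ℝ) 2 v := hv.1
  refine h.integrable_of_le hG (hu.1.continuous.mul (continuous_laplacian g hv2)) (C := C * D)
    (δ := β + (γ - 2)) (by linarith) fun z hz => ?_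
  have hz0 : 0 < ‖z‖ := h.pos.trans hz
  rw [abs_mul, Real.rpow_add hz0]
  calc _ ≤ C * ‖z‖ ^ β * (D * ‖z‖ ^ (γ - 2)) :=
        mul_le_mul (hC z hz).1 (hD z hz).2.2 (abs_nonneg _) (by positivity)
    _ = _ := by ring

lemma laplacian_cutoff_mul (h : c.IsAdapted ρ t) (hρ : Continuous ρ) {s : ℝ} (hs : t < s)
    {u : X → ℝ} (hu : ContMDiff (𝓡 n) 𝓘(ℝ, ℝ) 2 u) {z : EuclideanSpace ℝ (Fin n)} (hz : t < ‖z‖) :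
    laplacian g (fun x => c.cutoff s x * u x) (c.lift z)
      = ALE.cutoff s z * laplacian g u (c.lift z)
        + u (c.lift z) * metricLaplacian (pullbackMetric g c.lift) (ALE.cutoff s) z
        - 2 * fderiv ℝ (ALE.cutoff s) z
          ((pullbackMetric g c.lift z).inverse (fderiv ℝ (u ∘ c.lift) z)) := by
  have hχ : ContMDiff (𝓡 n) 𝓘(ℝ, ℝ) 2 (c.cutoff s) := (h.contMDiff_cutoff hρ hs).of_le (by norm_cast)
  have hd : ContDiffAt ℝ 2 (u ∘ c.lift) z :=
    (h.isParam.contDiffOn_comp (k := 2) hu).contDiffAt (h.isParam.isOpen.mem_nhds hz)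
  have hev : (fun x => c.cutoff s x * u x) ∘ c.lift
      =ᶠ[𝓝 z] fun y => ALE.cutoff s y * (u ∘ c.lift) y := by
    filter_upwards [h.isParam.isOpen.mem_nhds hz] with y hy
    rw [Function.comp_apply, cutoff_lift s (h.lt.trans hy)]
    rfl
  rw [laplacian_eq g h.isParam (f := fun x => c.cutoff s x * u x) (hχ.mul hu) hz,
    metricLaplacian_congr _ hev,
    metricLaplacian_mul h.isFlatEnd.isMetricOn hz (contDiff_cutoff s (m := 2)).contDiffAt hd,
    laplacian_eq g h.isParam hu hz]
  rfl

/-- Green's identity for the truncated `u` and `v` leaves the commutator `F k`, the product of `v`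
with Δ(χ_k u) - χ_k Δu. It contains only derivatives of the cutoff, so it vanishes for r < k and has
a bound of order β + γ - 2 < -n uniform in `k`. -/
lemma integral_mul_laplacian_eq (h : c.IsAdapted ρ t) (hρ : Continuous ρ)
    (hG : IsFreeRotationGroup G) {β γ : ℝ} {u v : X → ℝ} (hβγ : β + γ < 2 - n)
    (hu : u ∈ weightedC g ρ 2 β) (hv : v ∈ weightedC g ρ 2 γ) :
    ∫ x, u x * laplacian g v x ∂(riemannianVolume g)
      = ∫ x, v x * laplacian g u x ∂(riemannianVolume g) := by
  have : Fact (0 < t) := ⟨h.pos⟩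
  have i1 := h.integrable_mul_laplacian hG hβγ hu hv
  have i2 := h.integrable_mul_laplacian hG (by linarith) hv hu
  have hu2 : ContMDiff (𝓡 n) 𝓘(ℝ, ℝ) 2 u := hu.1
  have hv2 : ContMDiff (𝓡 n) 𝓘(ℝ, ℝ) 2 v := hv.1
  have hχ : ∀ {s : ℝ}, t < s → ContMDiff (𝓡 n) 𝓘(ℝ, ℝ) 2 (c.cutoff s) := fun hs =>
    (h.contMDiff_cutoff hρ hs).of_le (by norm_cast)
  have hχu : ∀ {s : ℝ}, t < s → ContMDiff (𝓡 n) 𝓘(ℝ, ℝ) 2 (fun x => c.cutoff s x * u x) :=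
    fun hs => (hχ hs).mul hu2
  have hsupp : ∀ {s : ℝ}, t < s → HasCompactSupport (c.cutoff s) := fun {s} hs =>
    hasCompactSupport_cutoff (h.pos.trans hs) (by linarith [h.lt, h.pos])
  have hsuppu : ∀ {s : ℝ}, t < s → HasCompactSupport (fun x => c.cutoff s x * u x) :=
    fun hs => (hsupp hs).mul_right
  rw [← sub_eq_zero, ← integral_sub i1 i2]
  refine tendsto_nhds_unique (h.tendsto_integral_cutoff hρ (i1.sub i2)) ?_
  set F : ℕ → X → ℝ := fun k x => c.cutoff k x * (u x * laplacian g v x - v x * laplacian g u x)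
    - greenIntegrand g (fun x => c.cutoff k x * u x) v x with hF
  have hFeq : ∀ k x, F k x = v x * (laplacian g (fun x => c.cutoff k x * u x) x
      - c.cutoff k x * laplacian g u x) := fun k x => by
    simp only [hF, greenIntegrand]
    ring
  have hcont : ∀ {s : ℝ}, t < s → Continuous
      (fun x => c.cutoff s x * (u x * laplacian g v x - v x * laplacian g u x)) := fun hs =>
    (hχ hs).continuous.mul ((hu2.continuous.mul (continuous_laplacian g hv2)).sub
      (hv2.continuous.mul (continuous_laplacian g hu2)))
  have hFint : ∀ k : ℕ, t < k → ∫ x, F k x ∂(riemannianVolume g)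
      = ∫ x, c.cutoff k x * (u x * laplacian g v x - v x * laplacian g u x)
        ∂(riemannianVolume g) := fun k hk => by
    rw [integral_sub ((hcont hk).integrable_of_hasCompactSupport (hsupp hk).mul_right)
      (integrable_greenIntegrand g (hχu hk) hv2 (hsuppu hk)),
      integral_greenIntegrand g (hχu hk) hv2 (hsuppu hk), sub_zero]
  obtain ⟨C, hC0, hC⟩ := h.exists_bound hu
  obtain ⟨D, hD0, hD⟩ := h.exists_bound hv
  obtain ⟨K, hK0, hK⟩ := h.isFlatEnd.exists_cutoff_bound
  -- The factor `D` bounds `v`, the product `C * K` bounds u Δχ, and the rest bounds twice the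
  -- product of the gradients, where the inverse metric has norm at most `2`.
  refine (h.tendsto_integral_end hG (C := D * (C * K + 2 * (K * (2 * C)))) (δ := β + γ - 2)
    (F := F) (by linarith) (fun k hk => ?_) (fun k hk x hx => ?_) (fun k hk z hz => ?_)
    (fun k hk z hz hzk => ?_)).congr' ((eventually_lt t).mono hFint)
  · exact (hcont hk).sub (continuous_greenIntegrand g (hχu hk) hv2)
  · have hev := h.cutoff_eventuallyEq_one hρ hx hk
    rw [hFeq, laplacian_congr g (hχu hk) hu2 (hev.mono fun y hy => by
      simp only [hy, one_mul]), hev.self_of_nhds]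
    ring
  · have hz0 : 0 < ‖z‖ := h.pos.trans hz
    obtain ⟨hK1, hK2, -⟩ := hK k (h.pos.trans hk) z hz
    obtain ⟨hC1, hC2, -⟩ := hC z hz
    rw [hFeq, h.laplacian_cutoff_mul hρ hk hu2 hz, cutoff_lift _ (h.lt.trans hz)]
    have e1 : |fderiv ℝ (ALE.cutoff k) z ((pullbackMetric g c.lift z).inverse
        (fderiv ℝ (u ∘ c.lift) z))| ≤ K * ‖z‖⁻¹ * (2 * (C * ‖z‖ ^ (β - 1))) := by
      refine (ContinuousLinearMap.le_opNorm _ _).trans (mul_le_mul hK1 ?_ (norm_nonneg _)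
        (by positivity))
      exact (ContinuousLinearMap.le_opNorm _ _).trans (mul_le_mul
        (h.isFlatEnd.norm_inverse_le hz) hC2 (norm_nonneg _) (by norm_num))
    have e2 : |u (c.lift z) * metricLaplacian (pullbackMetric g c.lift) (ALE.cutoff k) z|
        ≤ C * ‖z‖ ^ β * (K * (‖z‖ ^ 2)⁻¹) := by
      rw [abs_mul]
      exact mul_le_mul hC1 hK2 (abs_nonneg _) (by positivity)
    have p1 : ‖z‖ ^ (β - 1) = ‖z‖ ^ β * ‖z‖⁻¹ := by
      rw [Real.rpow_sub hz0, Real.rpow_one, div_eq_mul_inv]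
    have p2 : ‖z‖ ^ (β + γ - 2) = ‖z‖ ^ γ * (‖z‖ ^ β * (‖z‖ ^ 2)⁻¹) := by
      rw [Real.rpow_sub hz0, Real.rpow_add hz0, Real.rpow_two]
      ring
    rw [abs_mul, p2]
    calc _ ≤ D * ‖z‖ ^ γ * (C * ‖z‖ ^ β * (K * (‖z‖ ^ 2)⁻¹)
          + 2 * (K * ‖z‖⁻¹ * (2 * (C * ‖z‖ ^ (β - 1))))) := by
          refine mul_le_mul (hD z hz).1 ?_ (abs_nonneg _) (by positivity)
          rw [add_sub_assoc, add_sub_cancel_left]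
          refine (abs_sub _ _).trans (add_le_add e2 ?_)
          rw [abs_mul, abs_two]
          exact mul_le_mul_of_nonneg_left e1 (by norm_num)
      _ = _ := by
          rw [p1]
          field_simp
  · rw [hFeq, h.laplacian_cutoff_mul hρ hk hu2 hz, cutoff_lift _ (h.lt.trans hz),
      metricLaplacian_cutoff_eq_zero _ hzk, fderiv_cutoff_eq_zero hzk]
    simp

end AsymptoticCoordinates.IsAdapted

end Analysis

/-! ### Bounds on covariant derivatives over compact sets -/

section LocalBounds

lemma exists_forall_norm_sq_le {E : Type*} [NormedAddCommGroup E] [NormedSpace ℝ E]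
    [FiniteDimensional ℝ E] {B : E →L[ℝ] E →L[ℝ] ℝ} (hB : ∀ v, v ≠ 0 → 0 < B v v) :
    ∃ a, 0 < a ∧ ∀ v, a * ‖v‖ ^ 2 ≤ B v v := by
  have : ProperSpace E := FiniteDimensional.proper ℝ E
  obtain ⟨a, ha, h⟩ := (isCompact_sphere (0 : E) 1).exists_forall_le' (f := fun v => B v v)
    (B.continuous.clm_apply continuous_id).continuousOn (a := 0)
    (fun v hv => hB v fun h0 => by simp [h0] at hv)
  refine ⟨a, ha, fun v => ?_⟩
  by_cases hv : v = 0
  · simp [hv]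
  · have hv0 : 0 < ‖v‖ := norm_pos_iff.2 hv
    have h1 := h (‖v‖⁻¹ • v) (by simp [norm_smul, hv0.ne'])
    simp only [map_smul, smul_apply, smul_eq_mul] at h1
    calc a * ‖v‖ ^ 2 ≤ ‖v‖⁻¹ * (‖v‖⁻¹ * B v v) * ‖v‖ ^ 2 := by gcongr
      _ = B v v := by field_simp

variable {n : ℕ} {X : Type*} [TopologicalSpace X] [ChartedSpace (EuclideanSpace ℝ (Fin n)) X]
  [IsManifold (𝓡 n) ∞ X] (g : Metric n X)

lemma IsParam.surjective {ψ : EuclideanSpace ℝ (Fin n) → X} {U : Set (EuclideanSpace ℝ (Fin n))}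
    (hψ : IsParam ψ U) {z : EuclideanSpace ℝ (Fin n)} (hz : z ∈ U) :
    Function.Surjective (mfderiv (𝓡 n) (𝓡 n) ψ z) := by
  let D : EuclideanSpace ℝ (Fin n) →L[ℝ] EuclideanSpace ℝ (Fin n) := mfderiv (𝓡 n) (𝓡 n) ψ z
  exact (LinearMap.injective_iff_surjective (f := (D : _ →ₗ[ℝ] EuclideanSpace ℝ (Fin n)))).1
    (hψ.injective z hz)

/-- A bound on a covariant derivative in a parametrization gives a bound on the manifold. -/
lemma IsParam.abs_nablaIter_le {ψ : EuclideanSpace ℝ (Fin n) → X}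
    {U : Set (EuclideanSpace ℝ (Fin n))} (hψ : IsParam ψ U) {f : X → ℝ} {j : ℕ}
    (hf : ContMDiff (𝓡 n) 𝓘(ℝ, ℝ) j f) {z : EuclideanSpace ℝ (Fin n)} (hz : z ∈ U) {a : ℝ}
    (hle : ∀ v, ‖v‖ ≤ a * √(pullbackMetric g ψ z v v))
    (v : Fin j → TangentSpace (𝓡 n) (ψ z)) :
    |nablaIter g f j (ψ z) v|
      ≤ ‖iterCovDerivTensor (christoffelTensor (pullbackMetric g ψ)) (f ∘ ψ) j z‖ * a ^ j
        * ∏ i, √(g.inner (ψ z) (v i) (v i)) := by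
  choose w hw using fun i => hψ.surjective hz (v i)
  obtain rfl : (fun i => mfderiv (𝓡 n) (𝓡 n) ψ z (w i)) = v := funext hw
  refine (congrArg abs (nablaIter_eq g hψ hf hz w)).trans_le ?_
  refine (ContinuousMultilinearMap.le_opNorm
    (iterCovDerivTensor (christoffelTensor (pullbackMetric g ψ)) (f ∘ ψ) j z) w).trans ?_
  rw [mul_assoc]
  refine mul_le_mul_of_nonneg_left ?_ (norm_nonneg _)
  let w' : Fin j → EuclideanSpace ℝ (Fin n) := w
  have h := Finset.prod_le_prod (s := Finset.univ) (fun i _ => norm_nonneg (w' i))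
    fun i _ => hle (w' i)
  rwa [Finset.prod_mul_distrib, Finset.prod_const, Finset.card_univ, Fintype.card_fin] at h

/-- In the fixed chart at `p` the covariant derivative is a continuous tensor field, hence locally
bounded, and the metric is locally bounded from below. This avoids the charts that vary with the
point in the definition of `nablaIter`. -/
lemma exists_nablaIter_bound_nhds {f : X → ℝ} (hf : ContMDiff (𝓡 n) 𝓘(ℝ, ℝ) ∞ f) (j : ℕ) (p : X) :
    ∃ V ∈ 𝓝 p, ∃ C, ∀ x ∈ V, ∀ v : Fin j → TangentSpace (𝓡 n) x,
      |nablaIter g f j x v| ≤ C * ∏ i, √(g.inner x (v i) (v i)) := by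
  set φ := extChartAt (𝓡 n) p with hφ
  have hψ := isParam_extChartAt_symm (n := n) p
  have hb : IsMetricOn (chartMetric g p) φ.target := isMetricOn_pullbackMetric g hψ
  have hfj : ContMDiff (𝓡 n) 𝓘(ℝ, ℝ) j f := hf.of_le (by exact_mod_cast le_top)
  set T := iterCovDerivTensor (christoffelTensor (chartMetric g p)) (f ∘ φ.symm) j with hT
  have hTc : ContinuousOn T φ.target :=
    (contDiffOn_iterCovDerivTensor (m := 0) (n := j) hb.isOpen hb.contDiffOn_christoffelTensor j
      (by simp) (hψ.contDiffOn_comp (k := j) hfj)).continuousOn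
  have hp := mem_extChartAt_target (I := 𝓡 n) p
  have hn := hb.isOpen.mem_nhds hp
  obtain ⟨a, ha, hle⟩ := exists_forall_norm_sq_le (hb.pos _ hp)
  have h1 : ∀ᶠ y in 𝓝 (φ p), ‖T y‖ < ‖T (φ p)‖ + 1 :=
    (hTc.continuousAt hn).norm.eventually (gt_mem_nhds (by linarith))
  have h2 : ∀ᶠ y in 𝓝 (φ p), ‖chartMetric g p y - chartMetric g p (φ p)‖ < a / 2 := by
    have := ((hb.contDiffOn.continuousOn.continuousAt hn).sub
      (continuousAt_const (y := chartMetric g p (φ p)))).norm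
    refine this.eventually (gt_mem_nhds ?_)
    change ‖chartMetric g p (φ p) - chartMetric g p (φ p)‖ < a / 2
    rw [sub_self, norm_zero]
    exact half_pos ha
  have h3 : ∀ᶠ x in 𝓝 p, x ∈ φ.source ∧ ‖T (φ x)‖ < ‖T (φ p)‖ + 1 ∧
      ‖chartMetric g p (φ x) - chartMetric g p (φ p)‖ < a / 2 := by
    filter_upwards [(isOpen_extChartAt_source (I := 𝓡 n) p).mem_nhds (mem_extChartAt_source p),
      (continuousAt_extChartAt (I := 𝓡 n) p).eventually (h1.and h2)] with x hx hx' using ⟨hx, hx'⟩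
  -- Near `p` the metric is at least half its lower bound `a` at `p`.
  set κ := √(2 / a) with hκ
  refine ⟨_, h3, (‖T (φ p)‖ + 1) * κ ^ j, fun x hx v => ?_⟩
  obtain ⟨hxs, hx1, hx2⟩ := hx
  have hxt : φ x ∈ φ.target := φ.map_source hxs
  have hmet : ∀ w, ‖w‖ ≤ κ * √(pullbackMetric g φ.symm (φ x) w w) := by
    intro w
    have e1 := (chartMetric g p (φ x) - chartMetric g p (φ p)).le_opNorm₂ w w
    rw [sub_apply, sub_apply, Real.norm_eq_abs] at e1
    have e2 := hle w
    have e3 : a / 2 * ‖w‖ ^ 2 ≤ pullbackMetric g φ.symm (φ x) w w := by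
      have e4 : pullbackMetric g φ.symm (φ x) w w = chartMetric g p (φ x) w w := rfl
      rw [e4]
      have := (abs_le.1 e1).1
      nlinarith [sq_nonneg ‖w‖]
    rw [hκ, ← Real.sqrt_mul (by positivity)]
    refine Real.le_sqrt_of_sq_le ?_
    calc ‖w‖ ^ 2 = 2 / a * (a / 2 * ‖w‖ ^ 2) := by field_simp
      _ ≤ _ := by gcongr
  -- The vectors live in the tangent space at the given point, which is not by definition its image
  -- under the chart and back. Stating the bound for a variable point `y` permits the substitution.
  have hkey : ∀ y ∈ φ.source, φ y = φ x → ∀ v : Fin j → TangentSpace (𝓡 n) y,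
      |nablaIter g f j y v| ≤ ‖T (φ x)‖ * κ ^ j * ∏ i, √(g.inner y (v i) (v i)) := by
    intro y hy hyx
    have : φ.symm (φ x) = y := by rw [← hyx, φ.left_inv hy]
    subst this
    exact hψ.abs_nablaIter_le g hfj hxt hmet
  refine (hkey x hxs rfl v).trans ?_
  have hprod : 0 ≤ ∏ i, √(g.inner x (v i) (v i)) := Finset.prod_nonneg fun i _ => Real.sqrt_nonneg _
  have hκ0 : 0 ≤ κ := Real.sqrt_nonneg _
  gcongr

lemma exists_nablaIter_bound_of_isCompact {f : X → ℝ} (hf : ContMDiff (𝓡 n) 𝓘(ℝ, ℝ) ∞ f) (j : ℕ)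
    {S : Set X} (hS : IsCompact S) : ∃ C, 0 ≤ C ∧ ∀ x ∈ S, ∀ v : Fin j → TangentSpace (𝓡 n) x,
      |nablaIter g f j x v| ≤ C * ∏ i, √(g.inner x (v i) (v i)) := by
  refine hS.induction_on ⟨0, le_rfl, by simp⟩ ?_ ?_ ?_
  · rintro A B hAB ⟨C, h0, hC⟩
    exact ⟨C, h0, fun x hx => hC x (hAB hx)⟩
  · rintro A B ⟨C, h0, hC⟩ ⟨D, h0', hD⟩
    refine ⟨C + D, by positivity, fun x hx v => ?_⟩
    have hprod : 0 ≤ ∏ i, √(g.inner x (v i) (v i)) :=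
      Finset.prod_nonneg fun i _ => Real.sqrt_nonneg _
    rcases hx with hx | hx
    · refine (hC x hx v).trans ?_
      gcongr
      linarith
    · refine (hD x hx v).trans ?_
      gcongr
      linarith
  · intro p _
    obtain ⟨V, hV, C, hC⟩ := exists_nablaIter_bound_nhds g hf j p
    refine ⟨V, mem_nhdsWithin_of_mem_nhds hV, |C|, abs_nonneg C, fun x hx v => ?_⟩
    exact (hC x hx v).trans (mul_le_mul_of_nonneg_right (le_abs_self C)
      (Finset.prod_nonneg fun i _ => Real.sqrt_nonneg _))

end LocalBounds

/-! ### The Laplacian of `ρ ^ (2 - n)` and its integral -/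

section FundamentalSolution

variable {n : ℕ} {X : Type*} [TopologicalSpace X] [ChartedSpace (EuclideanSpace ℝ (Fin n)) X]
  [IsManifold (𝓡 n) ∞ X] {g : Metric n X}
  {G : Subgroup (EuclideanSpace ℝ (Fin n) ≃ₗᵢ[ℝ] EuclideanSpace ℝ (Fin n))}
  {c : AsymptoticCoordinates g G} {ρ : X → ℝ} {t : ℝ}

namespace AsymptoticCoordinates

lemma IsRadiusFunction.contMDiff_rpow (hρ : c.IsRadiusFunction ρ) (p : ℝ) :
    ContMDiff (𝓡 n) 𝓘(ℝ, ℝ) ∞ (fun x => ρ x ^ p) := fun x =>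
  (Real.contDiffAt_rpow_const_of_ne (n := ∞)
    (by linarith [hρ.one_le x] : ρ x ≠ 0)).contMDiffAt.comp x hρ.contMDiff.contMDiffAt

namespace IsAdapted

/-- A smooth function that is a symbol in asymptotic coordinates lies in a weighted space. -/
lemma mem_weightedCInfty (h : c.IsAdapted ρ t) (hρ : c.IsRadiusFunction ρ) {f : X → ℝ}
    (hf : ContMDiff (𝓡 n) 𝓘(ℝ, ℝ) ∞ f) {β : ℝ} (hs : IsSymbol t β (f ∘ c.lift)) :
    f ∈ weightedCInfty g ρ β := by
  have : Fact (0 < t) := ⟨h.pos⟩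
  refine mem_iInter.2 fun k => ⟨hf.of_le (by exact_mod_cast le_top), fun j _ => ?_⟩
  have hfj : ContMDiff (𝓡 n) 𝓘(ℝ, ℝ) j f := hf.of_le (by exact_mod_cast le_top)
  obtain ⟨K, hK⟩ := (h.isFlatEnd.isSymbol_iterCovDerivTensor hs j).norm_le
  have hcomp := c.isCompact_inner' h.lt
  obtain ⟨C, hC0, hC⟩ := exists_nablaIter_bound_of_isCompact g hf j hcomp
  obtain ⟨D, hD⟩ := hcomp.exists_bound_of_continuousOn (f := fun x => ρ x ^ (-(β - j)))
    (hρ.contMDiff_rpow _).continuous.continuousOn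
  have hρpos : ∀ x, 0 < ρ x := fun x => one_pos.trans_le (hρ.one_le x)
  -- The first summand serves the compact inner part, where the inverse weight is at most `|D|`; the
  -- second serves the end.
  refine ⟨C * |D| + |K| * 2 ^ |β - j| * 2 ^ j, fun x v => ?_⟩
  have hprod : 0 ≤ ∏ i, √(g.inner x (v i) (v i)) := Finset.prod_nonneg fun i _ => Real.sqrt_nonneg _
  have hρp : 0 ≤ ρ x ^ (β - j) := (Real.rpow_pos_of_pos (hρpos x) _).le
  by_cases hx : x ∈ c.inner t
  · refine (hC x hx v).trans ?_
    have h1 : 1 ≤ |D| * ρ x ^ (β - j) := by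
      have h2 := (le_abs_self _).trans ((hD x hx).trans (le_abs_self D))
      calc (1 : ℝ) = ρ x ^ (-(β - j)) * ρ x ^ (β - j) := by
            rw [← Real.rpow_add (hρpos x), neg_add_cancel, Real.rpow_zero]
        _ ≤ _ := mul_le_mul_of_nonneg_right h2 hρp
    refine mul_le_mul_of_nonneg_right ?_ hprod
    calc C ≤ C * (|D| * ρ x ^ (β - j)) := le_mul_of_one_le_right hC0 h1
      _ = C * |D| * ρ x ^ (β - j) := by ring
      _ ≤ _ := by
        refine mul_le_mul_of_nonneg_right ?_ hρp
        have : 0 ≤ |K| * 2 ^ |β - j| * 2 ^ j := by positivity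
        linarith
  · obtain ⟨z, -, hz, rfl⟩ := c.exists_lift_of_notMem_inner hx
    have hz0 : 0 < ‖z‖ := h.pos.trans hz
    refine (h.isParam.abs_nablaIter_le g hfj hz (a := 2)
      (h.isFlatEnd.norm_le hz) v).trans ?_
    refine mul_le_mul_of_nonneg_right ?_ hprod
    calc _ ≤ |K| * (2 ^ |β - j| * ρ (c.lift z) ^ (β - j)) * 2 ^ j := by
          gcongr
          refine (hK z hz).trans (mul_le_mul (le_abs_self K) (h.norm_rpow_le hz _) (by positivity)
            (abs_nonneg K))
      _ = |K| * 2 ^ |β - j| * 2 ^ j * ρ (c.lift z) ^ (β - j) := by ring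
      _ ≤ _ := by
        refine mul_le_mul_of_nonneg_right ?_ hρp
        have : 0 ≤ C * |D| := by positivity
        linarith

lemma isSymbol_laplacian_rpow (h : c.IsAdapted ρ t) (hρ : c.IsRadiusFunction ρ) :
    IsSymbol t (-2 * n) (laplacian g (fun x => ρ x ^ (2 - n : ℝ)) ∘ c.lift) := by
  have : Fact (0 < t) := ⟨h.pos⟩
  have h1 := h.isFlatEnd.isSymbol_metricLaplacian_rpow h.isRadiusSymbol
  rw [finrank_euclideanSpace_fin] at h1
  refine (h1.of_order_eq (by ring)).congr fun z hz => ?_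
  exact laplacian_eq g h.isParam ((hρ.contMDiff_rpow _).of_le (by norm_cast)) hz

lemma contMDiff_laplacian_rpow (hρ : c.IsRadiusFunction ρ) :
    ContMDiff (𝓡 n) 𝓘(ℝ, ℝ) ∞ (laplacian g (fun x => ρ x ^ (2 - n : ℝ))) :=
  contMDiff_laplacian g (m := ⊤) (k := ⊤) le_top (hρ.contMDiff_rpow _)

lemma laplacian_rpow_mem (h : c.IsAdapted ρ t) (hρ : c.IsRadiusFunction ρ) :
    laplacian g (fun x => ρ x ^ (2 - n : ℝ)) ∈ weightedCInfty g ρ (-2 * n) :=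
  h.mem_weightedCInfty hρ (contMDiff_laplacian_rpow hρ) (h.isSymbol_laplacian_rpow hρ)

variable [MeasurableSpace X] [BorelSpace X] [T2Space X] [SecondCountableTopology X] [Nonempty X]
  [Finite G]

lemma integrable_laplacian_rpow (h : c.IsAdapted ρ t) (hρ : c.IsRadiusFunction ρ)
    (hG : IsFreeRotationGroup G) (hn : 0 < n) :
    Integrable (laplacian g (fun x => ρ x ^ (2 - n : ℝ))) (riemannianVolume g) := by
  obtain ⟨K, hK⟩ := (h.isSymbol_laplacian_rpow hρ).norm_le
  have hn' : (0 : ℝ) < n := by exact_mod_cast hn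
  exact h.integrable_of_le hG (contMDiff_laplacian_rpow hρ).continuous (by linarith) hK

lemma integrableOn_density_mul (h : c.IsAdapted ρ t) (hG : IsFreeRotationGroup G) {F : X → ℝ}
    (hF : Continuous F) (hi : Integrable F (riemannianVolume g)) :
    IntegrableOn (fun z => volumeDensity (pullbackMetric g c.lift) z * F (c.lift z))
      (exterior (EuclideanSpace ℝ (Fin n)) t) := by
  refine (integrable_paramVolume_iff h.isParam hF.aestronglyMeasurable).1 ?_
  rw [c.paramVolume_lift hG h.lt, ← Nat.cast_smul_eq_nsmul ENNReal]
  exact hi.restrict.smul_measure (ENNReal.natCast_ne_top _)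

/-- The difference between the flux of `ρ ^ (2 - n)` and its Euclidean counterpart. -/
lemma tendsto_integral_error (h : c.IsAdapted ρ t) (hρ : c.IsRadiusFunction ρ)
    (hn : 0 < n) :
    let err : ℕ → EuclideanSpace ℝ (Fin n) → ℝ := fun k z =>
      volumeDensity (pullbackMetric g c.lift) z
        * (ρ (c.lift z) ^ (2 - n : ℝ) * laplacian g (c.cutoff k) (c.lift z))
        - ‖z‖ ^ (2 - n : ℝ) * flatLaplacian (ALE.cutoff k) z
    (∀ k : ℕ, t < k → IntegrableOn (err k) (exterior (EuclideanSpace ℝ (Fin n)) t)) ∧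
    Filter.Tendsto (fun k => ∫ z in exterior (EuclideanSpace ℝ (Fin n)) t, err k z) Filter.atTop
      (𝓝 0) := by
  intro err
  have : Fact (0 < t) := ⟨h.pos⟩
  have hn' : (0 : ℝ) < n := by exact_mod_cast hn
  set p : ℝ := 2 - n with hp
  have hcut : ∀ k : ℕ, t < k → ContMDiff (𝓡 n) 𝓘(ℝ, ℝ) 2 (c.cutoff k) := fun k hk =>
    (h.contMDiff_cutoff hρ.contMDiff.continuous hk).of_le (by norm_cast)
  -- In the first product the density and `ρ ^ p` are replaced by their Euclidean values, in the
  -- second the Laplacian. Each replacement gains ‖z‖^{-n} over the order p - 2, and p - 2 - n =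
  -- -2n.
  have herr : ∀ k : ℕ, t < k → ∀ z, t < ‖z‖ → err k z =
      (volumeDensity (pullbackMetric g c.lift) z * ρ (c.lift z) ^ p - ‖z‖ ^ p)
        * metricLaplacian (pullbackMetric g c.lift) (ALE.cutoff k) z
      + ‖z‖ ^ p * (metricLaplacian (pullbackMetric g c.lift) (ALE.cutoff k) z
        - flatLaplacian (ALE.cutoff k) z) := fun k hk z hz => by
    have hev : c.cutoff k ∘ c.lift =ᶠ[𝓝 z] ALE.cutoff k := by
      filter_upwards [h.isParam.isOpen.mem_nhds hz] with y hy
      exact cutoff_lift _ (h.lt.trans hy)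
    simp only [err]
    rw [laplacian_eq g h.isParam (hcut k hk) hz, metricLaplacian_congr _ hev]
    ring
  have hcont : ∀ k : ℕ, t < k → ContinuousOn (err k) (exterior (EuclideanSpace ℝ (Fin n)) t) := by
    intro k hk
    refine (h.continuousOn_density_mul (F := fun x => ρ x ^ p * laplacian g (c.cutoff k) x)
      ((hρ.contMDiff_rpow p).continuous.mul (continuous_laplacian g (hcut k hk)))).sub
      (((isSymbol_norm_rpow _ t p).contDiffOn.continuousOn).mul (Continuous.continuousOn ?_))
    have e : flatLaplacian (ALE.cutoff (k : ℝ) : EuclideanSpace ℝ (Fin n) → ℝ) = _ :=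
      funext (flatLaplacian_cutoff (k : ℝ))
    rw [e]
    have c0 : Continuous fun z : EuclideanSpace ℝ (Fin n) => ‖z‖ ^ 2 / (k : ℝ) ^ 2 :=
      (continuous_norm.pow 2).div_const _
    exact ((((contDiff_deriv_bump.continuous.comp c0).div_const _).const_mul _).add
      (((continuous_norm.pow 2).const_mul 4).mul
        ((continuous_deriv_deriv_bump.comp c0).div_const _))).neg
  obtain ⟨D, hD0, hD⟩ := h.isFlatEnd.exists_volumeDensity_bound
  obtain ⟨K, hK0, hK⟩ := h.isFlatEnd.exists_cutoff_bound
  obtain ⟨L, hL⟩ := (h.isRadiusSymbol.isSymbol_rpow_sub h.isFlatEnd.order_nonneg p).norm_le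
  set A := (2 : ℝ) ^ |p| with hA
  have hA0 : 0 ≤ A := by positivity
  have hle : ∀ k : ℕ, t < k → ∀ z ∈ exterior (EuclideanSpace ℝ (Fin n)) t,
      |err k z| ≤ ((D * A + |L|) * K + K) * ‖z‖ ^ (-2 * n : ℝ) := by
    intro k hk z hz
    have hz0 : 0 < ‖z‖ := h.pos.trans hz
    obtain ⟨-, hK2, hK3⟩ := hK k (h.pos.trans hk) z hz
    have e1 : |volumeDensity (pullbackMetric g c.lift) z * ρ (c.lift z) ^ p - ‖z‖ ^ p|
        ≤ (D * A + |L|) * (‖z‖ ^ (-n : ℝ) * ‖z‖ ^ p) := by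
      have e2 : volumeDensity (pullbackMetric g c.lift) z * ρ (c.lift z) ^ p - ‖z‖ ^ p
          = (volumeDensity (pullbackMetric g c.lift) z - 1) * ρ (c.lift z) ^ p
            + (ρ (c.lift z) ^ p - ‖z‖ ^ p) := by ring
      have e3 : |ρ (c.lift z) ^ p| ≤ A * ‖z‖ ^ p := by
        rw [abs_of_nonneg (Real.rpow_nonneg (by linarith [hρ.one_le (c.lift z)]) _)]
        exact h.rpow_le hz p
      have e4 : |ρ (c.lift z) ^ p - ‖z‖ ^ p| ≤ |L| * (‖z‖ ^ (-n : ℝ) * ‖z‖ ^ p) := by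
        rw [← Real.rpow_add hz0, neg_add_eq_sub]
        exact (hL z hz).trans (mul_le_mul_of_nonneg_right (le_abs_self L) (by positivity))
      rw [e2]
      refine (abs_add_le _ _).trans ?_
      rw [abs_mul]
      calc _ ≤ D * ‖z‖ ^ (-n : ℝ) * (A * ‖z‖ ^ p) + |L| * (‖z‖ ^ (-n : ℝ) * ‖z‖ ^ p) :=
            add_le_add (mul_le_mul (hD z hz).1 e3 (abs_nonneg _) (by positivity)) e4
        _ = _ := by ring
    have e5 : ‖z‖ ^ (-2 * n : ℝ) = ‖z‖ ^ (-n : ℝ) * ‖z‖ ^ p * (‖z‖ ^ 2)⁻¹ := by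
      rw [← Real.rpow_natCast, ← Real.rpow_neg hz0.le, ← Real.rpow_add hz0, ← Real.rpow_add hz0]
      congr 1
      rw [hp]
      push_cast
      ring
    rw [herr k hk z hz, e5]
    refine (abs_add_le _ _).trans ?_
    rw [abs_mul, abs_mul, abs_of_nonneg (by positivity : 0 ≤ ‖z‖ ^ p)]
    calc _ ≤ (D * A + |L|) * (‖z‖ ^ (-n : ℝ) * ‖z‖ ^ p) * (K * (‖z‖ ^ 2)⁻¹)
          + ‖z‖ ^ p * (K * ‖z‖ ^ (-n : ℝ) * (‖z‖ ^ 2)⁻¹) :=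
          add_le_add (mul_le_mul e1 hK2 (abs_nonneg _) (by positivity))
            (mul_le_mul_of_nonneg_left hK3 (by positivity))
      _ = _ := by ring
  have hδ : (-2 * n : ℝ) < -(Module.finrank ℝ (EuclideanSpace ℝ (Fin n)) : ℝ) := by
    rw [finrank_euclideanSpace_fin]
    linarith
  have hm := (isOpen_exterior (E := EuclideanSpace ℝ (Fin n)) t).measurableSet
  constructor
  · intro k hk
    exact ((integrableOn_norm_rpow h.pos hδ).const_mul _).mono'
      ((hcont k hk).aestronglyMeasurable hm)
      ((ae_restrict_iff' hm).2 (Filter.Eventually.of_forall (hle k hk)))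
  · refine tendsto_setIntegral_exterior h.pos hδ ((eventually_lt t).mono hcont)
      ((eventually_lt t).mono hle) ((eventually_lt t).mono fun k hk z hz hzk => ?_)
    rw [herr k hk z hz, metricLaplacian_cutoff_eq_zero _ hzk, flatLaplacian_cutoff_eq_zero hzk]
    simp

/-- Green's identity moves the Laplacian from `ρ ^ (2 - n)` to the cutoff function, whose Laplacian
lives in the end. There the integral is the Euclidean flux, which is the same for all `k`, plus an
error that tends to 0. -/
lemma integral_laplacian_rpow (h : c.IsAdapted ρ t) (hρ : c.IsRadiusFunction ρ)
    (hG : IsFreeRotationGroup G) (hn : 0 < n) :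
    ∫ x, laplacian g (fun x => ρ x ^ (2 - n : ℝ)) x ∂(riemannianVolume g)
      = (n - 2) * sphereVolume n / Nat.card G := by
  have : Nonempty (Fin n) := ⟨⟨0, hn⟩⟩
  have : Nontrivial (EuclideanSpace ℝ (Fin n)) := inferInstance
  set f : X → ℝ := fun x => ρ x ^ (2 - n : ℝ) with hf
  have hfs : ContMDiff (𝓡 n) 𝓘(ℝ, ℝ) ∞ f := hρ.contMDiff_rpow _
  have hf2 : ContMDiff (𝓡 n) 𝓘(ℝ, ℝ) 2 f := hfs.of_le (by norm_cast)
  have hρc := hρ.contMDiff.continuous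
  obtain ⟨herr, hlim⟩ := h.tendsto_integral_error hρ hn
  set Ω := exterior (EuclideanSpace ℝ (Fin n)) t with hΩ
  have hm : MeasurableSet Ω := (isOpen_exterior t).measurableSet
  set main : ℕ → EuclideanSpace ℝ (Fin n) → ℝ := fun k z =>
    ‖z‖ ^ (2 - n : ℝ) * flatLaplacian (ALE.cutoff k) z with hmain
  have hstep : ∀ k : ℕ, t < k → ∫ x, c.cutoff k x * laplacian g f x ∂(riemannianVolume g)
      = (Nat.card G : ℝ)⁻¹ * ((n - 2) * sphereVolume n + ∫ z in Ω,
        (volumeDensity (pullbackMetric g c.lift) z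
          * (ρ (c.lift z) ^ (2 - n : ℝ) * laplacian g (c.cutoff k) (c.lift z)) - main k z)) := by
    intro k hk
    have hχ : ContMDiff (𝓡 n) 𝓘(ℝ, ℝ) 2 (c.cutoff k) :=
      (h.contMDiff_cutoff hρc hk).of_le (by norm_cast)
    have hsupp : HasCompactSupport (c.cutoff (k : ℝ)) :=
      hasCompactSupport_cutoff (h.pos.trans hk) (by linarith [h.lt, h.pos])
    have hc1 : Continuous (fun x => c.cutoff k x * laplacian g f x) :=
      hχ.continuous.mul (continuous_laplacian g hf2)
    have hc2 : Continuous (fun x => f x * laplacian g (c.cutoff k) x) :=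
      hf2.continuous.mul (continuous_laplacian g hχ)
    have hi1 : Integrable (fun x => c.cutoff k x * laplacian g f x) (riemannianVolume g) :=
      hc1.integrable_of_hasCompactSupport hsupp.mul_right
    have hi2 : Integrable (fun x => f x * laplacian g (c.cutoff k) x) (riemannianVolume g) := by
      -- The function is the difference of the preceding one and Green's integrand, both already
      -- integrable.
      have := hi1.sub (integrable_greenIntegrand g hχ hf2 hsupp)
      refine this.congr (Filter.Eventually.of_forall fun x => ?_)
      simp [greenIntegrand]
    have h1 := integral_greenIntegrand g hχ hf2 hsupp
    simp only [greenIntegrand] at h1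
    rw [integral_sub hi1 hi2, sub_eq_zero] at h1
    rw [h1, c.integral_eq_of_end hG h.lt hc2 fun x hx => by
      rw [laplacian_eq_zero g hχ (h.cutoff_eventuallyEq_one hρc hx hk), mul_zero]]
    congr 1
    have hi3 := h.integrableOn_density_mul hG hc2 hi2
    have hi4 : IntegrableOn (main k) Ω := by
      refine (hi3.sub (herr k hk)).congr (Filter.Eventually.of_forall fun z => ?_)
      simp [hf, hmain]
    have h2 : ∫ z in Ω, main k z = (n - 2) * sphereVolume n := by
      -- The cutoff is constant near every point with ‖z‖ ≤ t < k, so the integral may be taken over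
      -- all of ℝⁿ, where the flux is known.
      rw [setIntegral_eq_integral_of_forall_compl_eq_zero fun z hz => ?_]
      · have := integral_norm_rpow_mul_flatLaplacian_cutoff (E := EuclideanSpace ℝ (Fin n))
          (h.pos.trans hk)
        rw [finrank_euclideanSpace_fin] at this
        exact this
      · have hz' : ‖z‖ ≤ t := not_lt.1 hz
        simp only [hmain]
        rw [flatLaplacian_cutoff_eq_zero (hz'.trans_lt hk), mul_zero]
    rw [integral_sub hi3 hi4, h2]
    simp only [hf]
    ring
  have h1 := h.tendsto_integral_cutoff hρc (h.integrable_laplacian_rpow hρ hG hn)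
  have h2 := (hlim.const_add ((n - 2) * sphereVolume n)).const_mul (Nat.card G : ℝ)⁻¹
  rw [tendsto_nhds_unique h1 (h2.congr' ((eventually_lt t).mono fun k hk => (hstep k hk).symm)),
    add_zero, div_eq_inv_mul]

end IsAdapted

/-- In dimension 0 the exterior domain is empty, so the compact core would be the whole manifold. -/
lemma dimension_pos [NoncompactSpace X] (c : AsymptoticCoordinates g G) : 0 < n := by
  rcases Nat.eq_zero_or_pos n with rfl | hn
  · refine absurd ?_ (noncompact_univ X)
    rw [← (eq_univ_of_forall fun x => by_contra fun hx => ?_ : c.core = univ)]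
    · exact c.isCompact_core
    · obtain ⟨z, hz, -⟩ := c.exists_lift_eq hx
      rw [Subsingleton.elim z 0, norm_zero] at hz
      exact absurd c.R_pos hz.not_gt
  · exact hn

end AsymptoticCoordinates

end FundamentalSolution

end ALE

end

theorem proposition4p3 {n : ℕ} {X : Type*} [TopologicalSpace X] [T2Space X]
    [SecondCountableTopology X] [NoncompactSpace X] [MeasurableSpace X] [BorelSpace X]
    [ChartedSpace (EuclideanSpace ℝ (Fin n)) X] [IsManifold (𝓡 n) ∞ X]
    (g : ALE.Metric n X)
    (G : Subgroup (EuclideanSpace ℝ (Fin n) ≃ₗᵢ[ℝ] EuclideanSpace ℝ (Fin n))) [Finite G]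
    (hG : ALE.IsFreeRotationGroup G)
    (c : ALE.AsymptoticCoordinates g G)
    (ρ : X → ℝ) (hρ : c.IsRadiusFunction ρ) :
    (∀ (β γ : ℝ) (u v : X → ℝ), β + γ < 2 - n →
      u ∈ ALE.weightedC g ρ 2 β → v ∈ ALE.weightedC g ρ 2 γ →
        Integrable (fun x => u x * ALE.laplacian g v x) (ALE.riemannianVolume g) ∧
        Integrable (fun x => v x * ALE.laplacian g u x) (ALE.riemannianVolume g) ∧
        ∫ x, u x * ALE.laplacian g v x ∂(ALE.riemannianVolume g)
          = ∫ x, v x * ALE.laplacian g u x ∂(ALE.riemannianVolume g)) ∧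
    ALE.laplacian g (fun x => ρ x ^ (2 - n : ℝ)) ∈ ALE.weightedCInfty g ρ (-2 * n) ∧
    Integrable (ALE.laplacian g (fun x => ρ x ^ (2 - n : ℝ))) (ALE.riemannianVolume g) ∧
    ∫ x, ALE.laplacian g (fun x => ρ x ^ (2 - n : ℝ)) x ∂(ALE.riemannianVolume g)
      = (n - 2) * ALE.sphereVolume n / Nat.card G := by
  have hX : Nonempty X := by
    by_contra hX
    rw [not_nonempty_iff] at hX
    exact noncompact_univ X (by rw [univ_eq_empty_iff.2 hX]; exact isCompact_empty)
  have hn := c.dimension_pos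
  have hρc := hρ.contMDiff.continuous
  obtain ⟨t, h⟩ := ALE.AsymptoticCoordinates.exists_isAdapted hn hρ
  exact ⟨fun β γ u v hβγ hu hv => ⟨h.integrable_mul_laplacian hG hβγ hu hv,
      h.integrable_mul_laplacian hG (by linarith) hv hu,
      h.integral_mul_laplacian_eq hρc hG hβγ hu hv⟩,
    h.laplacian_rpow_mem hρ, h.integrable_laplacian_rpow hρ hG hn,
    h.integral_laplacian_rpow hρ hG hn⟩
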